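/- Let $K=\mathbb{C}((\hbar))$, let $\overline K$ be an algebraic closure of $K$, and let $\sqrt\hbar\in\overline K$ be a square root of $\hbar$. Let $\mathfrak g$ be a finite-dimensional simple complex Lie algebra and write $\mathfrak g(F)=F\otimes_{\mathbb C}\mathfrak g$ for a field $F\supseteq\mathbb{C}$. Let $G$ be a linear algebraic group over $\mathbb{C}$ corresponding to $\mathfrak g$, i.e. with an identification $[\mathrm{Lie}\,G,\mathrm{Lie}\,G]\simeq\mathfrak g$ (for instance $\mathrm{Lie}\,G\simeq\mathfrak g$, or $G=GL_n$ and $\mathfrak g=\mathfrak{sl}_n$); then $G(\overline K)$ acts on $\mathfrak g(\overline K)$, and on its tensor square, by $\mathrm{Ad}$, and $\mathrm{Gal}(\overline K/K)$ acts on $G(\overline K)$. Let $r_{BD}$ be an $r$-matrix of the Belavin–Drinfeld list, defined over $K$, as follows. Fix a nondegenerate invariant symmetric bilinear form on $\mathfrak g$, a Cartan subalgebra $\mathfrak h\subset\mathfrak g$ with an orthonormal basis $(t_k)$, a set $\Gamma$ of simple roots, subsets $\Gamma_1,\Gamma_2\subseteq\Gamma$, and an isometric bijection $\tau:\Gamma_1\to\Gamma_2$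 such that for each $\alpha\in\Gamma_1$ some iterate $\tau^k(\alpha)$ is defined and lies in $\Gamma_2\setminus\Gamma_1$; extend $\tau$ additively to the roots in $\mathrm{Span}(\Gamma_1)$. Choose root vectors $e_\alpha$ with $(e_\alpha,e_{-\alpha})=1$ such that $e_\alpha\mapsto e_{\tau(\alpha)}$, for roots $\alpha\in\mathrm{Span}(\Gamma_1)$, extends to an isomorphism of the subalgebras generated by the root vectors of $\pm\Gamma_1$ and of $\pm\Gamma_2$. Let $r_0\in\mathfrak h(K)\otimes_K\mathfrak h(K)$ satisfy $r_0+r_0^{21}=\sum_k t_k\otimes t_k$ and $(\tau(\alpha)\otimes\mathrm{id}+\mathrm{id}\otimes\alpha)r_0=0$ for all $\alpha\in\Gamma_1$. Then $$r_{BD}=r_0+\sum_{\alpha>0}e_{-\alpha}\otimes e_\alpha+\sum_{\alpha\in\mathrm{Span}(\Gamma_1)^+}\ \sum_{k\ge1}e_{-\alpha}\wedge e_{\tau^k(\alpha)},\qquad x\wedge y=x\otimes y-y\otimes x,$$ the inner sum being over those $k\ge 1$ for which $\tau^k(\alpha)$ is defined. Let $a=\kappa\sqrt\hbar$ with $\kappa\in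 K^\times$, and let $X\in G(\overline K)$. Then $a\,\mathrm{Ad}_X r_{BD}$ defines a Lie bialgebra structure on $\mathfrak g(K)$ (that is, $x\mapsto[x\otimes1+1\otimes x,\;a\,\mathrm{Ad}_Xr_{BD}]$ maps $\mathfrak g(K)$ to $\mathfrak g(K)\otimes_K\mathfrak g(K)$, and is a Lie cobracket making $\mathfrak g(K)$ a Lie bialgebra) if and only if the following two conditions hold: 1. $X$ is a non-twisted Belavin–Drinfeld cocycle over the field $K[\sqrt\hbar]$: $\mathrm{Ad}_{X^{-1}\sigma(X)}r_{BD}=r_{BD}$ for every $\sigma\in\mathrm{Gal}(\overline K/K[\sqrt\hbar])$; 2. $\mathrm{Ad}_{X^{-1}\sigma_0(X)}r_{BD}=r_{BD}^{21}$, where $\sigma_0$ is the non-trivial element of $\mathrm{Gal}(K[\sqrt\hbar]/K)$, extended to an arbitrary (fixed) automorphism of $\overline K$ in order to act on $X$. -/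

import Mathlib

open scoped TensorProduct
open IntermediateField

noncomputable section

namespace TwistedBD

/-! ### The fields -/

/-- The field `ℂ((ħ))` of formal Laurent series. -/
abbrev K : Type := LaurentSeries ℂ

/-- An algebraic closure of `ℂ((ħ))`. -/
abbrev Kbar : Type := AlgebraicClosure K

/-- The formal parameter `ħ ∈ ℂ((ħ))`. -/
def hbar : K := HahnSeries.single (1 : ℤ) (1 : ℂ)

/-! ### Lie bialgebras -/

section Bialgebra

variable (F L : Type*) [Field F] [LieRing L] [LieAlgebra F L]

/-- The cyclic permutation `x ⊗ (y ⊗ z) ↦ y ⊗ (z ⊗ x)`. -/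
def cyc : L ⊗[F] (L ⊗[F] L) →ₗ[F] L ⊗[F] (L ⊗[F] L) :=
  (TensorProduct.assoc F L L L).toLinearMap ∘ₗ (TensorProduct.comm F L (L ⊗[F] L)).toLinearMap

/-- `δ : L → L ⊗ L` is a Lie bialgebra structure (a Lie cobracket) on the Lie algebra `L`:
it is skew-symmetric, satisfies the co-Jacobi identity, and is a 1-cocycle. -/
structure IsLieCobracket (δ : L →ₗ[F] L ⊗[F] L) : Prop where
  skew : ∀ x, TensorProduct.comm F L L (δ x) = -δ x
  coJacobi : ∀ x, δ.lTensor L (δ x) + cyc F L (δ.lTensor L (δ x))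
    + cyc F L (cyc F L (δ.lTensor L (δ x))) = 0
  cocycle : ∀ x y : L, δ ⁅x, y⁆ = ⁅x, δ y⁆ - ⁅y, δ x⁆

end Bialgebra

/-! ### Extension of scalars from `F` to `E` of `F ⊗ 𝔤` and of its tensor square -/

section Scalars

variable (F E : Type*) [Field F] [Field E] [Algebra ℂ F] [Algebra ℂ E] [Algebra F E]
  [IsScalarTower ℂ F E] (𝔤 : Type*) [LieRing 𝔤] [LieAlgebra ℂ 𝔤]

/-- The inclusion `𝔤(F) → 𝔤(E)`, `x ⊗ y ↦ x ⊗ y`. -/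
def ext₁ : F ⊗[ℂ] 𝔤 →ₗ[F] E ⊗[ℂ] 𝔤 :=
  TensorProduct.AlgebraTensorModule.map (Algebra.linearMap F E) LinearMap.id

/-- The inclusion `𝔤(F) ⊗_F 𝔤(F) → 𝔤(E) ⊗_E 𝔤(E)`. -/
def ext₂ : (F ⊗[ℂ] 𝔤) ⊗[F] (F ⊗[ℂ] 𝔤) →ₗ[F] (E ⊗[ℂ] 𝔤) ⊗[E] (E ⊗[ℂ] 𝔤) :=
  TensorProduct.lift <| LinearMap.mk₂ F (fun x y => ext₁ F E 𝔤 x ⊗ₜ[E] ext₁ F E 𝔤 y)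
    (fun x x' y => by rw [map_add, TensorProduct.add_tmul])
    (fun c x y => by rw [map_smul, TensorProduct.smul_tmul'])
    (fun x y y' => by rw [map_add, TensorProduct.tmul_add])
    (fun c x y => by rw [map_smul, ← algebraMap_smul E c (ext₁ F E 𝔤 y),
      TensorProduct.tmul_smul, algebraMap_smul])

/-- The tensor `t ∈ 𝔤(E) ⊗_E 𝔤(E)` defines a Lie bialgebra structure on `𝔤(F)`: the coboundary
`x ↦ [x ⊗ 1 + 1 ⊗ x, t]` maps `𝔤(F)` to `𝔤(F) ⊗_F 𝔤(F)`, and the resulting map is a Lie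
bialgebra structure on the Lie algebra `𝔤(F)` over `F`. -/
def DefinesLieBialgebra (t : (E ⊗[ℂ] 𝔤) ⊗[E] (E ⊗[ℂ] 𝔤)) : Prop :=
  ∃ δ : F ⊗[ℂ] 𝔤 →ₗ[F] (F ⊗[ℂ] 𝔤) ⊗[F] (F ⊗[ℂ] 𝔤),
    IsLieCobracket F (F ⊗[ℂ] 𝔤) δ ∧ ∀ x, ext₂ F E 𝔤 (δ x) = ⁅ext₁ F E 𝔤 x, t⁆

end Scalars

/-! ### Linear algebraic groups over `ℂ`, their Lie algebras, and the adjoint action -/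

/-- The matrix `M` satisfies the polynomial equations `eqs` in the matrix entries. -/
def Vanishes {n : ℕ} (eqs : Set (MvPolynomial (Fin n × Fin n) ℂ)) {R : Type} [CommRing R]
    [Algebra ℂ R] (M : Matrix (Fin n) (Fin n) R) : Prop :=
  ∀ f ∈ eqs, MvPolynomial.aeval (fun p : Fin n × Fin n => M p.1 p.2) f = 0

/-- A linear algebraic group over `ℂ`: a closed subgroup scheme of `GL_n`, given by polynomial
equations whose invertible solutions form a group over every commutative `ℂ`-algebra. -/
structure LinAlgGroup (n : ℕ) where
  eqs : Set (MvPolynomial (Fin n × Fin n) ℂ)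
  one_mem : ∀ (R : Type) [CommRing R] [Algebra ℂ R],
    Vanishes eqs (1 : Matrix (Fin n) (Fin n) R)
  mul_mem : ∀ (R : Type) [CommRing R] [Algebra ℂ R] (X Y : GL (Fin n) R),
    Vanishes eqs X.val → Vanishes eqs Y.val → Vanishes eqs (X * Y).val
  inv_mem : ∀ (R : Type) [CommRing R] [Algebra ℂ R] (X : GL (Fin n) R),
    Vanishes eqs X.val → Vanishes eqs (X⁻¹).val

namespace LinAlgGroup

variable {n : ℕ} (G : LinAlgGroup n)

/-- The group `G(R)` of `R`-points. -/
def points (R : Type) [CommRing R] [Algebra ℂ R] : Subgroup (GL (Fin n) R) where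
  carrier := {X | Vanishes G.eqs X.val}
  one_mem' := G.one_mem R
  mul_mem' := fun {X Y} hX hY => G.mul_mem R X Y hX hY
  inv_mem' := fun {X} hX => G.inv_mem R X hX

theorem vanishes_map {eqs : Set (MvPolynomial (Fin n × Fin n) ℂ)} {R S : Type} [CommRing R]
    [Algebra ℂ R] [CommRing S] [Algebra ℂ S] (φ : R →ₐ[ℂ] S) {M : Matrix (Fin n) (Fin n) R}
    (hM : Vanishes eqs M) : Vanishes eqs (M.map φ) := by
  intro f hf
  have h := congrArg φ (hM f hf)
  rw [map_zero, ← AlgHom.comp_apply, MvPolynomial.comp_aeval] at h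
  exact h

/-- The homomorphism `G(R) → G(S)` induced by a homomorphism `R → S` of `ℂ`-algebras
(apply it to each matrix entry). For an automorphism `σ` of `R` this is `X ↦ σ(X)`. -/
def mapPoints {R S : Type} [CommRing R] [Algebra ℂ R] [CommRing S] [Algebra ℂ S]
    (φ : R →ₐ[ℂ] S) : G.points R →* G.points S :=
  ((Matrix.GeneralLinearGroup.map (n := Fin n) φ.toRingHom).comp (G.points R).subtype).codRestrict
    (G.points S) fun X => vanishes_map φ X.2

/-- The tangent space at the identity of `G` over `R`: the matrices `y` with
`1 + ε y ∈ G(R[ε])`, `ε² = 0`; here `TrivSqZeroExt.inr r` is the element `ε r` of `R[ε]`.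
For `R = ℂ` this is the Lie algebra of `G`. -/
def tangent (R : Type) [CommRing R] [Algebra ℂ R] : Set (Matrix (Fin n) (Fin n) R) :=
  {y | Vanishes G.eqs (R := DualNumber R)
    (1 + y.map TrivSqZeroExt.inr)}

/-- The derived algebra `[Lie G, Lie G]` of the Lie algebra `Lie G ⊆ 𝔤𝔩_n(ℂ)`. -/
def derivedLie : Submodule ℂ (Matrix (Fin n) (Fin n) ℂ) :=
  Submodule.span ℂ {z | ∃ x ∈ G.tangent ℂ, ∃ y ∈ G.tangent ℂ, x * y - y * x = z}

/-- `G` is an algebraic group corresponding to the simple Lie algebra `𝔤`: an identification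
of `𝔤` with `[Lie G, Lie G]`. This includes all `G` with `Lie G ≃ 𝔤` (as then
`[Lie G, Lie G] = Lie G`), and `G = GL_n` for `𝔤 = 𝔰𝔩_n`. -/
structure Corresponds (𝔤 : Type*) [LieRing 𝔤] [LieAlgebra ℂ 𝔤] where
  ι : 𝔤 →ₗ[ℂ] Matrix (Fin n) (Fin n) ℂ
  map_lie : ∀ x y, ι ⁅x, y⁆ = ι x * ι y - ι y * ι x
  injective : Function.Injective ι
  range_eq : LinearMap.range ι = G.derivedLie

theorem aeval_dual {σ : Type} [Fintype σ] {R : Type} [CommRing R] [Algebra ℂ R]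
    (c y : σ → R) (f : MvPolynomial σ ℂ) :
    MvPolynomial.aeval (R := ℂ) (S₁ := DualNumber R)
      (fun i => TrivSqZeroExt.inl (c i) + TrivSqZeroExt.inr (y i)) f
    = TrivSqZeroExt.inl (MvPolynomial.aeval c f)
      + TrivSqZeroExt.inr (∑ i, MvPolynomial.aeval c (MvPolynomial.pderiv i f) * y i) := by
  classical
  induction f using MvPolynomial.induction_on with
  | C a =>
    rw [MvPolynomial.aeval_C, MvPolynomial.aeval_C]
    simp only [MvPolynomial.pderiv_C, map_zero, zero_mul, Finset.sum_const_zero,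
      TrivSqZeroExt.inr_zero, add_zero]
    rfl
  | add p q hp hq =>
    rw [map_add, hp, hq]
    simp only [map_add, add_mul, Finset.sum_add_distrib, TrivSqZeroExt.inl_add,
      TrivSqZeroExt.inr_add]
    abel
  | mul_X p i hp =>
    rw [map_mul, hp, MvPolynomial.aeval_X]
    have h : ∀ j, MvPolynomial.aeval c (MvPolynomial.pderiv j (p * MvPolynomial.X i)) * y j
        = c i * (MvPolynomial.aeval c (MvPolynomial.pderiv j p) * y j)
          + (if i = j then MvPolynomial.aeval c p * y j else 0) := by
      intro j
      rw [MvPolynomial.pderiv_mul, MvPolynomial.pderiv_X]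
      by_cases hij : i = j
      · subst hij
        simp
        ring
      · simp [hij]
        ring
    simp only [h, Finset.sum_add_distrib, ← Finset.mul_sum, Finset.sum_ite_eq, Finset.mem_univ,
      if_true]
    ext
    · simp
    · simp
      ring

theorem mem_tangent_iff {R : Type} [CommRing R] [Algebra ℂ R] (y : Matrix (Fin n) (Fin n) R) :
    y ∈ G.tangent R ↔ ∀ f ∈ G.eqs, ∑ p : Fin n × Fin n,
      (MvPolynomial.aeval (fun q : Fin n × Fin n => (1 : Matrix (Fin n) (Fin n) ℂ) q.1 q.2)
        (MvPolynomial.pderiv p f)) • y p.1 p.2 = 0 := by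
  refine forall₂_congr fun f hf => ?_
  have h1 : (fun p : Fin n × Fin n => ((1 : Matrix (Fin n) (Fin n) (DualNumber R))
      + y.map (TrivSqZeroExt.inr : R → DualNumber R)) p.1 p.2)
      = fun p => TrivSqZeroExt.inl ((1 : Matrix (Fin n) (Fin n) R) p.1 p.2)
        + TrivSqZeroExt.inr (y p.1 p.2) := by
    funext p
    by_cases h : p.1 = p.2
    · simp [h, Matrix.one_apply]
    · simp [h]
  have h2 : (fun q : Fin n × Fin n => (1 : Matrix (Fin n) (Fin n) R) q.1 q.2)
      = fun q => Algebra.ofId ℂ R ((1 : Matrix (Fin n) (Fin n) ℂ) q.1 q.2) := by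
    funext q
    by_cases h : q.1 = q.2 <;> simp [h, Matrix.one_apply]
  have h3 : ∀ g : MvPolynomial (Fin n × Fin n) ℂ,
      MvPolynomial.aeval (fun q : Fin n × Fin n => (1 : Matrix (Fin n) (Fin n) R) q.1 q.2) g
      = algebraMap ℂ R (MvPolynomial.aeval
        (fun q : Fin n × Fin n => (1 : Matrix (Fin n) (Fin n) ℂ) q.1 q.2) g) := by
    intro g
    rw [h2]
    exact (MvPolynomial.comp_aeval_apply (B := R) _ (Algebra.ofId ℂ R) g).symm
  rw [h1, aeval_dual, G.one_mem R f hf]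
  simp only [h3, Algebra.smul_def, TrivSqZeroExt.inl_zero, zero_add]
  exact ⟨fun h => TrivSqZeroExt.inr_injective (h.trans (TrivSqZeroExt.inr_zero R).symm),
    fun h => by rw [h, TrivSqZeroExt.inr_zero]⟩

section Field

variable (S : Type) [Field S] [Algebra ℂ S]

/-- The `S`-span of a set of complex matrices. -/
def spanOver (A : Set (Matrix (Fin n) (Fin n) ℂ)) : Submodule S (Matrix (Fin n) (Fin n) S) :=
  Submodule.span S ((fun y => y.map (algebraMap ℂ S)) '' A)

theorem tangent_le_span {y : Matrix (Fin n) (Fin n) S} (hy : y ∈ G.tangent S) :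
    y ∈ spanOver S (G.tangent ℂ) := by
  classical
  rw [mem_tangent_iff] at hy
  let b := Module.Basis.ofVectorSpace ℂ S
  let I : Finset (Module.Basis.ofVectorSpaceIndex ℂ S) :=
    Finset.univ.biUnion fun p : Fin n × Fin n => (b.repr (y p.1 p.2)).support
  have hsum : y = ∑ k ∈ I, b k • (Matrix.of fun i j => b.repr (y i j) k).map (algebraMap ℂ S) := by
    ext i j
    rw [Matrix.sum_apply]
    have h := b.linearCombination_repr (y i j)
    rw [Finsupp.linearCombination_apply, Finsupp.sum_of_support_subset (s := I)] at h
    · rw [← h]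
      refine Finset.sum_congr rfl fun k _ => ?_
      simp [Algebra.smul_def, mul_comm]
    · exact fun k hk => Finset.mem_biUnion.2 ⟨(i, j), Finset.mem_univ _, hk⟩
    · simp
  rw [hsum]
  refine Submodule.sum_mem _ fun k _ => Submodule.smul_mem _ _ (Submodule.subset_span ⟨_, ?_, rfl⟩)
  rw [mem_tangent_iff]
  intro f hf
  have h := congrArg (fun z => b.repr z k) (hy f hf)
  simpa [Finsupp.finsetSum_apply] using h

theorem conj_tangent {R : Type} [CommRing R] [Algebra ℂ R] (X : G.points R)
    {y : Matrix (Fin n) (Fin n) R} (hy : y ∈ G.tangent R) :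
    X.1.val * y * (X.1⁻¹).val ∈ G.tangent R := by
  have hmul : ∀ A B : Matrix (Fin n) (Fin n) R,
      A.map (TrivSqZeroExt.inr : R → DualNumber R) * B.map (TrivSqZeroExt.inr : R → DualNumber R)
        = 0 := by
    intro A B
    ext i j
    all_goals simp [Matrix.mul_apply]
  have hl : ∀ A B : Matrix (Fin n) (Fin n) R,
      A.map (TrivSqZeroExt.inl : R → DualNumber R) * B.map (TrivSqZeroExt.inr : R → DualNumber R)
        = (A * B).map (TrivSqZeroExt.inr : R → DualNumber R) := by
    intro A B
    ext i j : 1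
    rw [Matrix.mul_apply, Matrix.map_apply, Matrix.mul_apply]
    refine Eq.trans ?_ (map_sum (TrivSqZeroExt.inrHom R R) _ _).symm
    exact Finset.sum_congr rfl fun k _ => TrivSqZeroExt.inl_mul_inr _ _
  have hr : ∀ A B : Matrix (Fin n) (Fin n) R,
      A.map (TrivSqZeroExt.inr : R → DualNumber R) * B.map (TrivSqZeroExt.inl : R → DualNumber R)
        = (A * B).map (TrivSqZeroExt.inr : R → DualNumber R) := by
    intro A B
    ext i j : 1
    rw [Matrix.mul_apply, Matrix.map_apply, Matrix.mul_apply]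
    refine Eq.trans ?_ (map_sum (TrivSqZeroExt.inrHom R R) _ _).symm
    exact Finset.sum_congr rfl fun k _ => TrivSqZeroExt.inr_mul_inl _ _
  let U : GL (Fin n) (DualNumber R) :=
    ⟨1 + y.map TrivSqZeroExt.inr, 1 - y.map TrivSqZeroExt.inr,
      by rw [add_mul, mul_sub, mul_sub, hmul]; simp, by rw [sub_mul, mul_add, mul_add, hmul]; simp⟩
  let X' : G.points (DualNumber R) := G.mapPoints (TrivSqZeroExt.inlAlgHom ℂ R R) X
  let V : G.points (DualNumber R) := X' * ⟨U, hy⟩ * X'⁻¹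
  have hX : X'.1.val = X.1.val.map (TrivSqZeroExt.inl : R → DualNumber R) := rfl
  have hXi : (X'.1⁻¹).val = (X.1⁻¹).val.map (TrivSqZeroExt.inl : R → DualNumber R) := by
    have h : X'⁻¹ = G.mapPoints (TrivSqZeroExt.inlAlgHom ℂ R R) X⁻¹ := (map_inv _ _).symm
    exact congrArg (fun Z : G.points (DualNumber R) => Z.1.val) h
  have hV : V.1.val = 1 + (X.1.val * y * (X.1⁻¹).val).map TrivSqZeroExt.inr := by
    change X'.1.val * (1 + y.map TrivSqZeroExt.inr) * (X'.1⁻¹).val = _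
    rw [mul_add, mul_one, add_mul, Units.mul_inv, hX, hXi, hl, hr]
  change Vanishes G.eqs _
  rw [← hV]
  exact V.2

/-- Conjugation by an invertible matrix. -/
def conj (X : GL (Fin n) S) : Matrix (Fin n) (Fin n) S →ₗ[S] Matrix (Fin n) (Fin n) S :=
  LinearMap.mulRight S (X⁻¹).val ∘ₗ LinearMap.mulLeft S X.val

theorem conj_derived (X : G.points S) :
    spanOver S (G.derivedLie : Set (Matrix (Fin n) (Fin n) ℂ))
      ≤ (spanOver S (G.derivedLie : Set (Matrix (Fin n) (Fin n) ℂ))).comap (conj S X.1) := by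
  let W := spanOver S (G.derivedLie : Set (Matrix (Fin n) (Fin n) ℂ))
  have key : ∀ u ∈ spanOver S (G.tangent ℂ), ∀ v ∈ spanOver S (G.tangent ℂ),
      u * v - v * u ∈ W := by
    intro u hu v hv
    induction hu using Submodule.span_induction with
    | mem u hu =>
      obtain ⟨u, hu, rfl⟩ := hu
      induction hv using Submodule.span_induction with
      | mem v hv =>
        obtain ⟨v, hv, rfl⟩ := hv
        refine Submodule.subset_span ⟨u * v - v * u, Submodule.subset_span ⟨u, hu, v, hv, rfl⟩, ?_⟩
        simp only [Matrix.map_sub _ (map_sub (algebraMap ℂ S)), Matrix.map_mul]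
      | zero => simp
      | add v w _ _ hv hw =>
        have := W.add_mem hv hw
        convert this using 1
        noncomm_ring
      | smul c v _ hv =>
        have := W.smul_mem c hv
        convert this using 1
        rw [mul_smul_comm, smul_mul_assoc, smul_sub]
    | zero => simp
    | add u w _ _ hu hw =>
      have := W.add_mem hu hw
      convert this using 1
      noncomm_ring
    | smul c u _ hu =>
      have := W.smul_mem c hu
      convert this using 1
      rw [mul_smul_comm, smul_mul_assoc, smul_sub]
  have htan : ∀ u ∈ G.tangent ℂ, conj S X.1 (u.map (algebraMap ℂ S)) ∈ spanOver S (G.tangent ℂ) := by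
    intro u hu
    refine G.tangent_le_span S (G.conj_tangent X ?_)
    rw [mem_tangent_iff] at hu ⊢
    intro f hf
    have h := congrArg (algebraMap ℂ S) (hu f hf)
    rw [map_sum, map_zero] at h
    rw [← h]
    refine Finset.sum_congr rfl fun p _ => ?_
    rw [Matrix.map_apply, Algebra.smul_def, smul_eq_mul, map_mul]
  refine Submodule.span_le.2 ?_
  rintro _ ⟨z, hz, rfl⟩
  change conj S X.1 (z.map (algebraMap ℂ S)) ∈ W
  induction hz using Submodule.span_induction with
  | mem z hz =>
    obtain ⟨u, hu, v, hv, rfl⟩ := hz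
    have := key _ (htan u hu) _ (htan v hv)
    convert this using 1
    rw [Matrix.map_sub _ (map_sub (algebraMap ℂ S)), Matrix.map_mul, Matrix.map_mul, map_sub]
    have hc : ∀ A B, conj S X.1 (A * B) = conj S X.1 A * conj S X.1 B := by
      intro A B
      change X.1.val * (A * B) * (X.1⁻¹).val
        = X.1.val * A * (X.1⁻¹).val * (X.1.val * B * (X.1⁻¹).val)
      have h : (X.1⁻¹).val * X.1.val = 1 := Units.inv_mul _
      calc _ = X.1.val * A * 1 * B * (X.1⁻¹).val := by simp only [mul_assoc, mul_one]
        _ = _ := by rw [← h]; simp only [mul_assoc]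
    rw [hc, hc]
  | zero => simp
  | add z w _ _ hz hw =>
    rw [Matrix.map_add _ (map_add (algebraMap ℂ S)), map_add]
    exact W.add_mem hz hw
  | smul c z _ hz =>
    have h : (c • z).map (algebraMap ℂ S) = algebraMap ℂ S c • z.map (algebraMap ℂ S) := by
      ext i j
      simp
    rw [h, map_smul]
    exact W.smul_mem _ hz

namespace Corresponds

variable {G} {𝔤 : Type*} [LieRing 𝔤] [LieAlgebra ℂ 𝔤] (c : G.Corresponds 𝔤)

/-- The embedding `S ⊗ 𝔤 → 𝔤𝔩_n(S)` induced by `𝔤 ≃ [Lie G, Lie G] ⊆ 𝔤𝔩_n(ℂ)`. -/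
def ιExt : S ⊗[ℂ] 𝔤 →ₗ[S] Matrix (Fin n) (Fin n) S :=
  ((Algebra.linearMap ℂ S).mapMatrix ∘ₗ c.ι).liftBaseChange S

theorem ιExt_tmul (s : S) (y : 𝔤) :
    c.ιExt S (s ⊗ₜ y) = s • (c.ι y).map (algebraMap ℂ S) := rfl

theorem ιExt_injective : Function.Injective (c.ιExt S) := by
  have h : ∀ y, c.ιExt S y = (matrixEquivTensor (Fin n) ℂ S).symm (c.ι.lTensor S y) := by
    intro y
    induction y using TensorProduct.induction_on with
    | zero => simp
    | add x y hx hy => rw [map_add, map_add, map_add, hx, hy]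
    | tmul s y =>
      rw [ιExt_tmul, LinearMap.lTensor_tmul, matrixEquivTensor_apply_symm]
  intro x y hxy
  rw [h, h] at hxy
  exact Module.Flat.lTensor_preserves_injective_linearMap (M := S) c.ι c.injective
    ((matrixEquivTensor (Fin n) ℂ S).symm.injective hxy)

theorem range_ιExt : LinearMap.range (c.ιExt S)
    = spanOver S (G.derivedLie : Set (Matrix (Fin n) (Fin n) ℂ)) := by
  apply le_antisymm
  · rintro _ ⟨y, rfl⟩
    induction y using TensorProduct.induction_on with
    | zero => simp
    | add x y hx hy => rw [map_add]; exact Submodule.add_mem _ hx hy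
    | tmul s y =>
      rw [ιExt_tmul]
      refine Submodule.smul_mem _ _ (Submodule.subset_span ⟨_, ?_, rfl⟩)
      rw [← c.range_eq]
      exact ⟨y, rfl⟩
  · refine Submodule.span_le.2 ?_
    rintro _ ⟨z, hz, rfl⟩
    rw [← c.range_eq] at hz
    obtain ⟨y, rfl⟩ := hz
    exact ⟨1 ⊗ₜ y, by rw [ιExt_tmul, one_smul]⟩

/-- The adjoint action `Ad_X` of `X ∈ G(S)` on `𝔤(S) = S ⊗ 𝔤`: conjugation by `X`, transported
along the embedding of `S ⊗ 𝔤` in `𝔤𝔩_n(S)`. -/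
def Ad (X : G.points S) : S ⊗[ℂ] 𝔤 →ₗ[S] S ⊗[ℂ] 𝔤 :=
  (LinearEquiv.ofInjective (c.ιExt S) (c.ιExt_injective S)).symm.toLinearMap ∘ₗ
    (conj S X.1 ∘ₗ c.ιExt S).codRestrict (LinearMap.range (c.ιExt S)) (fun y => by
      have h := G.conj_derived S X
      rw [← c.range_ιExt S] at h
      exact h ⟨y, rfl⟩)

theorem ιExt_Ad (X : G.points S) (y : S ⊗[ℂ] 𝔤) :
    c.ιExt S (c.Ad S X y) = X.1.val * c.ιExt S y * (X.1⁻¹).val := by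
  have h := LinearEquiv.apply_symm_apply
    (LinearEquiv.ofInjective (c.ιExt S) (c.ιExt_injective S))
    ((conj S X.1 ∘ₗ c.ιExt S).codRestrict (LinearMap.range (c.ιExt S)) (fun y => by
      have h := G.conj_derived S X
      rw [← c.range_ιExt S] at h
      exact h ⟨y, rfl⟩) y)
  exact congrArg Subtype.val h

/-- The adjoint action of `X ∈ G(S)` on `𝔤(S) ⊗ 𝔤(S)`. -/
def Ad₂ (X : G.points S) :
    (S ⊗[ℂ] 𝔤) ⊗[S] (S ⊗[ℂ] 𝔤) →ₗ[S] (S ⊗[ℂ] 𝔤) ⊗[S] (S ⊗[ℂ] 𝔤) :=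
  TensorProduct.map (c.Ad S X) (c.Ad S X)

end Corresponds

end Field

end LinAlgGroup

/-! ### Belavin–Drinfeld data -/

section BD

variable {𝔤 : Type*} [LieRing 𝔤] [LieAlgebra ℂ 𝔤] [FiniteDimensional ℂ 𝔤]
  [LieAlgebra.IsSimple ℂ 𝔤]

/-- An admissible triple `(Γ₁, Γ₂, τ)` for a base of the root system of `(𝔤, H)`. Only the values
of `τ` on `Γ₁` matter. -/
structure AdmissibleTriple (H : LieSubalgebra ℂ 𝔤) [H.IsCartanSubalgebra]
    (b : (LieAlgebra.IsKilling.rootSystem H).Base) where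
  Γ₁ : Finset H.root
  Γ₂ : Finset H.root
  Γ₁_subset : Γ₁ ⊆ b.support
  Γ₂_subset : Γ₂ ⊆ b.support
  τ : H.root → H.root
  bijOn : Set.BijOn τ Γ₁ Γ₂
  /-- For every `α ∈ Γ₁` some iterate `τ^k(α)` is defined and lies in `Γ₂ \ Γ₁`. -/
  nilpotent : ∀ α ∈ Γ₁, ∃ β ∈ Γ₂, β ∉ Γ₁ ∧
    Relation.ReflTransGen (fun γ γ' => γ ∈ Γ₁ ∧ τ γ = γ') α β

namespace AdmissibleTriple

variable {H : LieSubalgebra ℂ 𝔤} [H.IsCartanSubalgebra]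
  {b : (LieAlgebra.IsKilling.rootSystem H).Base} (T : AdmissibleTriple H b)

/-- `α` is a root in `Span(Γ₁)`, and `β = τ(α)`, where `τ` is extended additively from `Γ₁`
to `Span(Γ₁)`. -/
def Ext (α β : H.root) : Prop :=
  ∃ m : H.root → ℤ,
    (LieAlgebra.IsKilling.rootSystem H).root α
      = ∑ γ ∈ T.Γ₁, m γ • (LieAlgebra.IsKilling.rootSystem H).root γ ∧
    (LieAlgebra.IsKilling.rootSystem H).root β
      = ∑ γ ∈ T.Γ₁, m γ • (LieAlgebra.IsKilling.rootSystem H).root (T.τ γ)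

/-- `β = τ^k(α)` for some `k ≥ 1`, where `α, τ(α), …, τ^(k-1)(α)` are positive roots in
`Span(Γ₁)`. -/
def Prec (α β : H.root) : Prop :=
  Relation.TransGen (fun γ γ' => b.IsPos γ ∧ T.Ext γ γ') α β

end AdmissibleTriple

/-- The scalar extension `F ⊗ H → F` of a linear form on the Cartan subalgebra. -/
def formExt (F : Type*) [Field F] [Algebra ℂ F] {H : LieSubalgebra ℂ 𝔤}
    (χ : Module.Dual ℂ H) : F ⊗[ℂ] H →ₗ[F] F :=
  ((Algebra.linearMap ℂ F) ∘ₗ χ).liftBaseChange F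

variable (𝔤) in
/-- The data entering the Belavin–Drinfeld list of non-skew-symmetric `r`-matrices of a simple
complex Lie algebra `𝔤`, with the Cartan part `r₀` defined over the extension field `F` of `ℂ`. -/
structure BDData (F : Type*) [Field F] [Algebra ℂ F] where
  /-- the invariant form on `𝔤` with respect to which things are normalized -/
  B : LinearMap.BilinForm ℂ 𝔤
  B_symm : B.IsSymm
  B_nondegenerate : B.Nondegenerate
  B_invariant : B.lieInvariant 𝔤
  H : LieSubalgebra ℂ 𝔤
  [cartan : H.IsCartanSubalgebra]
  base : (LieAlgebra.IsKilling.rootSystem H).Base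
  /-- an orthonormal basis of the Cartan subalgebra -/
  t : Module.Basis (Fin (Module.finrank ℂ H)) ℂ H
  t_orthonormal : ∀ i j, B (t i) (t j) = if i = j then 1 else 0
  triple : AdmissibleTriple H base
  /-- `τ` is isometric; `(α, β) = ∑ k, α(t_k) β(t_k)` is the form induced by `B` on the dual. -/
  isometric : ∀ α ∈ triple.Γ₁, ∀ β ∈ triple.Γ₁,
    ∑ k, (triple.τ α).1 (t k) * (triple.τ β).1 (t k) = ∑ k, α.1 (t k) * β.1 (t k)
  /-- root vectors; only the values at roots matter -/
  e : LieModule.Weight ℂ H 𝔤 → 𝔤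
  e_mem : ∀ α : H.root, e α ∈ LieAlgebra.rootSpace H α.1
  e_normalized : ∀ α : H.root, B (e α) (e (-α.1)) = 1
  /-- The root vectors are compatible with `τ`: the structure constants of the `e_α` with
  `α ∈ Span(Γ₁)` are preserved by `τ`, i.e. `e_α ↦ e_{τ(α)}` extends to an isomorphism of the
  semisimple subalgebras of `𝔤` generated by the root vectors of `± Γ₁` and `± Γ₂`. -/
  e_compatible : ∀ α β γ α' β' γ' : H.root,
    triple.Ext α α' → triple.Ext β β' → triple.Ext γ γ' →
      ∀ c : ℂ, ⁅e α, e β⁆ = c • e γ → ⁅e α', e β'⁆ = c • e γ'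
  r₀ : (F ⊗[ℂ] H) ⊗[F] (F ⊗[ℂ] H)
  r₀_symm : r₀ + TensorProduct.comm F _ _ r₀
    = ∑ k, ((1 : F) ⊗ₜ[ℂ] t k) ⊗ₜ[F] ((1 : F) ⊗ₜ[ℂ] t k)
  /-- `(τ(α) ⊗ id + id ⊗ α) r₀ = 0` -/
  r₀_triple : ∀ α ∈ triple.Γ₁,
    TensorProduct.lid F _ ((formExt F ((LieAlgebra.IsKilling.rootSystem H).root
        (triple.τ α))).rTensor _ r₀)
      + TensorProduct.rid F _ ((formExt F ((LieAlgebra.IsKilling.rootSystem H).root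
        α)).lTensor _ r₀) = 0

attribute [instance] BDData.cartan

namespace BDData

variable {F : Type*} [Field F] [Algebra ℂ F] (D : BDData 𝔤 F)

/-- The tensor `x ⊗ y`, for `x, y ∈ 𝔤`, as an element of `𝔤(F) ⊗ 𝔤(F)`. -/
def tens (F : Type*) [Field F] [Algebra ℂ F] (x y : 𝔤) : (F ⊗[ℂ] 𝔤) ⊗[F] (F ⊗[ℂ] 𝔤) :=
  ((1 : F) ⊗ₜ[ℂ] x) ⊗ₜ[F] ((1 : F) ⊗ₜ[ℂ] y)

open Classical in
/-- The Belavin–Drinfeld `r`-matrix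
`r₀ + ∑_{α > 0} e_{-α} ⊗ e_α + ∑_{α ∈ Span(Γ₁)⁺} ∑_{k ≥ 1} e_{-α} ∧ e_{τ^k(α)}`,
where `x ∧ y = x ⊗ y - y ⊗ x` (by nilpotency of `τ`, the roots `τ^k(α)` with different `k`
are different). -/
def r : (F ⊗[ℂ] 𝔤) ⊗[F] (F ⊗[ℂ] 𝔤) :=
  TensorProduct.map (D.H.toSubmodule.subtype.baseChange F) (D.H.toSubmodule.subtype.baseChange F)
      D.r₀
    + ∑ α : D.H.root with D.base.IsPos α, tens F (D.e (-α.1)) (D.e α)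
    + ∑ α : D.H.root, ∑ β : D.H.root with D.triple.Prec α β,
        (tens F (D.e (-α.1)) (D.e β) - tens F (D.e β) (D.e (-α.1)))

end BDData

end BD

/-! ### Cocycles -/

/-- The automorphism `σ` of `ℂ((ħ))^alg` over `ℂ((ħ))` acting on `G` of the algebraic closure. -/
def galAct {n : ℕ} (G : LinAlgGroup n) (σ : Kbar ≃ₐ[K] Kbar) : G.points Kbar →* G.points Kbar :=
  G.mapPoints (σ.toAlgHom.restrictScalars ℂ)

section Cocycle

variable {n : ℕ} {G : LinAlgGroup n} {𝔤 : Type*} [LieRing 𝔤] [LieAlgebra ℂ 𝔤]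
  (c : G.Corresponds 𝔤)

/-- The centralizer `C(r)`: the set of `X ∈ G(ℂ((ħ))^alg)` with `Ad_X r = r`. -/
def centralizer (r : (Kbar ⊗[ℂ] 𝔤) ⊗[Kbar] (Kbar ⊗[ℂ] 𝔤)) : Set (G.points Kbar) :=
  {X | c.Ad₂ Kbar X r = r}

/-- `X` is a non-twisted Belavin–Drinfeld cocycle for `r` over the field `M` between `ℂ((ħ))` and
its algebraic closure: `X⁻¹ σ(X) ∈ C(r)` for all `σ ∈ Gal(ℂ((ħ))^alg / M)`. -/
def IsNontwistedCocycle (M : IntermediateField K Kbar)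
    (r : (Kbar ⊗[ℂ] 𝔤) ⊗[Kbar] (Kbar ⊗[ℂ] 𝔤)) (X : G.points Kbar) : Prop :=
  ∀ σ : Kbar ≃ₐ[M] Kbar, X⁻¹ * galAct G (σ.restrictScalars K) X ∈ centralizer c r

end Cocycle

end TwistedBD

end

open TwistedBD

noncomputable section

namespace TwistedBD

/-! ### Coboundary Lie bialgebras in terms of operators -/

section Operator

variable {E M : Type*} [Field E] [AddCommGroup M] [Module E M]

/-! Write `r` for the `r`-matrix over the algebraic closure, `Ω = r + r²¹` for the Casimir tensor
and `s = a Ad_X r`. The proof has two independent halves.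

For every `X` and `a`, the coboundary of `s` is a Lie cobracket on `𝔤` over the algebraic closure.
Scaling and automorphisms preserve this property, so it suffices to treat `r`. The invariant form
turns `r` into an operator `f` with `f + f* = 1`. If the pairs `(f z, f z - z)` form a Lie
subalgebra of `𝔤 × 𝔤`, then `f` and `f - 1` are homomorphisms from the dual bracket to the Lie
bracket, and co-Jacobi follows from Jacobi (`isLieCobracket_coboundary`, `yangBaxter_of_span`). For
the Belavin–Drinfeld `r` the subalgebra is explicit: it is spanned by `(e_α, e_{τα})` for `α` in
`Span(Γ₁)`, by `(e_α, 0)` for positive `α` outside `Span(Γ₁)`, by `(0, e_α)` for negative `α`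
outside `Span(Γ₂)`, and by a Cartan part (`Gen.lie_mem_graph`, `span_gen`).

What remains is descent to `K`. The coboundary of `s` preserves the `K`-forms iff `τ(s) - s` is
`𝔤`-invariant for every Galois `τ` (`definesLieBialgebra_iff`). By Schur's lemma an invariant tensor
is a multiple of `Ω`, and since `s + s²¹ = aΩ`, symmetrizing determines the multiple: `τ(s) = s +
((τ(a) - a)/2) Ω` (`scal₂_smul_Ad₂_of_invariant`). If `τ` fixes `√ħ`, this says `τ(s) = s`, which is
condition 1. If `τ` negates `√ħ`, it says `-a Ad_{τ(X)} r = s - aΩ = -a Ad_X r²¹`, which for `τ = σ`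
is condition 2. The converse needs only the one lift `σ`, because any other `τ` negating `√ħ` is `σ`
times an automorphism fixing `√ħ`. -/

/-- The linear form `u ⊗ v ↦ B(x, u) B(y, v)`. -/
def pair (B : LinearMap.BilinForm E M) (x y : M) : M ⊗[E] M →ₗ[E] E :=
  LinearMap.mul' E E ∘ₗ TensorProduct.map (B x) (B y)

@[simp]
theorem pair_tmul (B : LinearMap.BilinForm E M) (x y u v : M) :
    pair B x y (u ⊗ₜ v) = B x u * B y v := rfl

/-- The operator `x ↦ B(u, x) v` attached to the tensor `u ⊗ v`. -/
def tensorOp (B : LinearMap.BilinForm E M) : M ⊗[E] M →ₗ[E] (M →ₗ[E] M) :=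
  dualTensorHom E M M ∘ₗ LinearMap.rTensor M B

@[simp]
theorem tensorOp_tmul (B : LinearMap.BilinForm E M) (u v x : M) :
    tensorOp B (u ⊗ₜ v) x = B u x • v := rfl

theorem pair_eq_tensorOp {B : LinearMap.BilinForm E M} (hs : B.IsSymm) (x y : M) (t : M ⊗[E] M) :
    pair B x y t = B y (tensorOp B t x) := by
  induction t using TensorProduct.induction_on with
  | zero => simp
  | add s t hs ht => simp [hs, ht]
  | tmul u v => simp [hs.eq x u]

theorem pair_comm (B : LinearMap.BilinForm E M) (x y : M) (t : M ⊗[E] M) :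
    pair B x y (TensorProduct.comm E M M t) = pair B y x t := by
  induction t using TensorProduct.induction_on with
  | zero => simp
  | add s t hs ht => simp [hs, ht]
  | tmul u v => simp [mul_comm]

/-- Flipping the tensor factors corresponds to taking the adjoint operator; hence `r + r²¹` is the
Casimir tensor exactly when `f + f* = 1`. -/
theorem tensorOp_comm {B : LinearMap.BilinForm E M} (hs : B.IsSymm) (t : M ⊗[E] M) (x y : M) :
    B (tensorOp B (TensorProduct.comm E M M t) x) y = B x (tensorOp B t y) := by
  rw [hs.eq, ← pair_eq_tensorOp hs, pair_comm, pair_eq_tensorOp hs]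

end Operator

/-! ### The co-Jacobi identity from the operator Yang–Baxter equation. -/

section Coboundary

variable {E L : Type*} [Field E] [LieRing L] [LieAlgebra E L]

/-- The coboundary `x ↦ [x ⊗ 1 + 1 ⊗ x, t]`. -/
def coboundary (t : L ⊗[E] L) : L →ₗ[E] L ⊗[E] L :=
  (LieModule.toEnd E L (L ⊗[E] L) : L →ₗ[E] Module.End E (L ⊗[E] L)).flip t

theorem coboundary_apply (t : L ⊗[E] L) (x : L) : coboundary t x = ⁅x, t⁆ := rfl

/-- The linear form `u ⊗ (v ⊗ w) ↦ B(x, u) B(y, v) B(z, w)`. -/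
def pair₃ (B : LinearMap.BilinForm E L) (x y z : L) : L ⊗[E] (L ⊗[E] L) →ₗ[E] E :=
  LinearMap.mul' E E ∘ₗ TensorProduct.map (B x) (pair B y z)

@[simp]
theorem pair₃_tmul (B : LinearMap.BilinForm E L) (x y z u : L) (v : L ⊗[E] L) :
    pair₃ B x y z (u ⊗ₜ v) = B x u * pair B y z v := rfl

theorem pair₃_cyc (B : LinearMap.BilinForm E L) (x y z : L) (t : L ⊗[E] (L ⊗[E] L)) :
    pair₃ B x y z (cyc E L t) = pair₃ B z x y t := by
  induction t using TensorProduct.induction_on with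
  | zero => simp
  | add s t hs ht => simp [hs, ht]
  | tmul u t =>
    induction t using TensorProduct.induction_on with
    | zero => simp
    | add s t hs ht => simp only [TensorProduct.tmul_add, map_add, hs, ht]
    | tmul v w =>
      simp [cyc]
      ring

theorem lieInvariant.apply_lie {B : LinearMap.BilinForm E L} (hi : B.lieInvariant L) (x y z : L) :
    B ⁅x, y⁆ z = B x ⁅y, z⁆ := by
  rw [← lie_skew, map_neg, LinearMap.neg_apply, hi y x z, neg_neg]

theorem pair_lie {B : LinearMap.BilinForm E L} (hi : B.lieInvariant L)
    (x y z : L) (t : L ⊗[E] L) :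
    pair B x y ⁅z, t⁆ = pair B ⁅x, z⁆ y t + pair B x ⁅y, z⁆ t := by
  induction t using TensorProduct.induction_on with
  | zero => simp
  | add s t hs ht => simp only [lie_add, map_add, hs, ht]; ring
  | tmul u v => simp [TensorProduct.LieModule.lie_tmul_right, lieInvariant.apply_lie hi]

variable [Module.Finite E L] {B : LinearMap.BilinForm E L}

omit [Module.Finite E L] in
theorem apply_dualBasis_eq_repr {ι : Type*} [Finite ι] [DecidableEq ι] (hB : B.Nondegenerate)
    (b : Module.Basis ι E L) (u : L) (i : ι) : B (B.dualBasis hB b i) u = b.repr u i := by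
  have := Fintype.ofFinite ι
  conv_lhs => rw [← b.sum_repr u]
  simp only [map_sum, map_smul, LinearMap.BilinForm.apply_dualBasis_left, smul_eq_mul, mul_ite,
    mul_one, mul_zero]
  simp

theorem eq_of_pair (hB : B.Nondegenerate) {s t : L ⊗[E] L}
    (h : ∀ x y, pair B x y s = pair B x y t) : s = t := by
  classical
  let b := Module.finBasis E L
  let d := B.dualBasis hB b
  have key : ∀ s i, (b.tensorProduct b).repr s i = pair B (d i.1) (d i.2) s := by
    intro s i
    induction s using TensorProduct.induction_on with
    | zero => simp
    | add s t hs ht => simp [hs, ht]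
    | tmul u v =>
      rw [pair_tmul, apply_dualBasis_eq_repr, apply_dualBasis_eq_repr, mul_comm]
      exact b.tensorProduct_repr_tmul_apply b u v i.1 i.2
  refine (b.tensorProduct b).repr.injective (Finsupp.ext fun i => ?_)
  rw [key, key, h]

theorem eq_of_pair₃ (hB : B.Nondegenerate) {s t : L ⊗[E] (L ⊗[E] L)}
    (h : ∀ x y z, pair₃ B x y z s = pair₃ B x y z t) : s = t := by
  classical
  let b := Module.finBasis E L
  let d := B.dualBasis hB b
  have key : ∀ s i, (b.tensorProduct (b.tensorProduct b)).repr s i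
      = pair₃ B (d i.1) (d i.2.1) (d i.2.2) s := by
    intro s i
    induction s using TensorProduct.induction_on with
    | zero => simp
    | add s t hs ht => simp [hs, ht]
    | tmul u s =>
      induction s using TensorProduct.induction_on with
      | zero => simp
      | add s t hs ht => simp only [TensorProduct.tmul_add, map_add, Finsupp.add_apply, hs, ht]
      | tmul v w =>
        rw [pair₃_tmul, pair_tmul, apply_dualBasis_eq_repr, apply_dualBasis_eq_repr,
          apply_dualBasis_eq_repr, mul_comm, mul_comm (b.repr v _)]
        refine (b.tensorProduct_repr_tmul_apply (b.tensorProduct b) u (v ⊗ₜ w) i.1 i.2).trans ?_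
        exact congrArg (· * b.repr u i.1) (b.tensorProduct_repr_tmul_apply b v w i.2.1 i.2.2)
  refine (b.tensorProduct (b.tensorProduct b)).repr.injective (Finsupp.ext fun i => ?_)
  rw [key, key, h]

theorem tensorOp_injective (hs : B.IsSymm) (hB : B.Nondegenerate) :
    Function.Injective (tensorOp B) := by
  intro s t h
  exact eq_of_pair hB fun x y => by rw [pair_eq_tensorOp hs, pair_eq_tensorOp hs, h]

/-- If the form dual to `δ` is a Lie bracket, then `δ` satisfies the co-Jacobi identity. -/
theorem coJacobi_of_dual (hB : B.Nondegenerate) (δ : L →ₗ[E] L ⊗[E] L)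
    (m : L → L → L) (hδ : ∀ x y z, pair B x y (δ z) = B (m x y) z)
    (hm : ∀ x y z, m x (m y z) + m y (m z x) + m z (m x y) = 0) (x : L) :
    δ.lTensor L (δ x) + cyc E L (δ.lTensor L (δ x)) + cyc E L (cyc E L (δ.lTensor L (δ x))) = 0 := by
  have key : ∀ y z w (t : L ⊗[E] L), pair₃ B y z w (δ.lTensor L t) = pair B y (m z w) t := by
    intro y z w t
    induction t using TensorProduct.induction_on with
    | zero => simp
    | add s t hs ht => simp [hs, ht]
    | tmul u v => simp [hδ]
  refine eq_of_pair₃ hB fun y z w => ?_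
  rw [map_zero, map_add, map_add, pair₃_cyc, pair₃_cyc, pair₃_cyc, key, key, key, hδ, hδ, hδ,
    ← LinearMap.add_apply, ← LinearMap.add_apply, ← map_add, ← map_add]
  have := hm y z w
  rw [add_right_comm, this, map_zero, LinearMap.zero_apply]

/-- An operator form of the (modified) classical Yang–Baxter equation implies that the coboundary
of a tensor is a Lie cobracket. -/
theorem isLieCobracket_coboundary (hs : B.IsSymm) (hB : B.Nondegenerate) (hi : B.lieInvariant L)
    (t : L ⊗[E] L)
    (hsymm : ∀ x y, B (tensorOp B t x) y + B x (tensorOp B t y) = B x y)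
    (hf : ∀ x y, tensorOp B t (⁅tensorOp B t x, y⁆ + ⁅x, tensorOp B t y⁆ - ⁅x, y⁆)
      = ⁅tensorOp B t x, tensorOp B t y⁆) :
    IsLieCobracket E L (coboundary t) := by
  set f := tensorOp B t with hfdef
  -- The bracket dual to the cobracket. Its term `-⁅x, y⁆` comes from using `f + f* = 1` to move `f`
  -- off `⁅x, z⁆`.
  have hδ : ∀ x y z, pair B x y (coboundary t z) = B (⁅f x, y⁆ + ⁅x, f y⁆ - ⁅x, y⁆) z := by
    intro x y z
    rw [coboundary_apply, pair_lie hi, pair_eq_tensorOp hs, pair_eq_tensorOp hs, ← hfdef]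
    have h1 := hsymm y ⁅x, z⁆
    have h2 : B ⁅y, z⁆ (f x) = B ⁅f x, y⁆ z := by
      rw [hs.eq, lieInvariant.apply_lie hi]
    have h3 : B (f y) ⁅x, z⁆ = - B ⁅x, f y⁆ z := by
      rw [← lieInvariant.apply_lie hi, ← lie_skew, map_neg, LinearMap.neg_apply]
    have h4 : B y ⁅x, z⁆ = - B ⁅x, y⁆ z := by
      rw [← lieInvariant.apply_lie hi, ← lie_skew, map_neg, LinearMap.neg_apply]
    simp only [map_add, map_sub, LinearMap.add_apply, LinearMap.sub_apply]
    rw [h2]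
    linear_combination h1 - h3 + h4
  refine ⟨fun x => ?_, coJacobi_of_dual hB _ _ hδ ?_, fun x y => ?_⟩
  · refine eq_of_pair hB fun y z => ?_
    rw [pair_comm, map_neg, hδ, hδ, ← LinearMap.neg_apply, ← map_neg]
    congr 2
    rw [← lie_skew (f z) y, ← lie_skew z (f y), ← lie_skew z y]
    abel
  · intro x y z
    -- The dual bracket is the difference of the brackets of the images under `f` and under `f - 1`.
    -- By `hf` and `hf'` both maps are homomorphisms for it, so its Jacobi sum is a difference of
    -- two Jacobi sums.
    have hm : ∀ x y, ⁅f x, y⁆ + ⁅x, f y⁆ - ⁅x, y⁆ = ⁅f x, f y⁆ - ⁅f x - x, f y - y⁆ := by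
      intro x y
      simp only [sub_lie, lie_sub]
      abel
    have hf' : ∀ x y, f (⁅f x, y⁆ + ⁅x, f y⁆ - ⁅x, y⁆) - (⁅f x, y⁆ + ⁅x, f y⁆ - ⁅x, y⁆)
        = ⁅f x - x, f y - y⁆ := by
      intro x y
      rw [hf, hm]
      abel
    have h3 : ∀ x y z, ⁅f x, (⁅f y, z⁆ + ⁅y, f z⁆ - ⁅y, z⁆)⁆
        + ⁅x, f (⁅f y, z⁆ + ⁅y, f z⁆ - ⁅y, z⁆)⁆ - ⁅x, (⁅f y, z⁆ + ⁅y, f z⁆ - ⁅y, z⁆)⁆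
        = ⁅f x, ⁅f y, f z⁆⁆ - ⁅f x - x, ⁅f y - y, f z - z⁆⁆ := by
      intro x y z
      rw [hm x, hf', hf]
    rw [h3, h3, h3]
    have j1 := lie_jacobi (f x) (f y) (f z)
    have j2 := lie_jacobi (f x - x) (f y - y) (f z - z)
    calc _ = (⁅f x, ⁅f y, f z⁆⁆ + ⁅f y, ⁅f z, f x⁆⁆ + ⁅f z, ⁅f x, f y⁆⁆)
        - (⁅f x - x, ⁅f y - y, f z - z⁆⁆ + ⁅f y - y, ⁅f z - z, f x - x⁆⁆
          + ⁅f z - z, ⁅f x - x, f y - y⁆⁆) := by abel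
      _ = 0 := by rw [j1, j2, sub_zero]
  · simp only [coboundary_apply, lie_lie]

omit [Module.Finite E L] in
/-- It is enough to check the operator form of the Yang–Baxter equation on a spanning set. -/
theorem yangBaxter_of_span (f : L →ₗ[E] L) (S : Set L) (hS : Submodule.span E S = ⊤)
    (h : ∀ x ∈ S, ∀ y ∈ S, ∃ z, f z = ⁅f x, f y⁆ ∧ f z - z = ⁅f x - x, f y - y⁆) (x y : L) :
    f (⁅f x, y⁆ + ⁅x, f y⁆ - ⁅x, y⁆) = ⁅f x, f y⁆ := by
  have hx : x ∈ Submodule.span E S := hS ▸ Submodule.mem_top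
  have hy : y ∈ Submodule.span E S := hS ▸ Submodule.mem_top
  induction hx using Submodule.span_induction with
  | mem x hx =>
    induction hy using Submodule.span_induction with
    | mem y hy =>
      obtain ⟨z, h1, h2⟩ := h x hx y hy
      -- The witness is forced, since `z = f z - (f z - z)`; this is the dual bracket of `x` and
      -- `y`.
      have : ⁅f x, y⁆ + ⁅x, f y⁆ - ⁅x, y⁆ = z := by
        have : z = ⁅f x, f y⁆ - ⁅f x - x, f y - y⁆ := by rw [← h1, ← h2]; abel
        rw [this]
        simp only [sub_lie, lie_sub]
        abel
      rw [this, h1]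
    | zero => simp
    | add y y' _ _ h1 h2 =>
      simp only [map_add, lie_add, map_sub] at h1 h2 ⊢
      rw [← h1, ← h2]
      abel
    | smul c y _ h1 =>
      simp only [map_smul, lie_smul, map_sub, map_add] at h1 ⊢
      rw [← h1]
      simp only [smul_add, smul_sub]
  | zero => simp
  | add x x' _ _ h1 h2 =>
    simp only [map_add, add_lie, map_sub] at h1 h2 ⊢
    rw [← h1, ← h2]
    abel
  | smul c x _ h1 =>
    simp only [map_smul, smul_lie, map_sub, map_add] at h1 ⊢
    rw [← h1]
    simp only [smul_add, smul_sub]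

end Coboundary

/-! ### Change of scalars along a homomorphism of fields -/

section ScalarMap

variable {E E' : Type*} [Field E] [Field E'] [Algebra ℂ E] [Algebra ℂ E']
  {𝔤 : Type*} [LieRing 𝔤] [LieAlgebra ℂ 𝔤]

variable (𝔤) in
/-- The semilinear map `𝔤(E) → 𝔤(E')` induced by a homomorphism `E → E'`. -/
def scal₁ (φ : E →ₐ[ℂ] E') : E ⊗[ℂ] 𝔤 →ₛₗ[(φ : E →+* E')] E' ⊗[ℂ] 𝔤 where
  toFun := φ.toLinearMap.rTensor 𝔤
  map_add' := map_add _
  map_smul' c x := by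
    induction x using TensorProduct.induction_on with
    | zero => simp
    | add x y hx hy => simp only [smul_add, map_add, hx, hy]
    | tmul s y => simp [TensorProduct.smul_tmul']

@[simp]
theorem scal₁_tmul (φ : E →ₐ[ℂ] E') (s : E) (y : 𝔤) : scal₁ 𝔤 φ (s ⊗ₜ y) = φ s ⊗ₜ y := rfl

variable (𝔤) in
/-- The semilinear map `𝔤(E) ⊗ 𝔤(E) → 𝔤(E') ⊗ 𝔤(E')` induced by a homomorphism `E → E'`. -/
def scal₂ (φ : E →ₐ[ℂ] E') : (E ⊗[ℂ] 𝔤) ⊗[E] (E ⊗[ℂ] 𝔤) →ₛₗ[(φ : E →+* E')]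
    (E' ⊗[ℂ] 𝔤) ⊗[E'] (E' ⊗[ℂ] 𝔤) :=
  TensorProduct.map (scal₁ 𝔤 φ) (scal₁ 𝔤 φ)

@[simp]
theorem scal₂_tmul (φ : E →ₐ[ℂ] E') (x y : E ⊗[ℂ] 𝔤) :
    scal₂ 𝔤 φ (x ⊗ₜ y) = scal₁ 𝔤 φ x ⊗ₜ scal₁ 𝔤 φ y := rfl

variable (𝔤) in
/-- The semilinear map of triple tensor products induced by a homomorphism `E → E'`. -/
def scal₃ (φ : E →ₐ[ℂ] E') :
    (E ⊗[ℂ] 𝔤) ⊗[E] ((E ⊗[ℂ] 𝔤) ⊗[E] (E ⊗[ℂ] 𝔤)) →ₛₗ[(φ : E →+* E')]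
      (E' ⊗[ℂ] 𝔤) ⊗[E'] ((E' ⊗[ℂ] 𝔤) ⊗[E'] (E' ⊗[ℂ] 𝔤)) :=
  TensorProduct.map (scal₁ 𝔤 φ) (scal₂ 𝔤 φ)

@[simp]
theorem scal₃_tmul (φ : E →ₐ[ℂ] E') (x : E ⊗[ℂ] 𝔤) (y : (E ⊗[ℂ] 𝔤) ⊗[E] (E ⊗[ℂ] 𝔤)) :
    scal₃ 𝔤 φ (x ⊗ₜ y) = scal₁ 𝔤 φ x ⊗ₜ scal₂ 𝔤 φ y := rfl

variable (φ : E →ₐ[ℂ] E')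

theorem scal₁_lie (x y : E ⊗[ℂ] 𝔤) : scal₁ 𝔤 φ ⁅x, y⁆ = ⁅scal₁ 𝔤 φ x, scal₁ 𝔤 φ y⁆ := by
  induction x using TensorProduct.induction_on with
  | zero => simp
  | add x x' hx hx' => simp only [add_lie, map_add, hx, hx']
  | tmul s u =>
    induction y using TensorProduct.induction_on with
    | zero => simp
    | add x x' hx hx' => simp only [lie_add, map_add, hx, hx']
    | tmul s' v => simp [LieAlgebra.ExtendScalars.bracket_tmul]

theorem scal₂_lie (x : E ⊗[ℂ] 𝔤) (t : (E ⊗[ℂ] 𝔤) ⊗[E] (E ⊗[ℂ] 𝔤)) :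
    scal₂ 𝔤 φ ⁅x, t⁆ = ⁅scal₁ 𝔤 φ x, scal₂ 𝔤 φ t⁆ := by
  induction t using TensorProduct.induction_on with
  | zero => simp
  | add t t' h h' => simp only [lie_add, map_add, h, h']
  | tmul u v => simp [TensorProduct.LieModule.lie_tmul_right, scal₁_lie]

theorem scal₂_comm (t : (E ⊗[ℂ] 𝔤) ⊗[E] (E ⊗[ℂ] 𝔤)) :
    scal₂ 𝔤 φ (TensorProduct.comm E _ _ t) = TensorProduct.comm E' _ _ (scal₂ 𝔤 φ t) := by
  induction t using TensorProduct.induction_on with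
  | zero => simp
  | add t t' h h' => simp only [map_add, h, h']
  | tmul u v => simp

theorem scal₃_cyc (t : (E ⊗[ℂ] 𝔤) ⊗[E] ((E ⊗[ℂ] 𝔤) ⊗[E] (E ⊗[ℂ] 𝔤))) :
    scal₃ 𝔤 φ (cyc E _ t) = cyc E' _ (scal₃ 𝔤 φ t) := by
  induction t using TensorProduct.induction_on with
  | zero => simp
  | add t t' h h' => simp only [map_add, h, h']
  | tmul u t =>
    induction t using TensorProduct.induction_on with
    | zero => simp
    | add t t' h h' => simp only [TensorProduct.tmul_add, map_add, h, h']
    | tmul v w => simp [cyc]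

theorem scal₁_scal₁ {E'' : Type*} [Field E''] [Algebra ℂ E''] (ψ : E' →ₐ[ℂ] E'')
    (x : E ⊗[ℂ] 𝔤) : scal₁ 𝔤 ψ (scal₁ 𝔤 φ x) = scal₁ 𝔤 (ψ.comp φ) x := by
  induction x using TensorProduct.induction_on with
  | zero => simp
  | add t t' h h' => simp only [map_add, h, h']
  | tmul u v => simp

theorem scal₂_scal₂ {E'' : Type*} [Field E''] [Algebra ℂ E''] (ψ : E' →ₐ[ℂ] E'')
    (t : (E ⊗[ℂ] 𝔤) ⊗[E] (E ⊗[ℂ] 𝔤)) :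
    scal₂ 𝔤 ψ (scal₂ 𝔤 φ t) = scal₂ 𝔤 (ψ.comp φ) t := by
  induction t using TensorProduct.induction_on with
  | zero => simp
  | add t t' h h' => simp only [map_add, h, h']
  | tmul u v => simp [scal₁_scal₁]

/-! ### Change of scalars in coordinates. -/

section Coordinates

variable {ι : Type*} (b : Module.Basis ι ℂ 𝔤)

/-- A basis of `𝔤` over `ℂ` is untouched by `φ`, so only coordinates move. Injectivity and Galois
descent of tensors are both read off from this. -/
theorem repr_scal₁ (x : E ⊗[ℂ] 𝔤) (i : ι) :
    (b.baseChange E').repr (scal₁ 𝔤 φ x) i = φ ((b.baseChange E).repr x i) := by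
  induction x using TensorProduct.induction_on with
  | zero => simp
  | add t t' h h' => simp only [map_add, Finsupp.add_apply, h, h']
  | tmul u v => simp [Module.Basis.baseChange_repr_tmul]

theorem repr_scal₂ (t : (E ⊗[ℂ] 𝔤) ⊗[E] (E ⊗[ℂ] 𝔤)) (i : ι × ι) :
    ((b.baseChange E').tensorProduct (b.baseChange E')).repr (scal₂ 𝔤 φ t) i
      = φ (((b.baseChange E).tensorProduct (b.baseChange E)).repr t i) := by
  induction t using TensorProduct.induction_on with
  | zero => simp
  | add t t' h h' => simp only [map_add, Finsupp.add_apply, h, h']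
  | tmul u v =>
    obtain ⟨i, j⟩ := i
    simp only [scal₂_tmul, Module.Basis.tensorProduct_repr_tmul_apply, repr_scal₁, smul_eq_mul,
      map_mul]

theorem repr_scal₃ (t : (E ⊗[ℂ] 𝔤) ⊗[E] ((E ⊗[ℂ] 𝔤) ⊗[E] (E ⊗[ℂ] 𝔤))) (i : ι × ι × ι) :
    ((b.baseChange E').tensorProduct
      ((b.baseChange E').tensorProduct (b.baseChange E'))).repr (scal₃ 𝔤 φ t) i
      = φ (((b.baseChange E).tensorProduct
        ((b.baseChange E).tensorProduct (b.baseChange E))).repr t i) := by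
  induction t using TensorProduct.induction_on with
  | zero => simp
  | add t t' h h' => simp only [map_add, Finsupp.add_apply, h, h']
  | tmul u v =>
    obtain ⟨i, j⟩ := i
    simp only [scal₃_tmul, Module.Basis.tensorProduct_repr_tmul_apply, repr_scal₂, repr_scal₁,
      smul_eq_mul, map_mul]

end Coordinates

theorem scal₂_injective : Function.Injective (scal₂ 𝔤 φ) := by
  intro s t h
  let b := Module.Basis.ofVectorSpace ℂ 𝔤
  refine ((b.baseChange E).tensorProduct (b.baseChange E)).repr.injective (Finsupp.ext fun i => ?_)
  apply φ.toRingHom.injective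
  change φ _ = φ _
  rw [← repr_scal₂, ← repr_scal₂, h]

theorem scal₃_injective : Function.Injective (scal₃ 𝔤 φ) := by
  intro s t h
  let b := Module.Basis.ofVectorSpace ℂ 𝔤
  refine ((b.baseChange E).tensorProduct
    ((b.baseChange E).tensorProduct (b.baseChange E))).repr.injective (Finsupp.ext fun i => ?_)
  apply φ.toRingHom.injective
  change φ _ = φ _
  rw [← repr_scal₃, ← repr_scal₃, h]

/-- A tensor whose coordinates lie in the image of `φ` lies in the image of `scal₂ 𝔤 φ`. -/
theorem mem_range_scal₂ {ι : Type*} (b : Module.Basis ι ℂ 𝔤)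
    (t : (E' ⊗[ℂ] 𝔤) ⊗[E'] (E' ⊗[ℂ] 𝔤))
    (h : ∀ i, ∃ s : E, φ s = ((b.baseChange E').tensorProduct (b.baseChange E')).repr t i) :
    ∃ t₀, scal₂ 𝔤 φ t₀ = t := by
  choose s hs using h
  let c := (b.baseChange E').tensorProduct (b.baseChange E')
  refine ⟨∑ i ∈ (c.repr t).support,
    s i • ((1 : E) ⊗ₜ[ℂ] b i.1) ⊗ₜ[E] ((1 : E) ⊗ₜ[ℂ] b i.2), ?_⟩
  rw [map_sum]
  conv_rhs => rw [← c.linearCombination_repr t, Finsupp.linearCombination_apply, Finsupp.sum]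
  refine Finset.sum_congr rfl fun i _ => ?_
  rw [map_smulₛₗ, scal₂_tmul, scal₁_tmul, scal₁_tmul, map_one]
  change φ (s i) • _ = _
  rw [hs]
  simp [c, Module.Basis.tensorProduct_apply']

/-- The image of `𝔤(E)` spans `𝔤(E')`. -/
theorem span_range_scal₁ : Submodule.span E' (Set.range (scal₁ 𝔤 φ)) = ⊤ := by
  refine eq_top_iff.2 fun x _ => ?_
  induction x using TensorProduct.induction_on with
  | zero => simp
  | add t t' h h' => exact Submodule.add_mem _ (h trivial) (h' trivial)
  | tmul s y =>
    have : s ⊗ₜ[ℂ] y = s • scal₁ 𝔤 φ ((1 : E) ⊗ₜ y) := by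
      simp [TensorProduct.smul_tmul']
    rw [this]
    exact Submodule.smul_mem _ _ (Submodule.subset_span ⟨_, rfl⟩)

/-! ### Lie cobrackets under change of scalars. -/

section Cobracket

variable {δ : E ⊗[ℂ] 𝔤 →ₗ[E] (E ⊗[ℂ] 𝔤) ⊗[E] (E ⊗[ℂ] 𝔤)}
  {δ' : E' ⊗[ℂ] 𝔤 →ₗ[E'] (E' ⊗[ℂ] 𝔤) ⊗[E'] (E' ⊗[ℂ] 𝔤)}

theorem scal₃_lTensor (h : ∀ x, scal₂ 𝔤 φ (δ x) = δ' (scal₁ 𝔤 φ x))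
    (t : (E ⊗[ℂ] 𝔤) ⊗[E] (E ⊗[ℂ] 𝔤)) :
    scal₃ 𝔤 φ (δ.lTensor _ t) = δ'.lTensor _ (scal₂ 𝔤 φ t) := by
  induction t using TensorProduct.induction_on with
  | zero => simp
  | add t t' h h' => simp only [map_add, h, h']
  | tmul u v => simp [h]

/-- The axioms are identities between tensors, and these can be tested after an injective change of
scalars. -/
theorem IsLieCobracket.of_scal (h : ∀ x, scal₂ 𝔤 φ (δ x) = δ' (scal₁ 𝔤 φ x))
    (h' : IsLieCobracket E' (E' ⊗[ℂ] 𝔤) δ') : IsLieCobracket E (E ⊗[ℂ] 𝔤) δ := by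
  refine ⟨fun x => ?_, fun x => ?_, fun x y => ?_⟩
  · apply scal₂_injective φ
    rw [scal₂_comm, h, h'.skew, map_neg, h]
  · apply scal₃_injective φ
    simp only [map_add, map_zero, scal₃_cyc, scal₃_lTensor φ h, h, h'.coJacobi]
  · apply scal₂_injective φ
    simp only [h, map_sub, scal₂_lie, scal₁_lie, h'.cocycle]

/-- The axioms are linear in each argument, so they need only be checked on the image of `𝔤(E)`,
which spans. -/
theorem IsLieCobracket.scal (h : ∀ x, scal₂ 𝔤 φ (δ x) = δ' (scal₁ 𝔤 φ x))
    (hδ : IsLieCobracket E (E ⊗[ℂ] 𝔤) δ) : IsLieCobracket E' (E' ⊗[ℂ] 𝔤) δ' := by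
  have hspan : ∀ x : E' ⊗[ℂ] 𝔤, x ∈ Submodule.span E' (Set.range (scal₁ 𝔤 φ)) := fun x => by
    rw [span_range_scal₁]
    trivial
  refine ⟨fun x => ?_, fun x => ?_, fun x y => ?_⟩
  · induction hspan x using Submodule.span_induction with
    | mem x hx =>
      obtain ⟨x, rfl⟩ := hx
      rw [← h, ← scal₂_comm, hδ.skew, map_neg]
    | zero => simp
    | add x y _ _ hx hy => rw [map_add, map_add, hx, hy, neg_add]
    | smul c x _ hx => rw [map_smul, map_smul, hx, smul_neg]
  · induction hspan x using Submodule.span_induction with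
    | mem x hx =>
      obtain ⟨x, rfl⟩ := hx
      have := congrArg (scal₃ 𝔤 φ) (hδ.coJacobi x)
      simpa only [map_add, map_zero, scal₃_cyc, scal₃_lTensor φ h, h] using this
    | zero => simp
    | add x y _ _ hx hy =>
      simp only [map_add]
      have hxy := congrArg₂ (· + ·) hx hy
      simp only [add_zero] at hxy
      rw [← hxy]
      abel
    | smul c x _ hx => simp only [map_smul, ← smul_add, hx, smul_zero]
  · induction hspan x using Submodule.span_induction with
    | mem x hx =>
      obtain ⟨x, rfl⟩ := hx
      induction hspan y using Submodule.span_induction with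
      | mem y hy =>
        obtain ⟨y, rfl⟩ := hy
        rw [← scal₁_lie, ← h, hδ.cocycle, map_sub, scal₂_lie, scal₂_lie, h, h]
      | zero => simp
      | add y y' _ _ h1 h2 => simp only [lie_add, map_add, h1, h2, add_lie]; abel
      | smul c y _ h1 => simp only [lie_smul, map_smul, h1, smul_lie, smul_sub]
    | zero => simp
    | add y y' _ _ h1 h2 => simp only [lie_add, map_add, h1, h2, add_lie]; abel
    | smul c y _ h1 => simp only [lie_smul, map_smul, h1, smul_lie, smul_sub]

end Cobracket

section Algebra

variable [Algebra E E'] [IsScalarTower ℂ E E']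

theorem ext₁_eq_scal₁ (x : E ⊗[ℂ] 𝔤) :
    ext₁ E E' 𝔤 x = scal₁ 𝔤 (IsScalarTower.toAlgHom ℂ E E') x := by
  induction x using TensorProduct.induction_on with
  | zero => simp
  | add t t' h h' => simp only [map_add, h, h']
  | tmul u v => rfl

theorem ext₂_eq_scal₂ (t : (E ⊗[ℂ] 𝔤) ⊗[E] (E ⊗[ℂ] 𝔤)) :
    ext₂ E E' 𝔤 t = scal₂ 𝔤 (IsScalarTower.toAlgHom ℂ E E') t := by
  induction t using TensorProduct.induction_on with
  | zero => simp
  | add t t' h h' => simp only [map_add, h, h']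
  | tmul u v =>
    rw [scal₂_tmul, ← ext₁_eq_scal₁, ← ext₁_eq_scal₁]
    rfl

end Algebra

end ScalarMap

/-! ### Invariant forms -/

section Form

variable (E : Type*) [Field E] [Algebra ℂ E] {𝔤 : Type*} [LieRing 𝔤] [LieAlgebra ℂ 𝔤]
  {B : LinearMap.BilinForm ℂ 𝔤}

theorem lieInvariant.baseChange (hi : B.lieInvariant 𝔤) :
    (B.baseChange E).lieInvariant (E ⊗[ℂ] 𝔤) := by
  intro x y z
  induction x using TensorProduct.induction_on with
  | zero => simp
  | add x x' h h' => simp only [add_lie, map_add, LinearMap.add_apply, h, h']; abel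
  | tmul r x =>
    induction y using TensorProduct.induction_on with
    | zero => simp
    | add x x' h h' => simp only [lie_add, map_add, LinearMap.add_apply, h, h']; abel
    | tmul s y =>
      induction z using TensorProduct.induction_on with
      | zero => simp
      | add x x' h h' => simp only [lie_add, map_add, h, h']; abel
      | tmul t z =>
        simp only [LieAlgebra.ExtendScalars.bracket_tmul, LinearMap.BilinForm.baseChange_tmul,
          hi x y z, neg_smul]
        congr 2
        ring

theorem isSymm_baseChange (hs : B.IsSymm) : (B.baseChange E).IsSymm :=
  LinearMap.BilinForm.isSymm_iff.2
    (LinearMap.BilinForm.IsSymm.baseChange E (LinearMap.BilinForm.isSymm_iff.1 hs))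

variable [FiniteDimensional ℂ 𝔤]

omit [FiniteDimensional ℂ 𝔤] in
theorem baseChange_dualBasis_apply {ι : Type*} [Finite ι] [DecidableEq ι] (hB : B.Nondegenerate)
    (b : Module.Basis ι ℂ 𝔤) (i : ι) (x : E ⊗[ℂ] 𝔤) :
    B.baseChange E ((1 : E) ⊗ₜ B.dualBasis hB b i) x = (b.baseChange E).repr x i := by
  induction x using TensorProduct.induction_on with
  | zero => simp
  | add x x' h h' => simp only [map_add, Finsupp.add_apply, h, h']
  | tmul s y =>
    rw [LinearMap.BilinForm.baseChange_tmul, apply_dualBasis_eq_repr,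
      Module.Basis.baseChange_repr_tmul, one_mul]

/-- Pairing with the dual basis of `𝔤` reads off coordinates over `E`, so a vector in the radical
has all coordinates zero. -/
theorem nondegenerate_baseChange (hs : B.IsSymm) (hB : B.Nondegenerate) :
    (B.baseChange E).Nondegenerate := by
  have hsE := isSymm_baseChange E hs
  rw [LinearMap.BilinForm.Nondegenerate, hsE.isRefl.nondegenerate_iff_separatingLeft]
  intro x h
  let b := Module.finBasis ℂ 𝔤
  refine (b.baseChange E).repr.injective (Finsupp.ext fun i => ?_)
  rw [← baseChange_dualBasis_apply E hB, map_zero, Finsupp.zero_apply, hsE.eq, h]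

end Form

/-! ### Invariant tensors -/

section Invariant

/-- The action on tensors becomes the commutator with `ad z`; invariant tensors thus correspond to
operators commuting with the adjoint representation. -/
theorem tensorOp_lie {E L : Type*} [Field E] [LieRing L] [LieAlgebra E L]
    {B : LinearMap.BilinForm E L} (hi : B.lieInvariant L) (t : L ⊗[E] L) (z x : L) :
    tensorOp B ⁅z, t⁆ x = ⁅z, tensorOp B t x⁆ - tensorOp B t ⁅z, x⁆ := by
  induction t using TensorProduct.induction_on with
  | zero => simp
  | add s t hs ht => simp only [lie_add, map_add, LinearMap.add_apply, hs, ht]; abel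
  | tmul u v =>
    simp [TensorProduct.LieModule.lie_tmul_right, hi z u x]
    abel

theorem tensorOp_map {E L : Type*} [Field E] [LieRing L] [LieAlgebra E L]
    {B : LinearMap.BilinForm E L} (θ : L ≃ₗ[E] L) (hθ : ∀ x y, B (θ x) (θ y) = B x y)
    (t : L ⊗[E] L) (x : L) :
    tensorOp B (TensorProduct.map θ.toLinearMap θ.toLinearMap t) x
      = θ (tensorOp B t (θ.symm x)) := by
  induction t using TensorProduct.induction_on with
  | zero => simp
  | add s t hs ht => simp only [map_add, LinearMap.add_apply, hs, ht]
  | tmul u v =>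
    have := hθ u (θ.symm x)
    rw [θ.apply_symm_apply] at this
    simp [this]

variable {𝔤 : Type*} [LieRing 𝔤] [LieAlgebra ℂ 𝔤] [FiniteDimensional ℂ 𝔤]
  [LieAlgebra.IsSimple ℂ 𝔤]

/-- Schur's lemma for the adjoint representation. -/
theorem exists_eq_smul_of_commute (φ : 𝔤 →ₗ[ℂ] 𝔤) (h : ∀ x y : 𝔤, φ ⁅x, y⁆ = ⁅x, φ y⁆) :
    ∃ c : ℂ, ∀ x, φ x = c • x := by
  have : Nontrivial 𝔤 := by
    by_contra hn
    have := not_nontrivial_iff_subsingleton.1 hn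
    exact LieAlgebra.IsSimple.non_abelian ℂ (L := 𝔤) ⟨fun x y => Subsingleton.elim _ _⟩
  obtain ⟨c, hc⟩ := Module.End.exists_eigenvalue φ
  -- An eigenspace of a map commuting with `ad` is an ideal, and a nonzero one exists over `ℂ`;
  -- simplicity makes it everything.
  let I : LieIdeal ℂ 𝔤 :=
    { Module.End.eigenspace φ c with
      lie_mem := by
        intro x y hy
        have hy : φ y = c • y := Module.End.mem_eigenspace_iff.1 hy
        exact Module.End.mem_eigenspace_iff.2 (by rw [h, hy, lie_smul]) }
  rcases LieAlgebra.IsSimple.eq_bot_or_eq_top (R := ℂ) I with hI | hI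
  · obtain ⟨v, hv, hv0⟩ := hc.exists_hasEigenvector
    have : v ∈ I := hv
    rw [hI] at this
    exact absurd this hv0
  · refine ⟨c, fun x => ?_⟩
    have : x ∈ I := hI ▸ trivial
    exact Module.End.mem_eigenspace_iff.1 this

/-- The operator comparing `B` with the Killing form commutes with `ad`, hence is scalar by Schur.
-/
theorem exists_eq_smul_killingForm {B : LinearMap.BilinForm ℂ 𝔤} (hi : B.lieInvariant 𝔤) :
    ∃ c : ℂ, ∀ x y, B x y = c * killingForm ℂ 𝔤 x y := by
  have hκ := LieAlgebra.IsKilling.killingForm_nondegenerate ℂ 𝔤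
  let φ : 𝔤 →ₗ[ℂ] 𝔤 := (LinearMap.BilinForm.toDual (killingForm ℂ 𝔤) hκ).symm.toLinearMap ∘ₗ B
  have hφ : ∀ x y, killingForm ℂ 𝔤 (φ x) y = B x y := fun x y =>
    LinearMap.BilinForm.apply_toDual_symm_apply (hB := hκ) (B x) y
  obtain ⟨c, hc⟩ := exists_eq_smul_of_commute φ fun x y => by
    refine sub_eq_zero.1 (hκ.1 _ fun z => ?_)
    rw [map_sub, LinearMap.sub_apply, hφ, hi x y z,
      LieModule.traceForm_lieInvariant ℂ 𝔤 𝔤 x (φ y) z]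
    change _ - -(killingForm ℂ 𝔤 _ _) = _
    rw [hφ]
    ring
  refine ⟨c, fun x y => ?_⟩
  rw [← hφ, hc, map_smul, LinearMap.smul_apply, smul_eq_mul]

variable (E : Type*) [Field E] [Algebra ℂ E] {B : LinearMap.BilinForm ℂ 𝔤}

/-- An invariant form is preserved by all automorphisms of `𝔤(E)`. -/
theorem baseChange_apply_equiv (hi : B.lieInvariant 𝔤) (θ : (E ⊗[ℂ] 𝔤) ≃ₗ⁅E⁆ (E ⊗[ℂ] 𝔤))
    (x y : E ⊗[ℂ] 𝔤) : B.baseChange E (θ x) (θ y) = B.baseChange E x y := by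
  obtain ⟨c, hc⟩ := exists_eq_smul_killingForm hi
  -- Proportionality to the Killing form survives extension of scalars, and every automorphism
  -- preserves the Killing form.
  have key : ∀ x y, B.baseChange E x y
      = algebraMap ℂ E c * killingForm E (E ⊗[ℂ] 𝔤) x y := by
    intro x y
    have hk : killingForm E (E ⊗[ℂ] 𝔤) = (killingForm ℂ 𝔤).baseChange E :=
      LieModule.traceForm_baseChange (R := ℂ) (L := 𝔤) (M := 𝔤) E
    rw [hk]
    induction x using TensorProduct.induction_on with
    | zero => simp
    | add x x' h h' => simp only [map_add, LinearMap.add_apply, h, h', mul_add]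
    | tmul s x =>
      induction y using TensorProduct.induction_on with
      | zero => simp
      | add x x' h h' => simp only [map_add, h, h', mul_add]
      | tmul s' y =>
        rw [LinearMap.BilinForm.baseChange_tmul, LinearMap.BilinForm.baseChange_tmul, hc,
          mul_smul, Algebra.smul_def]
  rw [key, key, LieAlgebra.killingForm_of_equiv_apply]

variable {E}

/-- Every invariant tensor is a multiple of the Casimir tensor. -/
theorem exists_eq_smul_of_invariant (hs : B.IsSymm) (hB : B.Nondegenerate)
    (hi : B.lieInvariant 𝔤) {Ω t : (E ⊗[ℂ] 𝔤) ⊗[E] (E ⊗[ℂ] 𝔤)}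
    (hΩ : ∀ x, tensorOp (B.baseChange E) Ω x = x)
    (ht : ∀ x : 𝔤, ⁅(1 : E) ⊗ₜ[ℂ] x, t⁆ = 0) : ∃ c : E, t = c • Ω := by
  classical
  set f := tensorOp (B.baseChange E) t with hf
  have hcomm : ∀ (z : 𝔤) (x : E ⊗[ℂ] 𝔤), f ⁅(1 : E) ⊗ₜ[ℂ] z, x⁆ = ⁅(1 : E) ⊗ₜ[ℂ] z, f x⁆ := by
    intro z x
    have := tensorOp_lie (lieInvariant.baseChange E hi) t (1 ⊗ₜ z) x
    rw [ht, map_zero, LinearMap.zero_apply] at this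
    exact (sub_eq_zero.1 this.symm).symm
  let b := Module.finBasis ℂ 𝔤
  let m := fun i j => (b.baseChange E).repr (f (1 ⊗ₜ b j)) i
  -- Schur's lemma is available over `ℂ` only. A `ℂ`-linear functional `ξ` applied to the
  -- coefficients turns `f` into an endomorphism of `𝔤` commuting with `ad`, hence scalar. Such
  -- functionals separate points of `E`, so the matrix of `f` is itself scalar.
  have key : ∀ ξ : Module.Dual ℂ E, ∃ c : ℂ, ∀ i j, ξ (m i j) = if j = i then c else 0 := by
    intro ξ
    let π : E ⊗[ℂ] 𝔤 →ₗ[ℂ] 𝔤 := (TensorProduct.lid ℂ 𝔤).toLinearMap ∘ₗ ξ.rTensor 𝔤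
    have hπ : ∀ (z : 𝔤) (y : E ⊗[ℂ] 𝔤), π ⁅(1 : E) ⊗ₜ[ℂ] z, y⁆ = ⁅z, π y⁆ := by
      intro z y
      induction y using TensorProduct.induction_on with
      | zero => simp
      | add x x' h h' => simp only [map_add, lie_add, h, h']
      | tmul s x => simp [π, LieAlgebra.ExtendScalars.bracket_tmul]
    have hπr : ∀ y i, b.repr (π y) i = ξ ((b.baseChange E).repr y i) := by
      intro y i
      induction y using TensorProduct.induction_on with
      | zero => simp
      | add x x' h h' => simp only [map_add, Finsupp.add_apply, h, h']
      | tmul s x => simp [π, Module.Basis.baseChange_repr_tmul, mul_comm]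
    obtain ⟨c, hc⟩ := exists_eq_smul_of_commute
      (π ∘ₗ (f.restrictScalars ℂ) ∘ₗ TensorProduct.mk ℂ E 𝔤 1) fun x y => by
        have := hcomm x (1 ⊗ₜ y)
        rw [LieAlgebra.ExtendScalars.bracket_tmul, one_mul] at this
        simp only [LinearMap.comp_apply, TensorProduct.mk_apply, LinearMap.restrictScalars_apply]
        rw [this, hπ]
    refine ⟨c, fun i j => ?_⟩
    rw [← hπr]
    have := hc (b j)
    simp only [LinearMap.comp_apply, TensorProduct.mk_apply,
      LinearMap.restrictScalars_apply] at this
    rw [this]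
    simp [Finsupp.single_apply]
  have hne : ∀ i j, j ≠ i → m i j = 0 := fun i j hij =>
    (Module.forall_dual_apply_eq_zero_iff ℂ _).1 fun ξ => by
      obtain ⟨c, hc⟩ := key ξ
      rw [hc, if_neg hij]
  have heq : ∀ i j, m i i = m j j := fun i j =>
    sub_eq_zero.1 <| (Module.forall_dual_apply_eq_zero_iff ℂ _).1 fun ξ => by
      obtain ⟨c, hc⟩ := key ξ
      rw [map_sub, hc, hc, if_pos rfl, if_pos rfl, sub_self]
  obtain ⟨c, hc⟩ : ∃ c : E, ∀ i, m i i = c := by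
    rcases isEmpty_or_nonempty (Fin (Module.finrank ℂ 𝔤)) with h | ⟨⟨i⟩⟩
    · exact ⟨0, fun i => isEmptyElim i⟩
    · exact ⟨m i i, fun j => heq j i⟩
  refine ⟨c, tensorOp_injective (isSymm_baseChange E hs)
    (nondegenerate_baseChange E hs hB) ?_⟩
  refine (b.baseChange E).ext fun j => ?_
  rw [map_smul, LinearMap.smul_apply, hΩ, Module.Basis.baseChange_apply]
  refine (b.baseChange E).repr.injective (Finsupp.ext fun i => ?_)
  change m i j = _
  rw [map_smul, Finsupp.smul_apply, Module.Basis.baseChange_repr_tmul]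
  by_cases hij : j = i
  · subst hij
    simp [hc]
  · simp [hne i j hij, hij]

end Invariant

/-! ### Partial isometries of bases of root systems -/

section Roots

variable {ι R M N : Type*} [Field R] [CharZero R] [AddCommGroup M] [Module R M]
  [AddCommGroup N] [Module R N] {P : RootPairing ι R M N} (b : P.Base)

/-- The coefficient of the simple root `j` in the root `i`. -/
def coeff (i j : ι) : ℤ := (b.exists_root_eq_sum_int i).choose j

theorem root_eq_sum_coeff (i : ι) : P.root i = ∑ j ∈ b.support, coeff b i j • P.root j :=
  (b.exists_root_eq_sum_int i).choose_spec.2.2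

theorem coeff_of_notMem (i : ι) {j : ι} (hj : j ∉ b.support) : coeff b i j = 0 := by
  by_contra h
  exact hj ((b.exists_root_eq_sum_int i).choose_spec.1 h)

theorem coeff_eq {i : ι} {f : ι → ℤ} (heq : P.root i = ∑ j ∈ b.support, f j • P.root j)
    {j : ι} (hj : j ∈ b.support) : coeff b i j = f j := by
  have h := linearIndepOn_finset_iffₛ.1 (b.linearIndepOn_root.restrict_scalars' ℤ)
    (coeff b i) f (by rw [← root_eq_sum_coeff, heq])
  exact h j hj

theorem height_eq_sum_coeff (i : ι) : b.height i = ∑ j ∈ b.support, coeff b i j :=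
  RootPairing.Base.height_eq_sum (root_eq_sum_coeff b i)

theorem coeff_add {i j k : ι} (h : P.root k = P.root i + P.root j) (l : ι) :
    coeff b k l = coeff b i l + coeff b j l := by
  by_cases hl : l ∈ b.support
  · refine coeff_eq b (f := fun l => coeff b i l + coeff b j l) ?_ hl
    simp only [add_smul, Finset.sum_add_distrib, ← root_eq_sum_coeff, h]
  · simp [coeff_of_notMem b _ hl]

theorem coeff_neg {i j : ι} (h : P.root j = -P.root i) (l : ι) :
    coeff b j l = -coeff b i l := by
  by_cases hl : l ∈ b.support
  · refine coeff_eq b (f := fun l => -coeff b i l) ?_ hl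
    simp only [neg_smul, Finset.sum_neg_distrib, ← root_eq_sum_coeff, h]
  · simp [coeff_of_notMem b _ hl]

theorem isPos_neg_iff {i j : ι} (h : P.root j = -P.root i) : b.IsPos j ↔ ¬b.IsPos i := by
  have hh : b.height j = -b.height i := by
    simp only [height_eq_sum_coeff, coeff_neg b h, Finset.sum_neg_distrib]
  have := b.height_ne_zero i
  rw [RootPairing.Base.isPos_iff, RootPairing.Base.isPos_iff, hh]
  lia

theorem coeff_injective {i j : ι} (h : ∀ l ∈ b.support, coeff b i l = coeff b j l) : i = j := by
  apply P.root.injective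
  rw [root_eq_sum_coeff b i, root_eq_sum_coeff b j]
  exact Finset.sum_congr rfl fun l hl => by rw [h l hl]

theorem exists_coeff_ne_zero (i : ι) : ∃ j ∈ b.support, coeff b i j ≠ 0 := by
  by_contra! h
  apply b.height_ne_zero i
  rw [height_eq_sum_coeff]
  exact Finset.sum_eq_zero h

theorem coeff_nonneg {i : ι} (h : b.IsPos i) (j : ι) : 0 ≤ coeff b i j := by
  have h' : 0 < coeff b i ∨ coeff b i < 0 := (b.exists_root_eq_sum_int i).choose_spec.2.1
  refine (h'.resolve_right fun hn => ?_).le j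
  rw [RootPairing.Base.isPos_iff, height_eq_sum_coeff] at h
  exact absurd h (not_lt.2 (Finset.sum_nonpos fun j _ => hn.le j))

/-- The sum of the coefficients of a root outside a set of simple roots. -/
def heightOff (Γ : Finset ι) (i : ι) : ℤ := by
  classical exact ∑ j ∈ b.support \ Γ, coeff b i j

theorem heightOff_add {i j k : ι} (h : P.root k = P.root i + P.root j) (Γ : Finset ι) :
    heightOff b Γ k = heightOff b Γ i + heightOff b Γ j := by
  simp only [heightOff, coeff_add b h, Finset.sum_add_distrib]

theorem heightOff_neg {i j : ι} (h : P.root j = -P.root i) (Γ : Finset ι) :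
    heightOff b Γ j = -heightOff b Γ i := by
  simp only [heightOff, coeff_neg b h, Finset.sum_neg_distrib]

theorem heightOff_nonneg {i : ι} (h : b.IsPos i) (Γ : Finset ι) : 0 ≤ heightOff b Γ i :=
  Finset.sum_nonneg fun j _ => coeff_nonneg b h j

theorem heightOff_nonpos {i : ι} (h : ¬b.IsPos i) (Γ : Finset ι) : heightOff b Γ i ≤ 0 := by
  let := P.indexNeg
  have hn : P.root (-i) = -P.root i := by simp
  have := heightOff_nonneg b ((isPos_neg_iff b hn).2 h) Γ
  rw [heightOff_neg b hn] at this
  lia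

theorem isPos_of_heightOff_pos {i : ι} {Γ : Finset ι} (h : 0 < heightOff b Γ i) : b.IsPos i := by
  by_contra hn
  exact absurd (heightOff_nonpos b hn Γ) (not_le.2 h)

theorem not_isPos_of_heightOff_neg {i : ι} {Γ : Finset ι} (h : heightOff b Γ i < 0) :
    ¬b.IsPos i := fun hn => absurd (heightOff_nonneg b hn Γ) (not_le.2 h)

/-- The coefficients of a root all have one sign, so a vanishing sum forces each term to vanish.
Thus an additive integer detects membership in `Span(Γ)`. -/
theorem heightOff_eq_zero_iff {i : ι} {Γ : Finset ι} :
    heightOff b Γ i = 0 ↔ ∀ j ∉ Γ, coeff b i j = 0 := by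
  classical
  have key : ∀ i, b.IsPos i → (heightOff b Γ i = 0 ↔ ∀ j ∉ Γ, coeff b i j = 0) := by
    intro i hi
    rw [heightOff, Finset.sum_eq_zero_iff_of_nonneg fun j _ => coeff_nonneg b hi j]
    refine ⟨fun h j hj => ?_, fun h j hj => h j (Finset.mem_sdiff.1 hj).2⟩
    by_cases hs : j ∈ b.support
    · exact h j (Finset.mem_sdiff.2 ⟨hs, hj⟩)
    · exact coeff_of_notMem b i hs
  by_cases hi : b.IsPos i
  · exact key i hi
  · let := P.indexNeg
    have hn : P.root (-i) = -P.root i := by simp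
    have := key (-i) ((isPos_neg_iff b hn).2 hi)
    simpa only [heightOff_neg b hn, coeff_neg b hn, neg_eq_zero] using this

/-- `τ` maps the root `i ∈ Span(Γ)` to the root `j`. -/
def SpanMap (P : RootPairing ι R M N) (Γ : Finset ι) (τ : ι → ι) (i j : ι) : Prop :=
  ∃ m : ι → ℤ, P.root i = ∑ l ∈ Γ, m l • P.root l ∧ P.root j = ∑ l ∈ Γ, m l • P.root (τ l)

variable {b} {Γ₁ Γ₂ : Finset ι} {τ : ι → ι}

/-- Simple roots are linearly independent, so the multiplicities `m` are forced to be the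
coefficients. Functionality, injectivity, positivity and nilpotence of the extended `τ` are read off
from this form. -/
theorem spanMap_iff (h₁ : Γ₁ ⊆ b.support) (h₂ : Γ₂ ⊆ b.support) (hτ : Set.BijOn τ Γ₁ Γ₂)
    {i j : ι} : SpanMap P Γ₁ τ i j ↔ heightOff b Γ₁ i = 0 ∧ heightOff b Γ₂ j = 0 ∧
      ∀ l ∈ Γ₁, coeff b j (τ l) = coeff b i l := by
  classical
  have key : ∀ m : ι → ℤ, ∑ l ∈ Γ₂, m l • P.root l = ∑ l ∈ Γ₁, m (τ l) • P.root (τ l) :=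
    fun m => (Finset.sum_nbij τ (fun l hl => hτ.mapsTo hl) hτ.injOn hτ.surjOn
      fun l _ => rfl).symm
  have hsub : ∀ (Γ : Finset ι), Γ ⊆ b.support → ∀ m : ι → ℤ, ∑ l ∈ Γ, m l • P.root l
      = ∑ l ∈ b.support, (if l ∈ Γ then m l else 0) • P.root l := by
    intro Γ hΓ m
    rw [← Finset.sum_subset hΓ]
    · exact Finset.sum_congr rfl fun l hl => by rw [if_pos hl]
    · exact fun l _ hl => by rw [if_neg hl, zero_smul]
  have hsum : ∀ (Γ : Finset ι), Γ ⊆ b.support → ∀ i, heightOff b Γ i = 0 →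
      P.root i = ∑ l ∈ Γ, coeff b i l • P.root l := by
    intro Γ hΓ i hi
    rw [heightOff_eq_zero_iff] at hi
    rw [root_eq_sum_coeff b i]
    refine (Finset.sum_subset hΓ fun l _ hl => ?_).symm
    rw [hi l hl, zero_smul]
  have hcoeff : ∀ (Γ : Finset ι), Γ ⊆ b.support → ∀ i (m : ι → ℤ),
      P.root i = ∑ l ∈ Γ, m l • P.root l →
        heightOff b Γ i = 0 ∧ ∀ l ∈ Γ, coeff b i l = m l := by
    intro Γ hΓ i m hm
    rw [hsub Γ hΓ] at hm
    refine ⟨Finset.sum_eq_zero fun l hl => ?_, fun l hl => ?_⟩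
    · rw [coeff_eq b hm (Finset.mem_sdiff.1 hl).1, if_neg (Finset.mem_sdiff.1 hl).2]
    · rw [coeff_eq b hm (hΓ hl), if_pos hl]
  constructor
  · rintro ⟨m, hi, hj⟩
    have : Nonempty ι := ⟨i⟩
    have hinv : ∀ l ∈ Γ₁, Function.invFunOn τ Γ₁ (τ l) = l := fun l hl =>
      hτ.injOn.leftInvOn_invFunOn hl
    have hj' : P.root j = ∑ l ∈ Γ₂, m (Function.invFunOn τ Γ₁ l) • P.root l := by
      rw [key fun l => m (Function.invFunOn τ Γ₁ l), hj]
      exact Finset.sum_congr rfl fun l hl => by rw [hinv l hl]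
    obtain ⟨hi0, hi⟩ := hcoeff Γ₁ h₁ i m hi
    obtain ⟨hj0, hj⟩ := hcoeff Γ₂ h₂ j _ hj'
    exact ⟨hi0, hj0, fun l hl => by rw [hj _ (hτ.mapsTo hl), hinv l hl, hi l hl]⟩
  · rintro ⟨hi, hj, h⟩
    refine ⟨coeff b i, hsum Γ₁ h₁ i hi, ?_⟩
    rw [hsum Γ₂ h₂ j hj, key]
    exact Finset.sum_congr rfl fun l hl => by rw [h l hl]

omit [CharZero R] in
theorem SpanMap.neg {i j i' j' : ι} (h : SpanMap P Γ₁ τ i j) (hi : P.root i' = -P.root i)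
    (hj : P.root j' = -P.root j) : SpanMap P Γ₁ τ i' j' := by
  obtain ⟨m, h1, h2⟩ := h
  refine ⟨-m, ?_, ?_⟩
  · simp [hi, h1]
  · simp [hj, h2]

theorem SpanMap.functional {i j j' : ι} (h₁ : Γ₁ ⊆ b.support) (h₂ : Γ₂ ⊆ b.support)
    (hτ : Set.BijOn τ Γ₁ Γ₂) (h : SpanMap P Γ₁ τ i j) (h' : SpanMap P Γ₁ τ i j') : j = j' := by
  rw [spanMap_iff h₁ h₂ hτ, heightOff_eq_zero_iff, heightOff_eq_zero_iff] at h h'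
  refine coeff_injective b fun l _ => ?_
  by_cases hl : l ∈ Γ₂
  · obtain ⟨l, hl', rfl⟩ := hτ.surjOn hl
    rw [h.2.2 l hl', h'.2.2 l hl']
  · rw [h.2.1 l hl, h'.2.1 l hl]

theorem SpanMap.injective {i i' j : ι} (h₁ : Γ₁ ⊆ b.support) (h₂ : Γ₂ ⊆ b.support)
    (hτ : Set.BijOn τ Γ₁ Γ₂) (h : SpanMap P Γ₁ τ i j) (h' : SpanMap P Γ₁ τ i' j) : i = i' := by
  rw [spanMap_iff h₁ h₂ hτ, heightOff_eq_zero_iff, heightOff_eq_zero_iff] at h h'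
  refine coeff_injective b fun l _ => ?_
  by_cases hl : l ∈ Γ₁
  · rw [← h.2.2 l hl, ← h'.2.2 l hl]
  · rw [h.1 l hl, h'.1 l hl]

theorem SpanMap.isPos {i j : ι} (h₁ : Γ₁ ⊆ b.support) (h₂ : Γ₂ ⊆ b.support)
    (hτ : Set.BijOn τ Γ₁ Γ₂) (h : SpanMap P Γ₁ τ i j) (hi : b.IsPos i) : b.IsPos j := by
  rw [spanMap_iff h₁ h₂ hτ, heightOff_eq_zero_iff, heightOff_eq_zero_iff] at h
  rw [RootPairing.Base.isPos_iff', height_eq_sum_coeff]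
  refine Finset.sum_nonneg fun l _ => ?_
  by_cases hl : l ∈ Γ₂
  · obtain ⟨l, hl', rfl⟩ := hτ.surjOn hl
    rw [h.2.2 l hl']
    exact coeff_nonneg b hi l
  · rw [h.2.1 l hl]

/-- Induction on the height. A positive root in `Span(Γ₁)` other than a simple one is lowered,
inside the span, by the reflection in some `j ∈ Γ₁`. As `τ` preserves Cartan integers, it carries
the reflection in `j` to the reflection in `τ j`, so the image of the lower root can be reflected
back up. Negative roots follow by a change of sign. -/
theorem exists_spanMap [Finite ι] [P.IsCrystallographic] [P.IsReduced]
    (hP : ∀ i ∈ Γ₁, ∀ j ∈ Γ₁, P.pairing (τ i) (τ j) = P.pairing i j) {i : ι}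
    (hi : heightOff b Γ₁ i = 0) : ∃ j, SpanMap P Γ₁ τ i j := by
  classical
  have key : ∀ (n : ℕ) (i : ι), (b.height i).toNat = n → b.IsPos i → heightOff b Γ₁ i = 0 →
      ∃ j, SpanMap P Γ₁ τ i j := by
    intro n
    induction n using Nat.strongRecOn with
    | ind n ih =>
    intro i hn hpos hi
    obtain ⟨j, hj, hij⟩ := hpos.exists_mem_support_pos_pairingIn
    rw [P.zero_lt_pairingIn_iff'] at hij
    have hi' := hi
    rw [heightOff_eq_zero_iff] at hi'
    -- If `j` were outside `Γ₁`, the root would be a nonnegative combination of simple roots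
    -- different from `j`, each pairing nonpositively with `j`.
    have hjΓ : j ∈ Γ₁ := by
      by_contra hjΓ
      refine absurd hij (not_lt.2 ?_)
      have : P.pairingIn ℤ i j = ∑ l ∈ b.support, coeff b i l * P.pairingIn ℤ l j := by
        apply (algebraMap ℤ R).injective_int
        simp_rw [map_sum, map_mul, P.algebraMap_pairingIn, ← P.root_coroot_eq_pairing]
        rw [root_eq_sum_coeff b i]
        simp
      rw [this]
      refine Finset.sum_nonpos fun l hl => ?_
      by_cases hlj : l = j
      · rw [hlj, hi' j hjΓ, zero_mul]
      · exact mul_nonpos_of_nonneg_of_nonpos (coeff_nonneg b hpos l)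
          (b.pairingIn_le_zero_of_ne hlj hl hj)
    by_cases hne : i = j
    · subst hne
      refine ⟨τ i, Pi.single i 1, ?_, ?_⟩ <;>
      · rw [Finset.sum_eq_single_of_mem i hjΓ fun l _ hl => by simp [hl]]
        simp
    set k := P.reflectionPerm j i with hk
    have hkroot : P.root k = P.root i + (-P.pairingIn ℤ i j) • P.root j := by
      rw [hk, P.root_reflectionPerm, neg_smul, P.reflection_apply_root' ℤ, sub_eq_add_neg]
    have hik : P.root i = P.root k + (-P.pairingIn ℤ k j) • P.root j := by
      rw [neg_smul, ← sub_eq_add_neg, ← P.reflection_apply_root' ℤ, ← P.root_reflectionPerm, hk,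
        P.reflectionPerm_self]
    have hkpos : b.IsPos k := hpos.reflectionPerm hj hne
    have hcoeff : ∀ l ∈ b.support, coeff b k l
        = coeff b i l + (-P.pairingIn ℤ i j) * coeff b j l := by
      intro l hl
      refine coeff_eq b (f := fun l => coeff b i l + (-P.pairingIn ℤ i j) * coeff b j l) ?_ hl
      simp only [add_smul, Finset.sum_add_distrib, mul_smul, ← Finset.smul_sum,
        ← root_eq_sum_coeff, hkroot]
    have hj0 : heightOff b Γ₁ j = 0 := by
      refine Finset.sum_eq_zero fun l hl => ?_
      have hlj : l ≠ j := fun h => (Finset.mem_sdiff.1 hl).2 (h ▸ hjΓ)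
      rw [coeff_eq b (f := Pi.single j 1) ?_ (Finset.mem_sdiff.1 hl).1, Pi.single_eq_of_ne hlj]
      rw [Finset.sum_eq_single_of_mem j hj fun l _ hl => by simp [hl]]
      simp
    have hk0 : heightOff b Γ₁ k = 0 := by
      have : heightOff b Γ₁ k
          = heightOff b Γ₁ i + (-P.pairingIn ℤ i j) * heightOff b Γ₁ j := by
        simp only [heightOff, Finset.mul_sum, ← Finset.sum_add_distrib]
        exact Finset.sum_congr rfl fun l hl => hcoeff l (Finset.mem_sdiff.1 hl).1
      rw [this, hi, hj0, mul_zero, add_zero]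
    have hheight : b.height k < b.height i := by
      rw [b.height_add_zsmul hkroot, RootPairing.Base.height_one_of_mem_support hj]
      simp only [smul_eq_mul, mul_one]
      lia
    obtain ⟨k', m, hm, hm'⟩ := ih _ (by
      have := (RootPairing.Base.isPos_iff b).1 hkpos
      lia) k rfl hkpos hk0
    -- The pairing is additive in the first argument, so preservation on `Γ₁` extends to `k` and its
    -- image `k'`.
    have hpair : P.pairing k' (τ j) = P.pairing k j := by
      rw [← P.root_coroot_eq_pairing, ← P.root_coroot_eq_pairing, hm, hm']
      simp only [map_sum, map_zsmul, LinearMap.sum_apply, LinearMap.smul_apply,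
        P.root_coroot_eq_pairing]
      exact Finset.sum_congr rfl fun l hl => by rw [hP l hl j hjΓ]
    have hpair' : P.pairingIn ℤ k' (τ j) = P.pairingIn ℤ k j := by
      apply (algebraMap ℤ R).injective_int
      rw [P.algebraMap_pairingIn, P.algebraMap_pairingIn, hpair]
    refine ⟨P.reflectionPerm (τ j) k', m + Pi.single j (-P.pairingIn ℤ k j), ?_, ?_⟩
    · simp only [Pi.add_apply, add_smul, Finset.sum_add_distrib, ← hm]
      rw [Finset.sum_eq_single_of_mem j hjΓ fun l _ hl => by simp [hl], hik]
      simp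
    · simp only [Pi.add_apply, add_smul, Finset.sum_add_distrib, ← hm']
      rw [Finset.sum_eq_single_of_mem j hjΓ fun l _ hl => by simp [hl], P.root_reflectionPerm,
        P.reflection_apply_root' ℤ, hpair', sub_eq_add_neg]
      simp
  by_cases hpos : b.IsPos i
  · exact key _ i rfl hpos hi
  · let := P.indexNeg
    have hn : P.root (-i) = -P.root i := by simp
    obtain ⟨j, hj⟩ := key _ (-i) rfl ((isPos_neg_iff b hn).2 hpos)
      (by rw [heightOff_neg b hn, hi, neg_zero])
    exact ⟨-j, hj.neg (by simp) (by simp)⟩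

/-- The inverse of `τ` on `Γ₂` satisfies the same hypotheses, so `exists_spanMap` applies to it. -/
theorem exists_spanMap_left [Finite ι] [P.IsCrystallographic] [P.IsReduced] (h₁ : Γ₁ ⊆ b.support)
    (h₂ : Γ₂ ⊆ b.support) (hτ : Set.BijOn τ Γ₁ Γ₂)
    (hP : ∀ i ∈ Γ₁, ∀ j ∈ Γ₁, P.pairing (τ i) (τ j) = P.pairing i j) {j : ι}
    (hj : heightOff b Γ₂ j = 0) : ∃ i, SpanMap P Γ₁ τ i j := by
  rcases isEmpty_or_nonempty ι with hι | hι
  · exact hι.elim j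
  have hinv := hτ.invOn_invFunOn
  have hτ' : Set.BijOn (Function.invFunOn τ Γ₁) Γ₂ Γ₁ := hτ.symm hinv.symm
  obtain ⟨i, hi⟩ := exists_spanMap (fun k hk l hl => by
    rw [← hP _ (hτ'.mapsTo hk) _ (hτ'.mapsTo hl), hinv.2 hk, hinv.2 hl]) hj
  rw [spanMap_iff h₂ h₁ hτ'] at hi
  refine ⟨i, (spanMap_iff h₁ h₂ hτ).2 ⟨hi.2.1, hi.1, fun l hl => ?_⟩⟩
  rw [← hi.2.2 _ (hτ.mapsTo hl), hinv.1 hl]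

/-- The extension of `τ` to the roots in the span of `Γ₁` is nilpotent. -/
theorem wellFounded_spanMap (h₁ : Γ₁ ⊆ b.support) (h₂ : Γ₂ ⊆ b.support)
    (hτ : Set.BijOn τ Γ₁ Γ₂)
    (hnil : ∀ i ∈ Γ₁, ∃ j ∈ Γ₂, j ∉ Γ₁ ∧
      Relation.ReflTransGen (fun k l => k ∈ Γ₁ ∧ τ k = l) i j) :
    WellFounded fun j i => SpanMap P Γ₁ τ i j := by
  -- On the simple roots themselves, every `τ`-chain reaches a root outside `Γ₁` and stops there.
  have hacc : ∀ i, Acc (fun l k => k ∈ Γ₁ ∧ τ k = l) i := by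
    intro i
    by_cases hi : i ∈ Γ₁
    · obtain ⟨j, -, hj, hij⟩ := hnil i hi
      induction hij using Relation.ReflTransGen.head_induction_on with
      | refl => exact absurd hi hj
      | @head k l hkl _ ih =>
        refine Acc.intro _ fun y hy => ?_
        obtain rfl : l = y := hkl.2.symm.trans hy.2
        by_cases hl : l ∈ Γ₁
        · exact ih hl
        · exact Acc.intro _ fun y hy => absurd hy.1 hl
    · exact Acc.intro _ fun y hy => absurd hy.1 hi
  -- A chain of roots is controlled by one simple root: if `l` occurs in `i`, then `l ∈ Γ₁` and `τ
  -- l` occurs in the image of `i`.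
  have key : ∀ l, ∀ i, coeff b i l ≠ 0 → Acc (fun j i => SpanMap P Γ₁ τ i j) i := by
    intro l
    induction hacc l with
    | intro l _ ih =>
      intro i hi
      refine Acc.intro _ fun j hj => ?_
      rw [spanMap_iff h₁ h₂ hτ, heightOff_eq_zero_iff] at hj
      have hl : l ∈ Γ₁ := by
        by_contra hl
        exact hi (hj.1 l hl)
      exact ih (τ l) ⟨hl, rfl⟩ j (by rwa [hj.2.2 l hl])
  refine ⟨fun i => ?_⟩
  obtain ⟨l, -, hl⟩ := exists_coeff_ne_zero b i
  exact key l i hl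

end Roots

/-! ### Root vectors in Belavin–Drinfeld data -/

namespace BDData

open LieAlgebra.IsKilling

variable {𝔤 : Type*} [LieRing 𝔤] [LieAlgebra ℂ 𝔤] [FiniteDimensional ℂ 𝔤]
  [LieAlgebra.IsSimple ℂ 𝔤] {F : Type*} [Field F] [Algebra ℂ F] (D : BDData 𝔤 F)

/-- The root system of the Cartan subalgebra. -/
abbrev P := rootSystem D.H

/-- The opposite of a root. -/
def negRoot (α : D.H.root) : D.H.root :=
  ⟨-α.1, by simpa using D.H.isNonZero_coe_root α⟩

theorem root_negRoot (α : D.H.root) : D.P.root (D.negRoot α) = -D.P.root α := rfl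

theorem negRoot_negRoot (α : D.H.root) : D.negRoot (D.negRoot α) = α :=
  Subtype.ext (neg_neg α.1)

theorem eq_negRoot {α β : D.H.root} (h : D.P.root α + D.P.root β = 0) : β = D.negRoot α :=
  D.P.root.injective (by rw [root_negRoot, eq_neg_iff_add_eq_zero, add_comm, h])

theorem lie_e (α : D.H.root) (h : D.H) : ⁅(h : 𝔤), D.e α⁆ = D.P.root α h • D.e α :=
  lie_eq_smul_of_mem_rootSpace (D.e_mem α) h

theorem e_normalized' (α : D.H.root) : D.B (D.e α) (D.e (D.negRoot α)) = 1 := D.e_normalized α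

theorem e_ne_zero (α : D.H.root) : D.e α ≠ 0 := by
  intro h
  have := D.e_normalized α
  rw [h, map_zero, LinearMap.zero_apply] at this
  exact zero_ne_one this

/-- The form restricted to the Cartan subalgebra. -/
def BH : LinearMap.BilinForm ℂ D.H :=
  D.B.compl₁₂ D.H.toSubmodule.subtype D.H.toSubmodule.subtype

theorem BH_apply (h h' : D.H) : D.BH h h' = D.B h h' := rfl

theorem BH_symm : D.BH.IsSymm := ⟨fun x y => D.B_symm.eq x y⟩

theorem BH_t (k : Fin (Module.finrank ℂ D.H)) (h : D.H) : D.BH h (D.t k) = D.t.repr h k := by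
  conv_lhs => rw [← D.t.sum_repr h]
  rw [map_sum, LinearMap.sum_apply]
  simp [BH_apply, D.t_orthonormal]

theorem BH_nondegenerate : D.BH.Nondegenerate := by
  rw [LinearMap.BilinForm.Nondegenerate,
    D.BH_symm.isRefl.nondegenerate_iff_separatingLeft]
  intro h hh
  refine D.t.repr.injective (Finsupp.ext fun k => ?_)
  rw [← BH_t, hh, map_zero, Finsupp.zero_apply]

theorem BH_eq_sum (h h' : D.H) : D.BH h h' = ∑ k, D.BH h (D.t k) * D.BH h' (D.t k) := by
  conv_lhs => rw [← D.t.sum_repr h']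
  simp only [map_sum, map_smul, smul_eq_mul]
  exact Finset.sum_congr rfl fun k _ => by rw [BH_t, BH_t, mul_comm]

theorem B_e_e {α β : D.H.root} (h : β ≠ D.negRoot α) : D.B (D.e α) (D.e β) = 0 := by
  have hne : D.P.root α + D.P.root β ≠ 0 := fun h' => h (D.eq_negRoot h')
  obtain ⟨x, hx⟩ : ∃ x : D.H, (D.P.root α + D.P.root β) x ≠ 0 := by
    by_contra! hx
    exact hne (LinearMap.ext hx)
  have h1 := D.B_invariant x (D.e α) (D.e β)
  rw [lie_e, lie_e, map_smul, map_smul, LinearMap.smul_apply, smul_eq_mul, smul_eq_mul] at h1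
  have : (D.P.root α + D.P.root β) x * D.B (D.e α) (D.e β) = 0 := by
    rw [LinearMap.add_apply]
    linear_combination h1
  exact (mul_eq_zero.1 this).resolve_left hx

theorem B_H_e (h : D.H) (α : D.H.root) : D.B h (D.e α) = 0 := by
  obtain ⟨x, hx⟩ : ∃ x : D.H, D.P.root α x ≠ 0 := by
    by_contra! hx
    exact D.P.ne_zero α (LinearMap.ext hx)
  have h1 := D.B_invariant x (h : 𝔤) (D.e α)
  have h2 : ⁅(x : 𝔤), (h : 𝔤)⁆ = 0 := congrArg Subtype.val (trivial_lie_zero D.H D.H x h)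
  rw [h2, lie_e, map_smul, smul_eq_mul, map_zero, LinearMap.zero_apply] at h1
  exact (mul_eq_zero.1 (neg_eq_zero.1 h1.symm)).resolve_left hx

/-- The element of the Cartan subalgebra dual to a root. -/
def dualElt (α : D.H.root) : D.H :=
  killingForm ℂ 𝔤 (D.e α) (D.e (D.negRoot α)) • (cartanEquivDual D.H).symm (D.P.root α)

theorem lie_e_negRoot (α : D.H.root) :
    ⁅D.e α, D.e (D.negRoot α)⁆ = (D.dualElt α : 𝔤) :=
  lie_eq_killingForm_smul_of_mem_rootSpace_of_mem_rootSpace_neg (D.e_mem α)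
    (D.e_mem (D.negRoot α))

theorem BH_dualElt (α : D.H.root) (h : D.H) : D.BH (D.dualElt α) h = D.P.root α h := by
  rw [BH_apply, ← lie_e_negRoot, lieInvariant.apply_lie D.B_invariant, ← lie_skew, lie_e,
    root_negRoot, LinearMap.neg_apply, neg_smul, neg_neg, map_smul, e_normalized', smul_eq_mul,
    mul_one]

/-- `dualElt α` is a nonzero multiple of the Killing dual of `α`, and the factor cancels in the
Cartan integer `2(β, α)/(α, α)`. Hence isometry of `τ` with respect to `B` gives preservation of
Cartan integers. -/
theorem pairing_eq (α β : D.H.root) : D.P.pairing β α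
    = 2 * ((∑ k, β.1 (D.t k) * α.1 (D.t k)) / ∑ k, α.1 (D.t k) * α.1 (D.t k)) := by
  have key : ∀ β : D.H.root, D.P.root β (D.dualElt α) = ∑ k, β.1 (D.t k) * α.1 (D.t k) := by
    intro β
    rw [← BH_dualElt, BH_eq_sum]
    simp only [BH_dualElt]
    rfl
  have hk : killingForm ℂ 𝔤 (D.e α) (D.e (D.negRoot α)) ≠ 0 := by
    intro hk
    refine D.P.ne_zero α (LinearMap.ext fun h => ?_)
    rw [← BH_dualElt, dualElt, hk, zero_smul]
    simp
  rw [← key β, ← key α]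
  have h1 : D.P.pairing β α = D.P.root β (coroot α.1) := rfl
  have h2 : coroot α.1 = (2 : ℕ) • (D.P.root α ((cartanEquivDual D.H).symm (D.P.root α)))⁻¹ •
    (cartanEquivDual D.H).symm (D.P.root α) := rfl
  rw [h1, h2, dualElt]
  simp only [map_nsmul, map_smul, smul_eq_mul, nsmul_eq_mul]
  rw [mul_div_mul_left _ _ hk]
  push_cast
  ring

theorem pairing_τ : ∀ α ∈ D.triple.Γ₁, ∀ β ∈ D.triple.Γ₁,
    D.P.pairing (D.triple.τ α) (D.triple.τ β) = D.P.pairing α β := by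
  intro α hα β hβ
  rw [pairing_eq, pairing_eq, D.isometric α hα β hβ, D.isometric β hβ β hβ]

theorem lie_e_e (α β : D.H.root) : β = D.negRoot α ∨
    (∃ γ, D.P.root γ = D.P.root α + D.P.root β ∧ ∃ c : ℂ, ⁅D.e α, D.e β⁆ = c • D.e γ) ∨
    ⁅D.e α, D.e β⁆ = 0 := by
  by_cases h0 : D.P.root α + D.P.root β = 0
  · exact Or.inl (D.eq_negRoot h0)
  right
  by_cases hl : ⁅D.e α, D.e β⁆ = 0
  · exact Or.inr hl
  left
  have hmem : ⁅D.e α, D.e β⁆ ∈ LieAlgebra.rootSpace D.H (α.1 + β.1 : D.H → ℂ) :=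
    LieAlgebra.lie_mem_genWeightSpace_of_mem_genWeightSpace (D.e_mem α) (D.e_mem β)
  let χ : LieModule.Weight ℂ D.H 𝔤 := ⟨α.1 + β.1, fun h => hl (by simpa [h] using hmem)⟩
  have hχ : χ.IsNonZero := fun h => h0 (LinearMap.ext fun x => congrFun h x)
  let γ : D.H.root := ⟨χ, by simpa [LieSubalgebra.root] using hχ⟩
  refine ⟨γ, LinearMap.ext fun x => rfl, ?_⟩
  have hdim := finrank_rootSpace_eq_one χ hχ
  obtain ⟨c, hc⟩ := (finrank_eq_one_iff_of_nonzero' (⟨D.e γ, D.e_mem γ⟩ : LieAlgebra.rootSpace D.H χ)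
    (fun h => D.e_ne_zero γ (congrArg Subtype.val h))).1 hdim ⟨⁅D.e α, D.e β⁆, hmem⟩
  exact ⟨c, (congrArg Subtype.val hc).symm⟩

theorem eq_top_of_mem {W : Submodule ℂ 𝔤} (hH : ∀ h : D.H, (h : 𝔤) ∈ W)
    (he : ∀ α : D.H.root, D.e α ∈ W) : W = ⊤ := by
  rw [eq_top_iff, ← LieSubmodule.top_toSubmodule (R := ℂ) (L := D.H) (M := 𝔤),
    ← LieModule.iSup_genWeightSpace_eq_top' ℂ D.H 𝔤, LieSubmodule.iSup_toSubmodule, iSup_le_iff]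
  intro χ x hx
  by_cases hχ : χ.IsZero
  · have hx' : x ∈ LieAlgebra.rootSpace D.H (0 : D.H → ℂ) := hχ ▸ hx
    rw [LieAlgebra.rootSpace_zero_eq, LieSubalgebra.mem_toLieSubmodule] at hx'
    exact hH ⟨x, hx'⟩
  · let γ : D.H.root := ⟨χ, by simpa [LieSubalgebra.root] using hχ⟩
    have hdim := finrank_rootSpace_eq_one χ hχ
    obtain ⟨c, hc⟩ := (finrank_eq_one_iff_of_nonzero'
      (⟨D.e γ, D.e_mem γ⟩ : LieAlgebra.rootSpace D.H χ)
      (fun h => D.e_ne_zero γ (congrArg Subtype.val h))).1 hdim ⟨x, hx⟩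
    have : c • D.e γ = x := congrArg Subtype.val hc
    rw [← this]
    exact W.smul_mem c (he γ)

/-! #### The extension of `τ` -/

theorem Ext.neg {α β : D.H.root} (h : D.triple.Ext α β) :
    D.triple.Ext (D.negRoot α) (D.negRoot β) :=
  SpanMap.neg h (D.root_negRoot α) (D.root_negRoot β)

theorem Ext.functional {α β β' : D.H.root} (h : D.triple.Ext α β) (h' : D.triple.Ext α β') :
    β = β' :=
  SpanMap.functional D.triple.Γ₁_subset D.triple.Γ₂_subset D.triple.bijOn h h'

theorem Ext.injective {α α' β : D.H.root} (h : D.triple.Ext α β) (h' : D.triple.Ext α' β) :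
    α = α' :=
  SpanMap.injective D.triple.Γ₁_subset D.triple.Γ₂_subset D.triple.bijOn h h'

theorem Ext.isPos {α β : D.H.root} (h : D.triple.Ext α β) (hα : D.base.IsPos α) :
    D.base.IsPos β :=
  SpanMap.isPos D.triple.Γ₁_subset D.triple.Γ₂_subset D.triple.bijOn h hα

theorem isPos_negRoot {α : D.H.root} : D.base.IsPos (D.negRoot α) ↔ ¬D.base.IsPos α :=
  isPos_neg_iff D.base (D.root_negRoot α)

theorem Ext.isPos_iff {α β : D.H.root} (h : D.triple.Ext α β) :
    D.base.IsPos α ↔ D.base.IsPos β := by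
  refine ⟨Ext.isPos D h, fun hβ => ?_⟩
  by_contra hα
  exact (D.isPos_negRoot.1 (Ext.isPos D (Ext.neg D h) (D.isPos_negRoot.2 hα))) hβ

theorem Ext.heightOff {α β : D.H.root} (h : D.triple.Ext α β) :
    heightOff D.base D.triple.Γ₁ α = 0 ∧ heightOff D.base D.triple.Γ₂ β = 0 := by
  have := (spanMap_iff D.triple.Γ₁_subset D.triple.Γ₂_subset D.triple.bijOn).1 h
  exact ⟨this.1, this.2.1⟩

theorem exists_ext {α : D.H.root} (h : TwistedBD.heightOff D.base D.triple.Γ₁ α = 0) :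
    ∃ β, D.triple.Ext α β :=
  exists_spanMap D.pairing_τ h

theorem exists_ext_left {β : D.H.root} (h : TwistedBD.heightOff D.base D.triple.Γ₂ β = 0) :
    ∃ α, D.triple.Ext α β :=
  exists_spanMap_left D.triple.Γ₁_subset D.triple.Γ₂_subset D.triple.bijOn D.pairing_τ h

theorem wellFounded_ext : WellFounded fun β α => D.triple.Ext α β :=
  wellFounded_spanMap D.triple.Γ₁_subset D.triple.Γ₂_subset D.triple.bijOn D.triple.nilpotent

theorem not_transGen_ext (α : D.H.root) : ¬Relation.TransGen D.triple.Ext α α := by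
  intro h
  have h' : Relation.TransGen (fun β α => D.triple.Ext α β) α α :=
    Relation.transGen_swap.2 h
  exact D.wellFounded_ext.transGen.irrefl.irrefl α h'

/-- There are finitely many roots and no `τ`-cycles, so chains also terminate backwards. -/
theorem wellFounded_ext_swap : WellFounded D.triple.Ext := by
  have : IsTrans D.H.root (Relation.TransGen D.triple.Ext) :=
    ⟨fun _ _ _ => Relation.TransGen.trans⟩
  have : Std.Irrefl (Relation.TransGen D.triple.Ext) := ⟨D.not_transGen_ext⟩
  exact Subrelation.wf (fun h => Relation.TransGen.single h)
    (Finite.wellFounded_of_trans_of_irrefl (Relation.TransGen D.triple.Ext))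

theorem not_prec_self (α : D.H.root) : ¬D.triple.Prec α α := fun h =>
  D.not_transGen_ext α (Relation.TransGen.mono (fun _ _ h => h.2) α α h)

theorem Prec.isPos_left {α β : D.H.root} (h : D.triple.Prec α β) : D.base.IsPos α := by
  obtain ⟨_, h, -⟩ := Relation.TransGen.head'_iff.1 h
  exact h.1

theorem Prec.isPos_right {α β : D.H.root} (h : D.triple.Prec α β) : D.base.IsPos β := by
  obtain ⟨_, -, h⟩ := Relation.TransGen.tail'_iff.1 h
  exact Ext.isPos D h.2 h.1

theorem Prec.heightOff_left {α β : D.H.root} (h : D.triple.Prec α β) :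
    TwistedBD.heightOff D.base D.triple.Γ₁ α = 0 := by
  obtain ⟨_, h, -⟩ := Relation.TransGen.head'_iff.1 h
  exact (Ext.heightOff D h.2).1

theorem Prec.heightOff_right {α β : D.H.root} (h : D.triple.Prec α β) :
    TwistedBD.heightOff D.base D.triple.Γ₂ β = 0 := by
  obtain ⟨_, -, h⟩ := Relation.TransGen.tail'_iff.1 h
  exact (Ext.heightOff D h.2).2

/-- As `τ` is single-valued, every chain leaving `α` starts with `α'`. This is what makes the sum
over `k` in the `r`-matrix telescope. -/
theorem prec_iff_left {α α' : D.H.root} (hα : D.base.IsPos α) (h : D.triple.Ext α α')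
    (β : D.H.root) : D.triple.Prec α β ↔ β = α' ∨ D.triple.Prec α' β := by
  rw [AdmissibleTriple.Prec, Relation.TransGen.head'_iff]
  constructor
  · rintro ⟨γ, h1, h2⟩
    obtain rfl := Ext.functional D h h1.2
    rcases Relation.reflTransGen_iff_eq_or_transGen.1 h2 with h2 | h2
    · exact Or.inl h2
    · exact Or.inr h2
  · rintro (rfl | h2)
    · exact ⟨β, ⟨hα, h⟩, .refl⟩
    · exact ⟨α', ⟨hα, h⟩, h2.to_reflTransGen⟩

theorem prec_iff_right {α α' : D.H.root} (hα : D.base.IsPos α) (h : D.triple.Ext α α')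
    (γ : D.H.root) : D.triple.Prec γ α' ↔ γ = α ∨ D.triple.Prec γ α := by
  rw [AdmissibleTriple.Prec, Relation.TransGen.tail'_iff]
  constructor
  · rintro ⟨β, h1, h2⟩
    obtain rfl := Ext.injective D h h2.2
    rcases Relation.reflTransGen_iff_eq_or_transGen.1 h1 with h1 | h1
    · exact Or.inl h1.symm
    · exact Or.inr h1
  · rintro (rfl | h2)
    · exact ⟨γ, .refl, ⟨hα, h⟩⟩
    · exact ⟨α, h2.to_reflTransGen, ⟨hα, h⟩⟩

end BDData

/-! ### The Belavin–Drinfeld `r`-matrix as an operator -/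

namespace BDData

variable {𝔤 : Type*} [LieRing 𝔤] [LieAlgebra ℂ 𝔤] [FiniteDimensional ℂ 𝔤]
  [LieAlgebra.IsSimple ℂ 𝔤] {F : Type*} [Field F] [Algebra ℂ F] (D : BDData 𝔤 F)

/-- A root vector as an element of `𝔤(F)`. -/
def eF (α : D.H.root) : F ⊗[ℂ] 𝔤 := 1 ⊗ₜ D.e α

/-- The inclusion of the Cartan subalgebra of `𝔤(F)`. -/
def incl : F ⊗[ℂ] D.H →ₗ[F] F ⊗[ℂ] 𝔤 := D.H.toSubmodule.subtype.baseChange F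

theorem incl_tmul (s : F) (h : D.H) : D.incl (s ⊗ₜ h) = s ⊗ₜ (h : 𝔤) := rfl

/-- The invariant form on `𝔤(F)`. -/
abbrev BF : LinearMap.BilinForm F (F ⊗[ℂ] 𝔤) := D.B.baseChange F

/-- The invariant form on the Cartan subalgebra of `𝔤(F)`. -/
abbrev BHF : LinearMap.BilinForm F (F ⊗[ℂ] D.H) := D.BH.baseChange F

theorem BF_incl_incl (x y : F ⊗[ℂ] D.H) : D.BF (D.incl x) (D.incl y) = D.BHF x y := by
  induction x using TensorProduct.induction_on with
  | zero => simp
  | add x x' h h' => simp only [map_add, LinearMap.add_apply, h, h']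
  | tmul s x =>
    induction y using TensorProduct.induction_on with
    | zero => simp
    | add x x' h h' => simp only [map_add, h, h']
    | tmul s' y =>
      rw [incl_tmul, incl_tmul, LinearMap.BilinForm.baseChange_tmul,
        LinearMap.BilinForm.baseChange_tmul, BH_apply]

theorem BF_tmul_eF (x : 𝔤) (α : D.H.root) :
    D.BF ((1 : F) ⊗ₜ x) (D.eF α) = algebraMap ℂ F (D.B x (D.e α)) := by
  rw [eF, LinearMap.BilinForm.baseChange_tmul, one_mul, Algebra.algebraMap_eq_smul_one]

theorem BF_eF_eF_of_ne {α β : D.H.root} (h : β ≠ D.negRoot α) : D.BF (D.eF α) (D.eF β) = 0 := by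
  rw [eF, BF_tmul_eF, B_e_e D h, map_zero]

theorem BF_eF_negRoot (α : D.H.root) : D.BF (D.eF (D.negRoot α)) (D.eF α) = 1 := by
  have h := D.e_normalized' (D.negRoot α)
  rw [negRoot_negRoot] at h
  rw [eF, BF_tmul_eF, h, map_one]

theorem BF_incl_eF (x : F ⊗[ℂ] D.H) (α : D.H.root) : D.BF (D.incl x) (D.eF α) = 0 := by
  induction x using TensorProduct.induction_on with
  | zero => simp
  | add x x' h h' => simp only [map_add, LinearMap.add_apply, h, h', add_zero]
  | tmul s x => rw [incl_tmul, eF, LinearMap.BilinForm.baseChange_tmul, B_H_e, zero_smul]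

theorem BF_symm : D.BF.IsSymm := isSymm_baseChange F D.B_symm

theorem BHF_symm : D.BHF.IsSymm := isSymm_baseChange F D.BH_symm

theorem BF_eF_incl (x : F ⊗[ℂ] D.H) (α : D.H.root) : D.BF (D.eF α) (D.incl x) = 0 := by
  rw [D.BF_symm.eq, BF_incl_eF]

theorem lie_incl_eF (x : F ⊗[ℂ] D.H) (α : D.H.root) :
    ⁅D.incl x, D.eF α⁆ = formExt F (D.P.root α) x • D.eF α := by
  induction x using TensorProduct.induction_on with
  | zero => simp
  | add x x' h h' => simp only [map_add, add_lie, h, h', add_smul]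
  | tmul s x =>
    rw [incl_tmul, eF, LieAlgebra.ExtendScalars.bracket_tmul, lie_e, mul_one,
      TensorProduct.smul_tmul', TensorProduct.tmul_smul, TensorProduct.smul_tmul']
    congr 1
    simp [formExt, Algebra.smul_def, mul_comm]

theorem lie_incl_incl (x y : F ⊗[ℂ] D.H) : ⁅D.incl x, D.incl y⁆ = 0 := by
  induction x using TensorProduct.induction_on with
  | zero => simp
  | add x x' h h' => simp only [map_add, add_lie, h, h', add_zero]
  | tmul s x =>
    induction y using TensorProduct.induction_on with
    | zero => simp
    | add x x' h h' => simp only [map_add, lie_add, h, h', add_zero]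
    | tmul s' y =>
      have h2 : ⁅(x : 𝔤), (y : 𝔤)⁆ = 0 := congrArg Subtype.val (trivial_lie_zero D.H D.H x y)
      rw [incl_tmul, incl_tmul, LieAlgebra.ExtendScalars.bracket_tmul, h2,
        TensorProduct.tmul_zero]

theorem eq_top_of_memF {W : Submodule F (F ⊗[ℂ] 𝔤)} (hH : ∀ x, D.incl x ∈ W)
    (he : ∀ α, D.eF α ∈ W) : W = ⊤ := by
  have key : (W.restrictScalars ℂ).comap (TensorProduct.mk ℂ F 𝔤 1) = ⊤ :=
    D.eq_top_of_mem (fun h => hH (1 ⊗ₜ h)) (fun α => he α)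
  refine eq_top_iff.2 fun x _ => ?_
  induction x using TensorProduct.induction_on with
  | zero => exact W.zero_mem
  | add x y hx hy => exact W.add_mem (hx trivial) (hy trivial)
  | tmul s x =>
    have hx : x ∈ (W.restrictScalars ℂ).comap (TensorProduct.mk ℂ F 𝔤 1) := key ▸ trivial
    have : s ⊗ₜ[ℂ] x = s • ((1 : F) ⊗ₜ[ℂ] x) := by simp [TensorProduct.smul_tmul']
    rw [this]
    exact W.smul_mem s hx

/-! #### The Cartan part -/

/-- The operator attached to `r₀`. -/
def f₀ : F ⊗[ℂ] D.H →ₗ[F] F ⊗[ℂ] D.H := tensorOp D.BHF D.r₀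

theorem tensorOp_sum_t (x : F ⊗[ℂ] D.H) :
    tensorOp D.BHF (∑ k, ((1 : F) ⊗ₜ[ℂ] D.t k) ⊗ₜ[F] ((1 : F) ⊗ₜ[ℂ] D.t k)) x = x := by
  rw [map_sum, LinearMap.sum_apply]
  induction x using TensorProduct.induction_on with
  | zero => simp
  | add x y hx hy => simp only [map_add, Finset.sum_add_distrib, hx, hy]
  | tmul s x =>
    conv_rhs => rw [← D.t.sum_repr x, TensorProduct.tmul_sum]
    refine Finset.sum_congr rfl fun k _ => ?_
    rw [tensorOp_tmul, LinearMap.BilinForm.baseChange_tmul, D.BH_symm.eq, BH_t, one_mul,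
      TensorProduct.smul_tmul', TensorProduct.tmul_smul, TensorProduct.smul_tmul', smul_eq_mul,
      mul_one]

/-- The symmetric part of `r₀` is half the Cartan Casimir tensor, so `f₀* = 1 - f₀`. -/
theorem tensorOp_comm_r₀ (x : F ⊗[ℂ] D.H) :
    tensorOp D.BHF (TensorProduct.comm F _ _ D.r₀) x = x - D.f₀ x := by
  have := tensorOp_sum_t D x
  rw [← D.r₀_symm, map_add, LinearMap.add_apply] at this
  rw [eq_sub_iff_add_eq, add_comm]
  exact this

theorem BHF_lid (χ : Module.Dual F (F ⊗[ℂ] D.H)) (t : (F ⊗[ℂ] D.H) ⊗[F] (F ⊗[ℂ] D.H))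
    (x : F ⊗[ℂ] D.H) : D.BHF (TensorProduct.lid F _ (χ.rTensor _ t)) x
      = χ (tensorOp D.BHF (TensorProduct.comm F _ _ t) x) := by
  induction t using TensorProduct.induction_on with
  | zero => simp
  | add s t hs ht => simp only [map_add, LinearMap.add_apply, hs, ht]
  | tmul u v =>
    rw [TensorProduct.comm_tmul, tensorOp_tmul, LinearMap.rTensor_tmul, TensorProduct.lid_tmul,
      map_smul, map_smul, LinearMap.smul_apply, smul_eq_mul, smul_eq_mul, mul_comm]

theorem BHF_rid (χ : Module.Dual F (F ⊗[ℂ] D.H)) (t : (F ⊗[ℂ] D.H) ⊗[F] (F ⊗[ℂ] D.H))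
    (x : F ⊗[ℂ] D.H) : D.BHF (TensorProduct.rid F _ (χ.lTensor _ t)) x
      = χ (tensorOp D.BHF t x) := by
  induction t using TensorProduct.induction_on with
  | zero => simp
  | add s t hs ht => simp only [map_add, LinearMap.add_apply, hs, ht]
  | tmul u v =>
    rw [tensorOp_tmul, LinearMap.lTensor_tmul, TensorProduct.rid_tmul,
      map_smul, map_smul, LinearMap.smul_apply, smul_eq_mul, smul_eq_mul, mul_comm]

omit [FiniteDimensional ℂ 𝔤] [LieAlgebra.IsSimple ℂ 𝔤] in
theorem formExt_sum {H : LieSubalgebra ℂ 𝔤} {ι : Type*} (s : Finset ι) (m : ι → ℤ)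
    (χ : ι → Module.Dual ℂ H) (x : F ⊗[ℂ] H) :
    formExt F (∑ i ∈ s, m i • χ i) x = ∑ i ∈ s, m i • formExt F (χ i) x := by
  induction x using TensorProduct.induction_on with
  | zero => simp
  | add s t hs ht => simp only [map_add, hs, ht, smul_add, Finset.sum_add_distrib]
  | tmul u v =>
    simp only [formExt, LinearMap.liftBaseChange_tmul, LinearMap.comp_apply,
      LinearMap.sum_apply, LinearMap.smul_apply, map_sum, map_zsmul, Algebra.linearMap_apply,
      Finset.smul_sum]
    exact Finset.sum_congr rfl fun i _ => smul_comm _ _ _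

/-- The operator form of `(τ(α) ⊗ id + id ⊗ α) r₀ = 0`, extended additively from `Γ₁`. It says that
`f₀ x` scales `e_α` exactly as `f₀ x - x` scales `e_{τα}`. -/
theorem formExt_f₀ {α α' : D.H.root} (h : D.triple.Ext α α') (x : F ⊗[ℂ] D.H) :
    formExt F (D.P.root α) (D.f₀ x) = formExt F (D.P.root α') (D.f₀ x - x) := by
  obtain ⟨m, h1, h2⟩ := h
  change D.P.root α = _ at h1
  change D.P.root α' = _ at h2
  rw [h1, h2, formExt_sum, formExt_sum]
  refine Finset.sum_congr rfl fun γ hγ => ?_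
  have h3 := congrArg (fun y => D.BHF y x) (D.r₀_triple γ hγ)
  simp only [map_add, LinearMap.add_apply, map_zero, LinearMap.zero_apply] at h3
  rw [BHF_lid, BHF_rid, tensorOp_comm_r₀, ← f₀] at h3
  congr 1
  rw [← neg_sub x, map_neg, eq_neg_iff_add_eq_zero, add_comm]
  exact h3

theorem BHF_dualElt (α : D.H.root) (x : F ⊗[ℂ] D.H) :
    D.BHF ((1 : F) ⊗ₜ D.dualElt α) x = formExt F (D.P.root α) x := by
  induction x using TensorProduct.induction_on with
  | zero => simp
  | add s t hs ht => simp only [map_add, hs, ht]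
  | tmul s x =>
    rw [LinearMap.BilinForm.baseChange_tmul, BH_dualElt]
    simp [formExt, Algebra.smul_def, mul_comm]

/-- The adjoint of `formExt_f₀`, obtained with `f₀* = 1 - f₀`. It accounts for the brackets `⁅e_α,
e_{-α}⁆` in the subalgebra of pairs. -/
theorem f₀_dualElt {α α' : D.H.root} (h : D.triple.Ext α α') :
    D.f₀ ((1 : F) ⊗ₜ D.dualElt α - (1 : F) ⊗ₜ D.dualElt α') = (1 : F) ⊗ₜ D.dualElt α := by
  refine sub_eq_zero.1 ((nondegenerate_baseChange F D.BH_symm D.BH_nondegenerate).1 _ fun x => ?_)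
  have key := tensorOp_comm D.BHF_symm D.r₀ x
    ((1 : F) ⊗ₜ D.dualElt α - (1 : F) ⊗ₜ D.dualElt α')
  rw [tensorOp_comm_r₀, ← f₀] at key
  have hsub : ∀ y, D.BHF ((1 : F) ⊗ₜ D.dualElt α - (1 : F) ⊗ₜ D.dualElt α') y
      = formExt F (D.P.root α) y - formExt F (D.P.root α') y := fun y => by
    rw [map_sub, LinearMap.sub_apply, BHF_dualElt, BHF_dualElt]
  have := D.formExt_f₀ h x
  rw [map_sub] at this
  rw [map_sub, LinearMap.sub_apply, BHF_dualElt, D.BHF_symm.eq, ← key, D.BHF_symm.eq, hsub,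
    map_sub, map_sub, this]
  ring

/-! #### The operator -/

/-- The operator attached to the `r`-matrix. -/
def f : F ⊗[ℂ] 𝔤 →ₗ[F] F ⊗[ℂ] 𝔤 := tensorOp D.BF D.r

theorem tensorOp_incl_eF (t : (F ⊗[ℂ] D.H) ⊗[F] (F ⊗[ℂ] D.H)) (α : D.H.root) :
    tensorOp D.BF (TensorProduct.map D.incl D.incl t) (D.eF α) = 0 := by
  induction t using TensorProduct.induction_on with
  | zero => simp
  | add s t hs ht => simp only [map_add, LinearMap.add_apply, hs, ht, add_zero]
  | tmul u v => rw [TensorProduct.map_tmul, tensorOp_tmul, BF_incl_eF, zero_smul]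

theorem tensorOp_incl_incl (t : (F ⊗[ℂ] D.H) ⊗[F] (F ⊗[ℂ] D.H)) (x : F ⊗[ℂ] D.H) :
    tensorOp D.BF (TensorProduct.map D.incl D.incl t) (D.incl x)
      = D.incl (tensorOp D.BHF t x) := by
  induction t using TensorProduct.induction_on with
  | zero => simp
  | add s t hs ht => simp only [map_add, LinearMap.add_apply, hs, ht]
  | tmul u v => rw [TensorProduct.map_tmul, tensorOp_tmul, BF_incl_incl, tensorOp_tmul, map_smul]

theorem tensorOp_tens (α β : D.H.root) (x : F ⊗[ℂ] 𝔤) :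
    tensorOp D.BF (tens F (D.e α) (D.e β)) x = D.BF (D.eF α) x • D.eF β := rfl

open Classical in
theorem r_eq : D.r = TensorProduct.map D.incl D.incl D.r₀
    + ∑ α : D.H.root with D.base.IsPos α, tens F (D.e (D.negRoot α)) (D.e α)
    + ∑ α : D.H.root, ∑ β : D.H.root with D.triple.Prec α β,
        (tens F (D.e (D.negRoot α)) (D.e β) - tens F (D.e β) (D.e (D.negRoot α))) := rfl

open Classical in
theorem f_apply (x : F ⊗[ℂ] 𝔤) : D.f x
    = tensorOp D.BF (TensorProduct.map D.incl D.incl D.r₀) x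
    + ∑ α : D.H.root with D.base.IsPos α, D.BF (D.eF (D.negRoot α)) x • D.eF α
    + ∑ α : D.H.root, ∑ β : D.H.root with D.triple.Prec α β,
        (D.BF (D.eF (D.negRoot α)) x • D.eF β - D.BF (D.eF β) x • D.eF (D.negRoot α)) := by
  simp only [f, r_eq, map_add, map_sum, map_sub, LinearMap.add_apply, LinearMap.sum_apply,
    LinearMap.sub_apply, tensorOp_tens]

theorem f_incl (x : F ⊗[ℂ] D.H) : D.f (D.incl x) = D.incl (D.f₀ x) := by
  rw [f_apply, tensorOp_incl_incl]
  simp only [BF_eF_incl, zero_smul, sub_self, Finset.sum_const_zero, add_zero]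
  rfl

theorem BF_eF (α β : D.H.root) [Decidable (α = D.negRoot β)] :
    D.BF (D.eF α) (D.eF β) = if α = D.negRoot β then 1 else 0 := by
  split_ifs with h
  · rw [h, BF_eF_negRoot]
  · refine D.BF_eF_eF_of_ne fun h' => h ?_
    rw [h', negRoot_negRoot]

theorem negRoot_injective : Function.Injective D.negRoot := fun α β h => by
  rw [← D.negRoot_negRoot α, h, negRoot_negRoot]

-- Each summand `e_{-β} ⊗ y` acts only on `e_β`. The first sum is empty unless `α` is positive, the
-- second unless `α` is negative.
open Classical in
theorem f_eF (α : D.H.root) : D.f (D.eF α)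
    = (if D.base.IsPos α then D.eF α else 0)
    + ∑ β : D.H.root with D.triple.Prec α β, D.eF β
    - ∑ γ : D.H.root with D.triple.Prec γ (D.negRoot α), D.eF (D.negRoot γ) := by
  rw [f_apply, tensorOp_incl_eF, zero_add, add_sub_assoc]
  congr 1
  · simp only [BF_eF, D.negRoot_injective.eq_iff, ite_smul, one_smul, zero_smul]
    rw [Finset.sum_ite_eq']
    simp
  · simp only [Finset.sum_sub_distrib]
    congr 1
    · simp only [BF_eF, D.negRoot_injective.eq_iff, ite_smul, one_smul, zero_smul]
      rw [Finset.sum_eq_single α]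
      · simp
      · intro β _ h
        simp [h]
      · simp
    · simp only [BF_eF, ite_smul, one_smul, zero_smul, Finset.sum_ite_eq',
        Finset.mem_filter, Finset.mem_univ, true_and, ← Finset.sum_filter]

/-- A positive root outside `Span(Γ₁)` starts no `τ`-chain, so only the standard part of `r` acts.
-/
theorem f_eF_of_pos {α : D.H.root} (h : 0 < heightOff D.base D.triple.Γ₁ α) :
    D.f (D.eF α) = D.eF α := by
  classical
  have hα := isPos_of_heightOff_pos D.base h
  rw [f_eF, if_pos hα, Finset.sum_eq_zero, Finset.sum_eq_zero, add_zero, sub_zero]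
  · intro γ hγ
    have := Prec.isPos_right D (Finset.mem_filter.1 hγ).2
    exact absurd hα (D.isPos_negRoot.1 this)
  · intro β hβ
    have := Prec.heightOff_left D (Finset.mem_filter.1 hβ).2
    exact absurd this h.ne'

/-- The opposite root is positive and outside `Span(Γ₂)`, so no `τ`-chain ends there. -/
theorem f_eF_of_neg {α : D.H.root} (h : heightOff D.base D.triple.Γ₂ α < 0) :
    D.f (D.eF α) = 0 := by
  classical
  have hα := not_isPos_of_heightOff_neg D.base h
  rw [f_eF, if_neg hα, Finset.sum_eq_zero, Finset.sum_eq_zero, add_zero, sub_zero]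
  · intro γ hγ
    have := Prec.heightOff_right D (Finset.mem_filter.1 hγ).2
    rw [heightOff_neg D.base (D.root_negRoot α)] at this
    exact absurd (neg_eq_zero.1 this) h.ne
  · intro β hβ
    exact absurd (Prec.isPos_left D (Finset.mem_filter.1 hβ).2) hα

/-- Telescoping: for positive `α` the chain after `α` is `α'` followed by the chain after `α'`; for
negative `α` the chain leading to `-α'` is the chain leading to `-α`, then `-α`. -/
theorem f_eF_sub {α α' : D.H.root} (h : D.triple.Ext α α') :
    D.f (D.eF α - D.eF α') = D.eF α := by
  classical
  rw [map_sub, f_eF, f_eF]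
  by_cases hα : D.base.IsPos α
  · have hα' := Ext.isPos D h hα
    have hz : ∀ β, D.base.IsPos β →
        ∑ γ : D.H.root with D.triple.Prec γ (D.negRoot β), D.eF (D.negRoot γ) = 0 := by
      intro β hβ
      refine Finset.sum_eq_zero fun γ hγ => ?_
      exact absurd hβ (D.isPos_negRoot.1 (Prec.isPos_right D (Finset.mem_filter.1 hγ).2))
    have hins : (Finset.univ.filter fun β => D.triple.Prec α β)
        = insert α' (Finset.univ.filter fun β => D.triple.Prec α' β) := by
      ext β
      simp [D.prec_iff_left hα h]
    rw [hz α hα, hz α' hα', if_pos hα, if_pos hα', hins, Finset.sum_insert]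
    · abel
    · simpa using D.not_prec_self α'
  · have hα' : ¬D.base.IsPos α' := fun h' => hα ((Ext.isPos_iff D h).2 h')
    have hz : ∀ β, ¬D.base.IsPos β →
        ∑ γ : D.H.root with D.triple.Prec β γ, D.eF γ = 0 := by
      intro β hβ
      refine Finset.sum_eq_zero fun γ hγ => ?_
      exact absurd (Prec.isPos_left D (Finset.mem_filter.1 hγ).2) hβ
    have hins : (Finset.univ.filter fun γ => D.triple.Prec γ (D.negRoot α'))
        = insert (D.negRoot α) (Finset.univ.filter fun γ => D.triple.Prec γ (D.negRoot α)) := by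
      ext γ
      simp [D.prec_iff_right (D.isPos_negRoot.2 hα) (Ext.neg D h)]
    rw [hz α hα, hz α' hα', if_neg hα, if_neg hα', hins, Finset.sum_insert]
    · rw [negRoot_negRoot]
      abel
    · simpa using D.not_prec_self (D.negRoot α)

/-! #### The Casimir tensor -/

-- The wedge terms are skew and cancel, and the `r₀` part symmetrizes to the Cartan Casimir tensor.
open Classical in
theorem r_add_comm : D.r + TensorProduct.comm F _ _ D.r
    = TensorProduct.map D.incl D.incl
        (∑ k, ((1 : F) ⊗ₜ[ℂ] D.t k) ⊗ₜ[F] ((1 : F) ⊗ₜ[ℂ] D.t k))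
      + ∑ α : D.H.root with D.base.IsPos α,
        (tens F (D.e (D.negRoot α)) (D.e α) + tens F (D.e α) (D.e (D.negRoot α))) := by
  have h1 : TensorProduct.comm F _ _ (TensorProduct.map D.incl D.incl D.r₀)
      = TensorProduct.map D.incl D.incl (TensorProduct.comm F _ _ D.r₀) :=
    (TensorProduct.map_comm D.incl D.incl D.r₀).symm
  have h2 : ∀ x y : 𝔤, TensorProduct.comm F _ _ (tens F x y) = tens F y x := fun x y => rfl
  rw [← D.r₀_symm, r_eq, map_add, map_add, h1, map_add, map_sum, map_sum, Finset.sum_add_distrib]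
  simp only [map_sum, map_sub, h2]
  have h3 : ∀ α : D.H.root, ∑ β : D.H.root with D.triple.Prec α β,
        (tens F (D.e β) (D.e (D.negRoot α)) - tens F (D.e (D.negRoot α)) (D.e β))
      = -∑ β : D.H.root with D.triple.Prec α β,
        (tens F (D.e (D.negRoot α)) (D.e β) - tens F (D.e β) (D.e (D.negRoot α))) := by
    intro α
    rw [← Finset.sum_neg_distrib]
    exact Finset.sum_congr rfl fun β _ => (neg_sub _ _).symm
  simp only [h3, Finset.sum_neg_distrib]
  abel

theorem tensorOp_casimir (x : F ⊗[ℂ] 𝔤) :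
    tensorOp D.BF (D.r + TensorProduct.comm F _ _ D.r) x = x := by
  classical
  set Ω := D.r + TensorProduct.comm F _ _ D.r with hΩ
  have key : LinearMap.eqLocus (tensorOp D.BF Ω) LinearMap.id = ⊤ := by
    refine D.eq_top_of_memF (fun x => ?_) (fun α => ?_)
    · rw [LinearMap.mem_eqLocus, hΩ, r_add_comm, map_add, LinearMap.add_apply,
        tensorOp_incl_incl, tensorOp_sum_t, map_sum, LinearMap.sum_apply]
      simp only [map_add, LinearMap.add_apply, tensorOp_tens, BF_eF_incl, zero_smul, add_zero,
        Finset.sum_const_zero, LinearMap.id_apply]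
    · rw [LinearMap.mem_eqLocus, hΩ, r_add_comm, map_add, LinearMap.add_apply,
        tensorOp_incl_eF, map_sum, LinearMap.sum_apply, zero_add, LinearMap.id_apply]
      simp only [map_add, LinearMap.add_apply, tensorOp_tens, Finset.sum_add_distrib, BF_eF,
        D.negRoot_injective.eq_iff, ite_smul, one_smul, zero_smul, Finset.sum_ite_eq',
        Finset.mem_filter, Finset.mem_univ, true_and, negRoot_negRoot, D.isPos_negRoot]
      by_cases hα : D.base.IsPos α <;> simp [hα]
  have hx : x ∈ LinearMap.eqLocus (tensorOp D.BF Ω) LinearMap.id := key ▸ trivial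
  exact hx

theorem f_symm (x y : F ⊗[ℂ] 𝔤) : D.BF (D.f x) y + D.BF x (D.f y) = D.BF x y := by
  rw [f, ← tensorOp_comm D.BF_symm, ← LinearMap.add_apply, ← map_add, ← LinearMap.add_apply,
    ← map_add, tensorOp_casimir]

end BDData

/-! ### The Belavin–Drinfeld `r`-matrix defines a Lie bialgebra -/

namespace BDData

variable {𝔤 : Type*} [LieRing 𝔤] [LieAlgebra ℂ 𝔤] [FiniteDimensional ℂ 𝔤]
  [LieAlgebra.IsSimple ℂ 𝔤] {F : Type*} [Field F] [Algebra ℂ F] (D : BDData 𝔤 F)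

theorem eF_lie_eF (α β : D.H.root) : ⁅D.eF α, D.eF β⁆ = 1 ⊗ₜ ⁅D.e α, D.e β⁆ := by
  rw [eF, eF, LieAlgebra.ExtendScalars.bracket_tmul, one_mul]

theorem tmul_smul_e (c : ℂ) (α : D.H.root) :
    (1 : F) ⊗ₜ[ℂ] (c • D.e α) = algebraMap ℂ F c • D.eF α := by
  rw [TensorProduct.tmul_smul, eF, algebraMap_smul]

/-- The pairs `(x₁, x₂) ∈ 𝔤(F) × 𝔤(F)` of the form `(f z, f z - z)`. -/
def graph : Submodule F ((F ⊗[ℂ] 𝔤) × (F ⊗[ℂ] 𝔤)) :=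
  LinearMap.eqLocus (D.f ∘ₗ (LinearMap.fst F _ _ - LinearMap.snd F _ _)) (LinearMap.fst F _ _)

theorem mem_graph {x₁ x₂ : F ⊗[ℂ] 𝔤} : (x₁, x₂) ∈ D.graph ↔ D.f (x₁ - x₂) = x₁ := Iff.rfl

/-- Generators of the space of pairs `(f z, f z - z)`. -/
inductive Gen : F ⊗[ℂ] 𝔤 → F ⊗[ℂ] 𝔤 → Prop
  | both {α α' : D.H.root} (h : D.triple.Ext α α') : Gen (D.eF α) (D.eF α')
  | left {α : D.H.root} (h : 0 < heightOff D.base D.triple.Γ₁ α) : Gen (D.eF α) 0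
  | right {α : D.H.root} (h : heightOff D.base D.triple.Γ₂ α < 0) : Gen 0 (D.eF α)
  | cartan (x : F ⊗[ℂ] D.H) : Gen (D.incl (D.f₀ x)) (D.incl (D.f₀ x - x))

theorem Gen.mem_graph {x₁ x₂ : F ⊗[ℂ] 𝔤} (h : D.Gen x₁ x₂) : (x₁, x₂) ∈ D.graph := by
  rw [BDData.mem_graph]
  cases h with
  | both h => exact D.f_eF_sub h
  | left h => rw [sub_zero, D.f_eF_of_pos h]
  | right h => rw [zero_sub, map_neg, D.f_eF_of_neg h, neg_zero]
  | cartan x => rw [← map_sub, sub_sub_cancel, f_incl]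

theorem smul_mem_graph {x₁ x₂ : F ⊗[ℂ] 𝔤} (c : F) (h : D.Gen x₁ x₂) :
    (c • x₁, c • x₂) ∈ D.graph := D.graph.smul_mem c (Gen.mem_graph D h)

theorem dualElt_mem_graph {α α' : D.H.root} (h : D.triple.Ext α α') :
    ((1 : F) ⊗ₜ (D.dualElt α : 𝔤), (1 : F) ⊗ₜ (D.dualElt α' : 𝔤)) ∈ D.graph := by
  rw [mem_graph]
  have := congrArg D.incl (D.f₀_dualElt h)
  rw [← f_incl, map_sub] at this
  exact this

theorem heightOff_negRoot (α : D.H.root) (Γ : Finset D.H.root) :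
    heightOff D.base Γ (D.negRoot α) = -heightOff D.base Γ α :=
  heightOff_neg D.base (D.root_negRoot α) Γ

/-- The bracket of two root vectors on which a functional `heightOff` is nonnegative and not
both zero. -/
theorem left_mem_graph {α β : D.H.root} (h : 0 < heightOff D.base D.triple.Γ₁ α)
    (h' : 0 ≤ heightOff D.base D.triple.Γ₁ β) : (⁅D.eF α, D.eF β⁆, 0) ∈ D.graph := by
  rw [eF_lie_eF]
  rcases D.lie_e_e α β with rfl | ⟨γ, hγ, c, hc⟩ | h0
  · rw [heightOff_negRoot] at h'
    lia
  · rw [hc, tmul_smul_e, ← smul_zero (algebraMap ℂ F c)]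
    refine D.smul_mem_graph _ (.left ?_)
    rw [heightOff_add D.base hγ]
    lia
  · rw [h0, TensorProduct.tmul_zero]
    exact D.graph.zero_mem

/-- Negative roots outside `Span(Γ₂)` are stable under adding a root on which `heightOff` for `Γ₂`
is nonpositive; the bracket stays in the ideal spanned by the second components. -/
theorem right_mem_graph {α β : D.H.root} (h : heightOff D.base D.triple.Γ₂ α < 0)
    (h' : heightOff D.base D.triple.Γ₂ β ≤ 0) : (0, ⁅D.eF α, D.eF β⁆) ∈ D.graph := by
  rw [eF_lie_eF]
  rcases D.lie_e_e α β with rfl | ⟨γ, hγ, c, hc⟩ | h0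
  · rw [heightOff_negRoot] at h'
    lia
  · rw [hc, tmul_smul_e, ← smul_zero (algebraMap ℂ F c)]
    refine D.smul_mem_graph _ (.right ?_)
    rw [heightOff_add D.base hγ]
    lia
  · rw [h0, TensorProduct.tmul_zero]
    exact D.graph.zero_mem

theorem both_mem_graph {α α' β β' : D.H.root} (h : D.triple.Ext α α') (h' : D.triple.Ext β β') :
    (⁅D.eF α, D.eF β⁆, ⁅D.eF α', D.eF β'⁆) ∈ D.graph := by
  rw [eF_lie_eF, eF_lie_eF]
  rcases D.lie_e_e α β with rfl | ⟨γ, hγ, c, hc⟩ | h0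
  -- Opposite roots: the bracket lands in the Cartan subalgebra, where the condition on `r₀` enters.
  · obtain rfl := Ext.functional D h' (Ext.neg D h)
    rw [lie_e_negRoot, lie_e_negRoot]
    exact D.dualElt_mem_graph h
  · have hγ0 : heightOff D.base D.triple.Γ₁ γ = 0 := by
      rw [heightOff_add D.base hγ, (Ext.heightOff D h).1, (Ext.heightOff D h').1, add_zero]
    obtain ⟨γ', hγ'⟩ := D.exists_ext hγ0
    rw [hc, D.e_compatible α β γ α' β' γ' h h' hγ' c hc, tmul_smul_e, tmul_smul_e]
    exact D.smul_mem_graph _ (.both hγ')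
  -- The vanishing of the bracket is transported by compatibility with constant `0`; the third root
  -- is a dummy, for which `α` serves.
  · have h1 := D.e_compatible α β α α' β' α' h h' h 0 (by rw [h0, zero_smul])
    rw [h0, h1, zero_smul, TensorProduct.tmul_zero]
    exact D.graph.zero_mem

/-- The subalgebra property, which is the Yang–Baxter equation. The pairs `(e_α, 0)` and `(0, e_α)`
absorb brackets with the pairs `(e_β, e_{τβ})`, and the latter are closed up to the Cartan part by
compatibility of the root vectors with `τ`. -/
theorem Gen.lie_mem_graph {x₁ x₂ y₁ y₂ : F ⊗[ℂ] 𝔤} (hx : D.Gen x₁ x₂) (hy : D.Gen y₁ y₂) :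
    (⁅x₁, y₁⁆, ⁅x₂, y₂⁆) ∈ D.graph := by
  have hswap : ∀ {x₁ x₂ y₁ y₂ : F ⊗[ℂ] 𝔤}, (⁅y₁, x₁⁆, ⁅y₂, x₂⁆) ∈ D.graph →
      (⁅x₁, y₁⁆, ⁅x₂, y₂⁆) ∈ D.graph := by
    intro x₁ x₂ y₁ y₂ h
    rw [BDData.mem_graph] at h ⊢
    rw [← lie_skew x₁, ← lie_skew x₂, ← neg_sub', map_neg, h]
  have hcartan : ∀ {y₁ y₂ : F ⊗[ℂ] 𝔤} (x : F ⊗[ℂ] D.H), D.Gen y₁ y₂ →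
      (⁅D.incl (D.f₀ x), y₁⁆, ⁅D.incl (D.f₀ x - x), y₂⁆) ∈ D.graph := by
    intro y₁ y₂ x hy
    cases hy with
    | both h =>
      rw [lie_incl_eF, lie_incl_eF, D.formExt_f₀ h]
      exact D.smul_mem_graph _ (.both h)
    | left h =>
      rw [lie_incl_eF, lie_zero, ← smul_zero (formExt F (D.P.root _) (D.f₀ x))]
      exact D.smul_mem_graph _ (.left h)
    | right h =>
      rw [lie_incl_eF, lie_zero, ← smul_zero (formExt F (D.P.root _) (D.f₀ x - x))]
      exact D.smul_mem_graph _ (.right h)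
    | cartan y =>
      rw [lie_incl_incl, lie_incl_incl]
      exact D.graph.zero_mem
  have h0 : ∀ y : F ⊗[ℂ] 𝔤, ⁅(0 : F ⊗[ℂ] 𝔤), y⁆ = 0 := fun y => zero_lie y
  have h0' : ∀ y : F ⊗[ℂ] 𝔤, ⁅y, (0 : F ⊗[ℂ] 𝔤)⁆ = 0 := fun y => lie_zero y
  cases hx with
  | cartan x => exact hcartan x hy
  | both h =>
    cases hy with
    | cartan y => exact hswap (hcartan y (.both h))
    | both h' => exact D.both_mem_graph h h'
    | left h' =>
      refine hswap ?_
      rw [h0]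
      exact D.left_mem_graph h' (Ext.heightOff D h).1.ge
    | right h' =>
      refine hswap ?_
      rw [h0]
      exact D.right_mem_graph h' (Ext.heightOff D h).2.le
  | left h =>
    cases hy with
    | cartan y => exact hswap (hcartan y (.left h))
    | both h' =>
      rw [h0]
      exact D.left_mem_graph h (Ext.heightOff D h').1.ge
    | left h' =>
      rw [h0]
      exact D.left_mem_graph h h'.le
    | right h' =>
      rw [h0, h0']
      exact D.graph.zero_mem
  | right h =>
    cases hy with
    | cartan y => exact hswap (hcartan y (.right h))
    | both h' =>
      rw [h0]
      exact D.right_mem_graph h (Ext.heightOff D h').2.le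
    | left h' =>
      rw [h0, h0']
      exact D.graph.zero_mem
    | right h' =>
      rw [h0]
      exact D.right_mem_graph h h'.le

/-- Since `z` is the difference of `f z` and `f z - z`, this says that the generators exhaust the
graph. For positive `α`, add `e_α - e_{τα}`, `e_{τα} - e_{τ²α}`, … until the chain leaves
`Span(Γ₁)`; for negative roots follow `τ` backwards until it leaves `Span(Γ₂)`. -/
theorem span_gen : Submodule.span F {z | ∃ x₁ x₂, D.Gen x₁ x₂ ∧ x₁ - x₂ = z} = ⊤ := by
  set W := Submodule.span F {z | ∃ x₁ x₂, D.Gen x₁ x₂ ∧ x₁ - x₂ = z} with hW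
  have hG : ∀ {x₁ x₂}, D.Gen x₁ x₂ → x₁ - x₂ ∈ W := fun h =>
    Submodule.subset_span ⟨_, _, h, rfl⟩
  have hpos : ∀ α, D.base.IsPos α → D.eF α ∈ W := by
    intro α
    induction α using D.wellFounded_ext.induction with
    | h α ih =>
      intro hα
      rcases (heightOff_nonneg D.base hα D.triple.Γ₁).eq_or_lt with h | h
      · obtain ⟨α', h'⟩ := D.exists_ext h.symm
        have := W.add_mem (hG (.both h')) (ih α' h' (Ext.isPos D h' hα))
        rwa [sub_add_cancel] at this
      · simpa using hG (.left h)
  have hneg : ∀ α, ¬D.base.IsPos α → D.eF α ∈ W := by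
    intro α
    induction α using D.wellFounded_ext_swap.induction with
    | h β ih =>
      intro hβ
      rcases (heightOff_nonpos D.base hβ D.triple.Γ₂).eq_or_lt with h | h
      · obtain ⟨α, h'⟩ := D.exists_ext_left h
        have := W.sub_mem (ih α h' fun hα => hβ (Ext.isPos D h' hα)) (hG (.both h'))
        rwa [sub_sub_cancel] at this
      · simpa using hG (.right h)
  refine D.eq_top_of_memF (fun x => ?_) fun α => ?_
  · have := hG (.cartan x)
    rwa [← map_sub, sub_sub_cancel] at this
  · by_cases hα : D.base.IsPos α
    · exact hpos α hα
    · exact hneg α hα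

theorem isLieCobracket_r : IsLieCobracket F (F ⊗[ℂ] 𝔤) (coboundary D.r) := by
  refine isLieCobracket_coboundary D.BF_symm
    (nondegenerate_baseChange F D.B_symm D.B_nondegenerate)
    (lieInvariant.baseChange F D.B_invariant) D.r D.f_symm
    (yangBaxter_of_span D.f _ D.span_gen ?_)
  rintro _ ⟨x₁, x₂, hx, rfl⟩ _ ⟨y₁, y₂, hy, rfl⟩
  have h1 : D.f (x₁ - x₂) = x₁ := Gen.mem_graph D hx
  have h2 : D.f (y₁ - y₂) = y₁ := Gen.mem_graph D hy
  have h3 : D.f (⁅x₁, y₁⁆ - ⁅x₂, y₂⁆) = ⁅x₁, y₁⁆ := Gen.lie_mem_graph D hx hy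
  refine ⟨⁅x₁, y₁⁆ - ⁅x₂, y₂⁆, ?_, ?_⟩
  · rw [h1, h2, h3]
  · rw [h1, h2, h3, sub_sub_cancel, sub_sub_cancel, sub_sub_cancel]

end BDData

/-! ### Transport of Lie cobrackets -/

section Transport

variable {E L : Type*} [Field E] [LieRing L] [LieAlgebra E L]

theorem map_lie_tensor (θ : L →ₗ[E] L) (hθ : ∀ x y, θ ⁅x, y⁆ = ⁅θ x, θ y⁆) (x : L)
    (t : L ⊗[E] L) : TensorProduct.map θ θ ⁅x, t⁆ = ⁅θ x, TensorProduct.map θ θ t⁆ := by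
  induction t using TensorProduct.induction_on with
  | zero => simp
  | add s t hs ht => simp only [lie_add, map_add, hs, ht]
  | tmul u v => simp [TensorProduct.LieModule.lie_tmul_right, hθ]

theorem cyc_map (θ : L →ₗ[E] L) (t : L ⊗[E] (L ⊗[E] L)) :
    cyc E L (TensorProduct.map θ (TensorProduct.map θ θ) t)
      = TensorProduct.map θ (TensorProduct.map θ θ) (cyc E L t) := by
  induction t using TensorProduct.induction_on with
  | zero => simp
  | add s t hs ht => simp only [map_add, hs, ht]
  | tmul u t =>
    induction t using TensorProduct.induction_on with
    | zero => simp
    | add s t hs ht => simp only [TensorProduct.tmul_add, map_add, hs, ht]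
    | tmul v w => simp [cyc]

theorem comm_map (θ : L →ₗ[E] L) (t : L ⊗[E] L) :
    TensorProduct.comm E L L (TensorProduct.map θ θ t)
      = TensorProduct.map θ θ (TensorProduct.comm E L L t) :=
  (TensorProduct.map_comm θ θ t).symm

theorem coboundary_cocycle (t : L ⊗[E] L) (x y : L) :
    coboundary t ⁅x, y⁆ = ⁅x, coboundary t y⁆ - ⁅y, coboundary t x⁆ := by
  simp only [coboundary_apply, lie_lie]

/-- Skewness is linear and co-Jacobi quadratic in the tensor, while the cocycle condition holds for
every coboundary. -/
theorem IsLieCobracket.smul {t : L ⊗[E] L} (h : IsLieCobracket E L (coboundary t)) (a : E) :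
    IsLieCobracket E L (coboundary (a • t)) := by
  have ha : coboundary (a • t) = a • coboundary t := map_smul _ a t
  refine ⟨fun x => ?_, fun x => ?_, coboundary_cocycle _⟩
  · rw [ha, LinearMap.smul_apply, map_smul, h.skew, smul_neg]
  · rw [ha]
    simp only [LinearMap.lTensor_smul, LinearMap.smul_apply, map_smul, ← smul_add, h.coJacobi,
      smul_zero]

theorem IsLieCobracket.map {t : L ⊗[E] L} (h : IsLieCobracket E L (coboundary t))
    (θ : L ≃ₗ⁅E⁆ L) : IsLieCobracket E L
      (coboundary (TensorProduct.map (θ : L →ₗ[E] L) (θ : L →ₗ[E] L) t)) := by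
  set θ' : L →ₗ[E] L := (θ : L →ₗ[E] L) with hθ'
  have hδ : ∀ x, coboundary (TensorProduct.map θ' θ' t) (θ' x)
      = TensorProduct.map θ' θ' (coboundary t x) := fun x =>
    (map_lie_tensor θ' (fun x y => θ.toLieHom.map_lie x y) x t).symm
  have hlT : ∀ s, (coboundary (TensorProduct.map θ' θ' t)).lTensor L (TensorProduct.map θ' θ' s)
      = TensorProduct.map θ' (TensorProduct.map θ' θ') ((coboundary t).lTensor L s) := by
    intro s
    induction s using TensorProduct.induction_on with
    | zero => simp
    | add s t hs ht => simp only [map_add, hs, ht]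
    | tmul u v => simp only [TensorProduct.map_tmul, LinearMap.lTensor_tmul, hδ]
  have hsurj : ∀ x, ∃ y, θ' y = x := θ.surjective
  refine ⟨fun x => ?_, fun x => ?_, coboundary_cocycle _⟩
  · obtain ⟨x, rfl⟩ := hsurj x
    rw [hδ, comm_map, h.skew, map_neg]
  · obtain ⟨x, rfl⟩ := hsurj x
    rw [hδ, hlT, cyc_map, cyc_map, ← map_add, ← map_add, h.coJacobi, map_zero]

end Transport

/-! ### The adjoint action -/

namespace LinAlgGroup.Corresponds

variable {n : ℕ} {G : LinAlgGroup n} {𝔤 : Type*} [LieRing 𝔤] [LieAlgebra ℂ 𝔤]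
  (c : G.Corresponds 𝔤) {S S' : Type} [Field S] [Algebra ℂ S] [Field S'] [Algebra ℂ S']

/-- This lets identities for `Ad` be checked as identities between matrices, `ιExt` being injective.
-/
theorem ιExt_lie (x y : S ⊗[ℂ] 𝔤) :
    c.ιExt S ⁅x, y⁆ = c.ιExt S x * c.ιExt S y - c.ιExt S y * c.ιExt S x := by
  induction x using TensorProduct.induction_on with
  | zero => simp
  | add x x' h h' => simp only [add_lie, map_add, h, h', add_mul, mul_add]; abel
  | tmul s x =>
    induction y using TensorProduct.induction_on with
    | zero => simp
    | add y y' h h' => simp only [lie_add, map_add, h, h', add_mul, mul_add]; abel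
    | tmul s' y =>
      rw [LieAlgebra.ExtendScalars.bracket_tmul, ιExt_tmul, ιExt_tmul, ιExt_tmul, c.map_lie,
        Matrix.map_sub _ (map_sub (algebraMap ℂ S)), Matrix.map_mul, Matrix.map_mul,
        smul_mul_smul_comm, smul_mul_smul_comm, mul_comm s' s, smul_sub]

theorem Ad_lie (X : G.points S) (x y : S ⊗[ℂ] 𝔤) :
    c.Ad S X ⁅x, y⁆ = ⁅c.Ad S X x, c.Ad S X y⁆ := by
  apply c.ιExt_injective S
  have h : ∀ A B : Matrix (Fin n) (Fin n) S, X.1.val * A * (X.1⁻¹).val * (X.1.val * B * (X.1⁻¹).val)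
      = X.1.val * (A * B) * (X.1⁻¹).val := by
    intro A B
    have h1 : (X.1⁻¹).val * X.1.val = 1 := Units.inv_mul _
    calc _ = X.1.val * A * ((X.1⁻¹).val * X.1.val) * B * (X.1⁻¹).val := by simp only [mul_assoc]
      _ = _ := by rw [h1, mul_one]; simp only [mul_assoc]
  rw [ιExt_Ad, ιExt_lie, ιExt_lie, ιExt_Ad, ιExt_Ad, h, h, mul_sub, sub_mul]

theorem Ad_mul (X Y : G.points S) (x : S ⊗[ℂ] 𝔤) :
    c.Ad S (X * Y) x = c.Ad S X (c.Ad S Y x) := by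
  apply c.ιExt_injective S
  have h1 : ((X * Y).1⁻¹).val = (Y.1⁻¹).val * (X.1⁻¹).val := by
    rw [Subgroup.coe_mul, mul_inv_rev, Units.val_mul]
  have h2 : (X * Y).1.val = X.1.val * Y.1.val := rfl
  rw [ιExt_Ad, ιExt_Ad, ιExt_Ad, h1, h2]
  simp only [mul_assoc]

theorem Ad_one (x : S ⊗[ℂ] 𝔤) : c.Ad S (1 : G.points S) x = x := by
  apply c.ιExt_injective S
  rw [ιExt_Ad]
  simp

/-- The adjoint action by automorphisms of the Lie algebra. -/
def AdEquiv (X : G.points S) : (S ⊗[ℂ] 𝔤) ≃ₗ⁅S⁆ (S ⊗[ℂ] 𝔤) :=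
  { c.Ad S X with
    map_lie' := fun {x y} => c.Ad_lie X x y
    invFun := c.Ad S X⁻¹
    left_inv := fun x => by
      change c.Ad S X⁻¹ (c.Ad S X x) = x
      rw [← Ad_mul, inv_mul_cancel, Ad_one]
    right_inv := fun x => by
      change c.Ad S X (c.Ad S X⁻¹ x) = x
      rw [← Ad_mul, mul_inv_cancel, Ad_one] }

theorem Ad₂_mul (X Y : G.points S) (t : (S ⊗[ℂ] 𝔤) ⊗[S] (S ⊗[ℂ] 𝔤)) :
    c.Ad₂ S (X * Y) t = c.Ad₂ S X (c.Ad₂ S Y t) := by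
  have h : c.Ad S (X * Y) = c.Ad S X ∘ₗ c.Ad S Y := LinearMap.ext (c.Ad_mul X Y)
  rw [Ad₂, h, TensorProduct.map_comp]
  rfl

theorem Ad₂_one (t : (S ⊗[ℂ] 𝔤) ⊗[S] (S ⊗[ℂ] 𝔤)) : c.Ad₂ S (1 : G.points S) t = t := by
  have h : c.Ad S (1 : G.points S) = LinearMap.id := LinearMap.ext c.Ad_one
  rw [Ad₂, h, TensorProduct.map_id]
  rfl

theorem Ad₂_inv_mul_eq_iff (X Y : G.points S) (t u : (S ⊗[ℂ] 𝔤) ⊗[S] (S ⊗[ℂ] 𝔤)) :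
    c.Ad₂ S (X⁻¹ * Y) t = u ↔ c.Ad₂ S Y t = c.Ad₂ S X u := by
  rw [Ad₂_mul]
  constructor
  · intro h
    rw [← h, ← Ad₂_mul, mul_inv_cancel, Ad₂_one]
  · intro h
    rw [h, ← Ad₂_mul, inv_mul_cancel, Ad₂_one]

theorem ιExt_scal₁ (φ : S →ₐ[ℂ] S') (x : S ⊗[ℂ] 𝔤) :
    c.ιExt S' (scal₁ 𝔤 φ x) = (c.ιExt S x).map φ := by
  induction x using TensorProduct.induction_on with
  | zero =>
    ext i j
    simp
  | add x y hx hy =>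
    rw [map_add, map_add, map_add, hx, hy, Matrix.map_add _ (map_add φ)]
  | tmul s x =>
    rw [scal₁_tmul, ιExt_tmul, ιExt_tmul]
    ext i j
    simp

/-- Galois equivariance: conjugation is given by polynomials over `ℂ` in the entries of `X` and
`X⁻¹`, so `σ(Ad_X x) = Ad_{σ(X)} σ(x)`. -/
theorem scal₁_Ad (φ : S →ₐ[ℂ] S') (X : G.points S) (x : S ⊗[ℂ] 𝔤) :
    scal₁ 𝔤 φ (c.Ad S X x) = c.Ad S' (G.mapPoints φ X) (scal₁ 𝔤 φ x) := by
  apply c.ιExt_injective S'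
  have h2 : ((G.mapPoints φ X).1⁻¹).val = ((X.1⁻¹).val).map φ := by
    have h : (G.mapPoints φ X)⁻¹ = G.mapPoints φ X⁻¹ := (map_inv _ _).symm
    exact congrArg (fun Z : G.points S' => Z.1.val) h
  have h1 : (G.mapPoints φ X).1.val = X.1.val.map φ := rfl
  rw [ιExt_Ad, ιExt_scal₁, ιExt_scal₁, ιExt_Ad, h1, h2, Matrix.map_mul, Matrix.map_mul]

theorem scal₂_Ad₂ (φ : S →ₐ[ℂ] S') (X : G.points S) (t : (S ⊗[ℂ] 𝔤) ⊗[S] (S ⊗[ℂ] 𝔤)) :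
    scal₂ 𝔤 φ (c.Ad₂ S X t) = c.Ad₂ S' (G.mapPoints φ X) (scal₂ 𝔤 φ t) := by
  induction t using TensorProduct.induction_on with
  | zero => simp
  | add s t hs ht => simp only [map_add, hs, ht]
  | tmul u v =>
    simp only [Ad₂, TensorProduct.map_tmul, scal₂_tmul, scal₁_Ad]

theorem Ad₂_comm (X : G.points S) (t : (S ⊗[ℂ] 𝔤) ⊗[S] (S ⊗[ℂ] 𝔤)) :
    TensorProduct.comm S _ _ (c.Ad₂ S X t) = c.Ad₂ S X (TensorProduct.comm S _ _ t) :=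
  comm_map _ _

variable [FiniteDimensional ℂ 𝔤] [LieAlgebra.IsSimple ℂ 𝔤]

/-- The Casimir tensor is invariant under the adjoint action. -/
theorem Ad₂_casimir {B : LinearMap.BilinForm ℂ 𝔤} (hs : B.IsSymm) (hB : B.Nondegenerate)
    (hi : B.lieInvariant 𝔤) {Ω : (S ⊗[ℂ] 𝔤) ⊗[S] (S ⊗[ℂ] 𝔤)}
    (hΩ : ∀ x, tensorOp (B.baseChange S) Ω x = x) (X : G.points S) : c.Ad₂ S X Ω = Ω := by
  apply tensorOp_injective (isSymm_baseChange S hs) (nondegenerate_baseChange S hs hB)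
  refine LinearMap.ext fun x => ?_
  have := tensorOp_map (c.AdEquiv X).toLinearEquiv
    (baseChange_apply_equiv S hi (c.AdEquiv X)) Ω x
  rw [hΩ, LinearEquiv.apply_symm_apply] at this
  rw [hΩ]
  exact this

end LinAlgGroup.Corresponds

/-! ### The Casimir tensor after extension of scalars -/

section CasimirScal

variable {E E' : Type*} [Field E] [Field E'] [Algebra ℂ E] [Algebra ℂ E']
  {𝔤 : Type*} [LieRing 𝔤] [LieAlgebra ℂ 𝔤] (φ : E →ₐ[ℂ] E') {B : LinearMap.BilinForm ℂ 𝔤}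

theorem baseChange_scal₁ (x y : E ⊗[ℂ] 𝔤) :
    B.baseChange E' (scal₁ 𝔤 φ x) (scal₁ 𝔤 φ y) = φ (B.baseChange E x y) := by
  induction x using TensorProduct.induction_on with
  | zero => simp
  | add x x' h h' => simp only [map_add, LinearMap.add_apply, h, h']
  | tmul s x =>
    induction y using TensorProduct.induction_on with
    | zero => simp
    | add x x' h h' => simp only [map_add, h, h']
    | tmul s' y =>
      simp only [scal₁_tmul, LinearMap.BilinForm.baseChange_tmul, map_smul, map_mul]

theorem tensorOp_scal₂ (t : (E ⊗[ℂ] 𝔤) ⊗[E] (E ⊗[ℂ] 𝔤)) (x : E ⊗[ℂ] 𝔤) :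
    tensorOp (B.baseChange E') (scal₂ 𝔤 φ t) (scal₁ 𝔤 φ x)
      = scal₁ 𝔤 φ (tensorOp (B.baseChange E) t x) := by
  induction t using TensorProduct.induction_on with
  | zero => simp
  | add x x' h h' => simp only [map_add, LinearMap.add_apply, h, h']
  | tmul u v =>
    rw [scal₂_tmul, tensorOp_tmul, tensorOp_tmul, baseChange_scal₁, map_smulₛₗ]
    rfl

theorem tensorOp_scal₂_casimir {Ω : (E ⊗[ℂ] 𝔤) ⊗[E] (E ⊗[ℂ] 𝔤)}
    (hΩ : ∀ x, tensorOp (B.baseChange E) Ω x = x) (x : E' ⊗[ℂ] 𝔤) :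
    tensorOp (B.baseChange E') (scal₂ 𝔤 φ Ω) x = x := by
  have hx : x ∈ Submodule.span E' (Set.range (scal₁ 𝔤 φ)) := by
    rw [span_range_scal₁]
    trivial
  induction hx using Submodule.span_induction with
  | mem x hx =>
    obtain ⟨x, rfl⟩ := hx
    rw [tensorOp_scal₂, hΩ]
  | zero => simp
  | add x y _ _ hx hy => rw [map_add, hx, hy]
  | smul c x _ hx => rw [map_smul, hx]

/-- The operator of `Ω` is the identity, which commutes with `ad x`. -/
theorem lie_casimir [FiniteDimensional ℂ 𝔤] (hs : B.IsSymm) (hB : B.Nondegenerate)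
    (hi : B.lieInvariant 𝔤) {Ω : (E ⊗[ℂ] 𝔤) ⊗[E] (E ⊗[ℂ] 𝔤)}
    (hΩ : ∀ x, tensorOp (B.baseChange E) Ω x = x) (x : E ⊗[ℂ] 𝔤) : ⁅x, Ω⁆ = 0 := by
  apply tensorOp_injective (isSymm_baseChange E hs) (nondegenerate_baseChange E hs hB)
  refine LinearMap.ext fun y => ?_
  rw [tensorOp_lie (lieInvariant.baseChange E hi), hΩ, hΩ, sub_self, map_zero,
    LinearMap.zero_apply]

end CasimirScal

/-! ### Twists of the coboundary by automorphisms -/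

section Module

variable {E M : Type*} [Field E] [AddCommGroup M] [Module E M]

theorem smul_sub_smul_add (a : E) (u v : M) : a • u - a • (u + v) = -a • v := by module

theorem smul_sub_smul_add_swap (a b : E) (u v u' v' : M) (h : u + v = u' + v') :
    b • u' - a • u + (b • v' - a • v) = (b - a) • (u + v) := by
  have : b • u' + b • v' = b • (u + v) := by rw [h, smul_add]
  rw [sub_add_sub_comm, this, ← smul_add, ← sub_smul]

end Module

section Twist

variable {E : Type} [Field E] [Algebra ℂ E] {𝔤 : Type*} [LieRing 𝔤] [LieAlgebra ℂ 𝔤]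
  {n : ℕ} {G : LinAlgGroup n} (c : G.Corresponds 𝔤) {φ : E →ₐ[ℂ] E}
  {r : (E ⊗[ℂ] 𝔤) ⊗[E] (E ⊗[ℂ] 𝔤)} (hr : scal₂ 𝔤 φ r = r) {a : E} (X : G.points E)

include hr

theorem scal₂_smul_Ad₂ :
    scal₂ 𝔤 φ (a • c.Ad₂ E X r) = φ a • c.Ad₂ E (G.mapPoints φ X) r := by
  rw [map_smulₛₗ, LinAlgGroup.Corresponds.scal₂_Ad₂, hr]
  rfl

theorem scal₂_smul_Ad₂_eq_iff (ha : a ≠ 0) (hφ : φ a = a) :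
    scal₂ 𝔤 φ (a • c.Ad₂ E X r) = a • c.Ad₂ E X r ↔ c.Ad₂ E (X⁻¹ * G.mapPoints φ X) r = r := by
  rw [scal₂_smul_Ad₂ c hr, hφ, LinAlgGroup.Corresponds.Ad₂_inv_mul_eq_iff]
  exact smul_right_inj ha

variable [FiniteDimensional ℂ 𝔤] [LieAlgebra.IsSimple ℂ 𝔤] {B : LinearMap.BilinForm ℂ 𝔤}
  (hs : B.IsSymm) (hB : B.Nondegenerate) (hi : B.lieInvariant 𝔤)
  (hΩ : ∀ x, tensorOp (B.baseChange E) (r + TensorProduct.comm E _ _ r) x = x)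

include hs hB hi hΩ

/-- With `s = a Ad_X r` and `Ω = Ad_X Ω`, the right side is `s - aΩ = -a Ad_X r²¹`, while the left
side is `-a Ad_{φ(X)} r`. -/
theorem scal₂_smul_Ad₂_eq_sub_iff (ha : a ≠ 0) (hφ : φ a = -a) :
    scal₂ 𝔤 φ (a • c.Ad₂ E X r) = a • c.Ad₂ E X r - a • (r + TensorProduct.comm E _ _ r) ↔
      c.Ad₂ E (X⁻¹ * G.mapPoints φ X) r = TensorProduct.comm E _ _ r := by
  have h := c.Ad₂_casimir hs hB hi hΩ X
  rw [scal₂_smul_Ad₂ c hr, hφ, LinAlgGroup.Corresponds.Ad₂_inv_mul_eq_iff, ← h, map_add]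
  exact (Eq.congr_right (smul_sub_smul_add a _ _)).trans (smul_right_inj (neg_ne_zero.2 ha))

/-- The difference is some `lΩ` by Schur. Symmetrizing `φ(s) - s` gives `(φ(a) - a)Ω`, because `Ad_Y
r + Ad_Y r²¹ = Ω` for every `Y`; on the other hand it gives `2lΩ`. -/
theorem scal₂_smul_Ad₂_of_invariant
    (h : ∀ x : 𝔤, ⁅(1 : E) ⊗ₜ[ℂ] x, scal₂ 𝔤 φ (a • c.Ad₂ E X r) - a • c.Ad₂ E X r⁆ = 0) :
    scal₂ 𝔤 φ (a • c.Ad₂ E X r)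
      = a • c.Ad₂ E X r + ((φ a - a) / 2) • (r + TensorProduct.comm E _ _ r) := by
  have : CharZero E := charZero_of_injective_algebraMap (algebraMap ℂ E).injective
  set Ω := r + TensorProduct.comm E _ _ r with hΩdef
  have hcomm : TensorProduct.comm E _ _ Ω = Ω := by
    rw [hΩdef, map_add, add_comm]
    congr 1
    exact (TensorProduct.comm E _ _).symm_apply_apply r
  have hsym : ∀ Y : G.points E, c.Ad₂ E Y r + TensorProduct.comm E _ _ (c.Ad₂ E Y r) = Ω := by
    intro Y
    rw [c.Ad₂_comm, ← map_add]
    exact c.Ad₂_casimir hs hB hi hΩ Y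
  obtain ⟨l, hl⟩ := exists_eq_smul_of_invariant hs hB hi hΩ h
  rw [← sub_eq_iff_eq_add', hl]
  have h2 : l • Ω + l • Ω = (φ a - a) • Ω := by
    have h3 := congrArg (fun t => t + TensorProduct.comm E _ _ t) hl
    simp only [map_smul, hcomm] at h3
    rw [← h3, scal₂_smul_Ad₂ c hr, map_sub, map_smul, map_smul, ← hsym X]
    exact smul_sub_smul_add_swap a (φ a) _ _ _ _ ((hsym X).trans (hsym _).symm)
  rw [div_eq_inv_mul, mul_smul, ← h2, ← two_smul E, smul_smul, inv_mul_cancel₀ two_ne_zero, one_smul]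

end Twist

/-! ### Galois descent of the cobracket -/

section Comp

variable {E₁ E₂ E₃ : Type*} [Field E₁] [Field E₂] [Field E₃] [Algebra ℂ E₁] [Algebra ℂ E₂]
  [Algebra ℂ E₃] {𝔤 : Type*} [LieRing 𝔤] [LieAlgebra ℂ 𝔤] {φ : E₁ →ₐ[ℂ] E₂} {ψ : E₂ →ₐ[ℂ] E₃}
  {χ : E₁ →ₐ[ℂ] E₃}

theorem scal₁_scal₁_eq (h : ∀ z, ψ (φ z) = χ z) (x : E₁ ⊗[ℂ] 𝔤) :
    scal₁ 𝔤 ψ (scal₁ 𝔤 φ x) = scal₁ 𝔤 χ x := by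
  obtain rfl : ψ.comp φ = χ := AlgHom.ext h
  exact scal₁_scal₁ φ ψ x

theorem scal₂_scal₂_eq (h : ∀ z, ψ (φ z) = χ z) (t : (E₁ ⊗[ℂ] 𝔤) ⊗[E₁] (E₁ ⊗[ℂ] 𝔤)) :
    scal₂ 𝔤 ψ (scal₂ 𝔤 φ t) = scal₂ 𝔤 χ t := by
  obtain rfl : ψ.comp φ = χ := AlgHom.ext h
  exact scal₂_scal₂ φ ψ t

end Comp

section Descent

variable {F E : Type*} [Field F] [Field E] [Algebra ℂ F] [Algebra ℂ E] [Algebra F E]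
  [IsScalarTower ℂ F E] {𝔤 : Type*} [LieRing 𝔤] [LieAlgebra ℂ 𝔤]

theorem scal₁_ext₁ (τ : E ≃ₐ[F] E) (x : F ⊗[ℂ] 𝔤) :
    scal₁ 𝔤 (τ.toAlgHom.restrictScalars ℂ) (ext₁ F E 𝔤 x) = ext₁ F E 𝔤 x := by
  rw [ext₁_eq_scal₁]
  exact scal₁_scal₁_eq (fun z => τ.commutes z) x

theorem scal₂_ext₂ (τ : E ≃ₐ[F] E) (t : (F ⊗[ℂ] 𝔤) ⊗[F] (F ⊗[ℂ] 𝔤)) :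
    scal₂ 𝔤 (τ.toAlgHom.restrictScalars ℂ) (ext₂ F E 𝔤 t) = ext₂ F E 𝔤 t := by
  rw [ext₂_eq_scal₂]
  exact scal₂_scal₂_eq (fun z => τ.commutes z) t

/-- A tensor over `E` comes from `F` iff its coordinates are Galois-fixed. For the tensors `⁅x, s⁆`
with `x ∈ 𝔤(F)` this means `⁅x, τ(s) - s⁆ = 0`. The cobracket axioms are inherited from `E` by
injectivity. -/
theorem definesLieBialgebra_iff
    (hfix : ∀ z : E, (∀ τ : E ≃ₐ[F] E, τ z = z) → ∃ w : F, algebraMap F E w = z)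
    {s : (E ⊗[ℂ] 𝔤) ⊗[E] (E ⊗[ℂ] 𝔤)} (hs : IsLieCobracket E (E ⊗[ℂ] 𝔤) (coboundary s)) :
    DefinesLieBialgebra F E 𝔤 s ↔ ∀ (τ : E ≃ₐ[F] E) (x : 𝔤),
      ⁅(1 : E) ⊗ₜ[ℂ] x, scal₂ 𝔤 (τ.toAlgHom.restrictScalars ℂ) s - s⁆ = 0 := by
  have hone : ∀ x : 𝔤, ext₁ F E 𝔤 (1 ⊗ₜ x) = 1 ⊗ₜ x := by
    intro x
    rw [ext₁_eq_scal₁, scal₁_tmul, map_one]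
  constructor
  · rintro ⟨δ, -, hδ⟩ τ x
    have h := hδ (1 ⊗ₜ x)
    have h' := congrArg (scal₂ 𝔤 (τ.toAlgHom.restrictScalars ℂ)) h
    rw [scal₂_ext₂, scal₂_lie, scal₁_ext₁, h] at h'
    rw [← hone, lie_sub, ← h', sub_self]
  · intro h
    have hinv : ∀ (τ : E ≃ₐ[F] E) (x : F ⊗[ℂ] 𝔤),
        scal₂ 𝔤 (τ.toAlgHom.restrictScalars ℂ) ⁅ext₁ F E 𝔤 x, s⁆ = ⁅ext₁ F E 𝔤 x, s⁆ := by
      intro τ x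
      rw [scal₂_lie, scal₁_ext₁, ← sub_eq_zero, ← lie_sub]
      rw [ext₁_eq_scal₁]
      induction x using TensorProduct.induction_on with
      | zero => simp
      | add x y hx hy => rw [map_add, add_lie, hx, hy, add_zero]
      | tmul z x =>
        have hz : z ⊗ₜ[ℂ] x = z • ((1 : F) ⊗ₜ[ℂ] x) := by simp [TensorProduct.smul_tmul']
        rw [hz, map_smulₛₗ, scal₁_tmul, map_one, smul_lie, h, smul_zero]
    have hex : ∀ x : F ⊗[ℂ] 𝔤,
        ∃ t, scal₂ 𝔤 (IsScalarTower.toAlgHom ℂ F E) t = ⁅ext₁ F E 𝔤 x, s⁆ := by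
      intro x
      refine mem_range_scal₂ _ (Module.Basis.ofVectorSpace ℂ 𝔤) _ fun i => hfix _ fun τ => ?_
      have := repr_scal₂ (τ.toAlgHom.restrictScalars ℂ) (Module.Basis.ofVectorSpace ℂ 𝔤)
        ⁅ext₁ F E 𝔤 x, s⁆ i
      rw [hinv] at this
      exact this.symm
    choose d hd using hex
    let δ : F ⊗[ℂ] 𝔤 →ₗ[F] (F ⊗[ℂ] 𝔤) ⊗[F] (F ⊗[ℂ] 𝔤) :=
      { toFun := d
        map_add' := fun x y => by
          apply scal₂_injective (IsScalarTower.toAlgHom ℂ F E)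
          rw [map_add, hd, hd, hd, map_add, add_lie]
        map_smul' := fun z x => by
          apply scal₂_injective (IsScalarTower.toAlgHom ℂ F E)
          rw [map_smulₛₗ, hd, hd, ext₁_eq_scal₁, ext₁_eq_scal₁, map_smulₛₗ, smul_lie]
          rfl }
    have hδ : ∀ x, scal₂ 𝔤 (IsScalarTower.toAlgHom ℂ F E) (δ x)
        = coboundary s (scal₁ 𝔤 (IsScalarTower.toAlgHom ℂ F E) x) := fun x => by
      rw [coboundary_apply, ← ext₁_eq_scal₁]
      exact hd x
    refine ⟨δ, IsLieCobracket.of_scal _ hδ hs, fun x => ?_⟩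
    rw [ext₂_eq_scal₂]
    exact hd x

theorem isLieCobracket_ext₂ {t : (F ⊗[ℂ] 𝔤) ⊗[F] (F ⊗[ℂ] 𝔤)}
    (h : IsLieCobracket F (F ⊗[ℂ] 𝔤) (coboundary t)) :
    IsLieCobracket E (E ⊗[ℂ] 𝔤) (coboundary (ext₂ F E 𝔤 t)) := by
  rw [ext₂_eq_scal₂]
  exact h.scal (IsScalarTower.toAlgHom ℂ F E) fun x => scal₂_lie _ _ _

theorem tensorOp_ext₂_casimir {B : LinearMap.BilinForm ℂ 𝔤} {t : (F ⊗[ℂ] 𝔤) ⊗[F] (F ⊗[ℂ] 𝔤)}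
    (h : ∀ x, tensorOp (B.baseChange F) (t + TensorProduct.comm F _ _ t) x = x) (x : E ⊗[ℂ] 𝔤) :
    tensorOp (B.baseChange E)
      (ext₂ F E 𝔤 t + TensorProduct.comm E _ _ (ext₂ F E 𝔤 t)) x = x := by
  rw [ext₂_eq_scal₂, ← scal₂_comm, ← map_add]
  exact tensorOp_scal₂_casimir _ h x

end Descent

/-! ### The Galois group -/

section Galois

theorem hbar_ne_zero : hbar ≠ 0 := HahnSeries.single_ne_zero one_ne_zero

theorem exists_algebraMap_eq_of_fixed (z : Kbar) (h : ∀ τ : Kbar ≃ₐ[K] Kbar, τ z = z) :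
    ∃ w : K, algebraMap K Kbar w = z := by
  have : CharZero K := charZero_of_injective_algebraMap (algebraMap ℂ K).injective
  have : IsGalois K Kbar := inferInstance
  exact IntermediateField.mem_bot.1 ((InfiniteGalois.mem_bot_iff_fixed z).2 h)

variable {F E : Type*} [Field F] [Field E] [Algebra F E] {y : E}

theorem apply_eq_of_mem_adjoin {τ : E ≃ₐ[F] E} (h : τ y = y) {z : E} (hz : z ∈ F⟮y⟯) :
    τ z = z := by
  induction hz using IntermediateField.adjoin_induction with
  | mem x hx =>
    obtain rfl := hx
    exact h
  | algebraMap x => exact τ.commutes x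
  | add x y _ _ hx hy => rw [map_add, hx, hy]
  | inv x _ hx => rw [map_inv₀, hx]
  | mul x y _ _ hx hy => rw [map_mul, hx, hy]

/-- Identifies the Galois group over `F⟮y⟯` with the stabilizer of `y`. -/
theorem exists_restrictScalars_eq {τ : E ≃ₐ[F] E} (h : τ y = y) :
    ∃ τ' : E ≃ₐ[F⟮y⟯] E, τ'.restrictScalars F = τ :=
  ⟨AlgEquiv.ofRingEquiv (f := τ.toRingEquiv) fun z => apply_eq_of_mem_adjoin h z.2,
    AlgEquiv.ext fun _ => rfl⟩

theorem restrictScalars_apply_gen (τ : E ≃ₐ[F⟮y⟯] E) : τ.restrictScalars F y = y :=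
  τ.commutes (⟨y, IntermediateField.mem_adjoin_simple_self F y⟩ : F⟮y⟯)

theorem apply_eq_or_eq_neg {w : F} (hy : y ^ 2 = algebraMap F E w) (τ : E ≃ₐ[F] E) :
    τ y = y ∨ τ y = -y := by
  rw [← sq_eq_sq_iff_eq_or_eq_neg, ← map_pow, hy, τ.commutes]

theorem apply_ne_of_ne_one {σ₀ : F⟮y⟯ ≃ₐ[F] F⟮y⟯} (hσ₀ : σ₀ ≠ 1) {σ : E ≃ₐ[F] E}
    (hσ : ∀ z : F⟮y⟯, σ z = σ₀ z) : σ y ≠ y := fun h =>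
  hσ₀ <| AlgEquiv.ext fun z => Subtype.ext <| by
    rw [← hσ, apply_eq_of_mem_adjoin h z.2]
    rfl

end Galois

end TwistedBD

end

theorem mainTheorem3 {𝔤 : Type*} [LieRing 𝔤] [LieAlgebra ℂ 𝔤] [FiniteDimensional ℂ 𝔤]
    [LieAlgebra.IsSimple ℂ 𝔤] {n : ℕ} {G : LinAlgGroup n} (c : G.Corresponds 𝔤)
    (D : BDData 𝔤 K) (sqrtħ : Kbar) (hsqrt : sqrtħ ^ 2 = algebraMap K Kbar hbar)
    (a : Kbar) (ha : ∃ k : K, k ≠ 0 ∧ a = algebraMap K Kbar k * sqrtħ)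
    (X : G.points Kbar)
    (σ₀ : K⟮sqrtħ⟯ ≃ₐ[K] K⟮sqrtħ⟯) (hσ₀ : σ₀ ≠ 1)
    (σ : Kbar ≃ₐ[K] Kbar) (hσ : ∀ z : K⟮sqrtħ⟯, σ z = σ₀ z) :
    DefinesLieBialgebra K Kbar 𝔤 (a • c.Ad₂ Kbar X (ext₂ K Kbar 𝔤 D.r)) ↔
      IsNontwistedCocycle c K⟮sqrtħ⟯ (ext₂ K Kbar 𝔤 D.r) X ∧
      c.Ad₂ Kbar (X⁻¹ * galAct G σ X) (ext₂ K Kbar 𝔤 D.r)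
        = TensorProduct.comm Kbar _ _ (ext₂ K Kbar 𝔤 D.r) := by
  have hsq0 : sqrtħ ≠ 0 := by
    rintro rfl
    refine hbar_ne_zero ((algebraMap K Kbar).injective ?_)
    rw [← hsqrt, map_zero, zero_pow two_ne_zero]
  obtain ⟨k, hk, rfl⟩ := ha
  set a := algebraMap K Kbar k * sqrtħ with hadef
  have ha0 : a ≠ 0 := mul_ne_zero (by simpa using hk) hsq0
  have hpos : ∀ τ : Kbar ≃ₐ[K] Kbar, τ sqrtħ = sqrtħ → τ a = a := fun τ h => by
    rw [hadef, map_mul, τ.commutes, h]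
  have hneg : ∀ τ : Kbar ≃ₐ[K] Kbar, τ sqrtħ = -sqrtħ → τ a = -a := fun τ h => by
    rw [hadef, map_mul, τ.commutes, h, mul_neg]
  -- Nontriviality of `σ₀` excludes `σ(√ħ) = √ħ`, as `√ħ` generates the quadratic field.
  have hσneg : σ sqrtħ = -sqrtħ :=
    (apply_eq_or_eq_neg hsqrt σ).resolve_left (apply_ne_of_ne_one hσ₀ hσ)
  have hr := fun τ : Kbar ≃ₐ[K] Kbar => scal₂_ext₂ τ D.r
  have hΩ : ∀ x, tensorOp (D.B.baseChange Kbar)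
      (ext₂ K Kbar 𝔤 D.r + TensorProduct.comm Kbar _ _ (ext₂ K Kbar 𝔤 D.r)) x = x :=
    tensorOp_ext₂_casimir D.tensorOp_casimir
  have hcob : IsLieCobracket Kbar (Kbar ⊗[ℂ] 𝔤)
      (coboundary (a • c.Ad₂ Kbar X (ext₂ K Kbar 𝔤 D.r))) :=
    ((isLieCobracket_ext₂ D.isLieCobracket_r).map (c.AdEquiv X)).smul a
  rw [definesLieBialgebra_iff exists_algebraMap_eq_of_fixed hcob]
  generalize hrE : ext₂ K Kbar 𝔤 D.r = r at *
  set Ω := r + TensorProduct.comm Kbar _ _ r with hΩdef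
  constructor
  · intro h
    have key := fun τ => scal₂_smul_Ad₂_of_invariant c (hr τ) X D.B_symm D.B_nondegenerate
      D.B_invariant hΩ (h τ)
    constructor
    · intro τ
      have hτ := hpos _ (restrictScalars_apply_gen τ)
      refine (scal₂_smul_Ad₂_eq_iff c (hr (τ.restrictScalars K)) X ha0 hτ).1 ?_
      rw [key]
      change _ + ((τ.restrictScalars K a - a) / 2) • _ = _
      rw [hτ, sub_self, zero_div, zero_smul, add_zero]
    · refine (scal₂_smul_Ad₂_eq_sub_iff c (hr σ) X D.B_symm D.B_nondegenerate
        D.B_invariant hΩ ha0 (hneg σ hσneg)).1 ?_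
      rw [key]
      change _ + ((σ a - a) / 2) • _ = _
      have : CharZero Kbar := charZero_of_injective_algebraMap (algebraMap ℂ Kbar).injective
      -- Here `σ(a) = -a`, so the coefficient of `Ω` in `key` becomes `-a`.
      have ha2 : (-a - a) / 2 = -a := by
        field_simp
        ring
      rw [hneg σ hσneg, ha2, sub_eq_add_neg]
      exact congrArg _ (neg_smul a Ω)
  · rintro ⟨h1, h2⟩ τ x
    have hfix : ∀ τ : Kbar ≃ₐ[K] Kbar, τ sqrtħ = sqrtħ →
        scal₂ 𝔤 (τ.toAlgHom.restrictScalars ℂ) (a • c.Ad₂ Kbar X r) = a • c.Ad₂ Kbar X r := by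
      intro τ hτ
      obtain ⟨τ', rfl⟩ := exists_restrictScalars_eq hτ
      exact (scal₂_smul_Ad₂_eq_iff c (hr (τ'.restrictScalars K)) X ha0 (hpos _ hτ)).2 (h1 τ')
    rcases apply_eq_or_eq_neg hsqrt τ with hτ | hτ
    · rw [hfix τ hτ, sub_self, lie_zero]
    -- Automorphisms negating `√ħ` form the single coset of `σ`. As `σ⁻¹τ` fixes `√ħ`, it fixes the
    -- tensor by condition 1, so `τ` acts on it as `σ` does.
    · have hτσ : τ = σ * (σ⁻¹ * τ) := by rw [mul_inv_cancel_left]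
      have hfix' := hfix (σ⁻¹ * τ) (by
        apply σ.injective
        rw [← AlgEquiv.mul_apply, ← hτσ, hτ, hσneg])
      have hτs : scal₂ 𝔤 (τ.toAlgHom.restrictScalars ℂ) (a • c.Ad₂ Kbar X r)
          = scal₂ 𝔤 (σ.toAlgHom.restrictScalars ℂ) (a • c.Ad₂ Kbar X r) := by
        conv_rhs => rw [← hfix']
        exact (scal₂_scal₂_eq (fun z => (DFunLike.congr_fun hτσ z).symm) _).symm
      -- By condition 2 the difference `τ(s) - s` is `-aΩ`, which `𝔤` annihilates.
      rw [hτs, (scal₂_smul_Ad₂_eq_sub_iff c (hr σ) X D.B_symm D.B_nondegenerate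
        D.B_invariant hΩ ha0 (hneg σ hσneg)).2 h2, sub_sub_cancel_left, lie_neg, neg_eq_zero]
      refine (lie_smul a _ Ω).trans ?_
      rw [lie_casimir D.B_symm D.B_nondegenerate D.B_invariant hΩ]
      exact smul_zero a
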